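/- **Setting.** Let $\alpha=[(1,2),\mathsf B_2,\dots,\mathsf B_m]$ be a colour ordering of $n$ massless particles, where a block $\mathsf B$ is a single adjoint particle $g$ (with $l=r=g$), or $\mathsf B=(l,\mathsf S_1,\dots,\mathsf S_s,r)$ with a fundamental particle $l$, an anti-fundamental particle $r$ of the same flavour and sub-blocks $\mathsf S_j$ ($s\ge 0$); $\mathrm{sub}[\mathsf B]=\{\mathsf S_1,\dots,\mathsf S_s\}$, all pairs have distinct flavours, and particles are numbered from left to right. The planar variables $X_{i,j}=X_{j,i}=(p_i+\dots+p_{j-1})^2$ are attached to the diagonals of the $n$-gon with vertices $1,\dots,n$ ($n+1\equiv 1$; $X_{i,i}=X_{i,i+1}=0$). The flavour line of a pair $(l,r)$ joins the edges $(l,l+1)$ and $(r,r+1)$; $X_{i,j}$ is allowed if it crosses at most one flavour line. The amplitude $A_n[\alpha]$ is the sum over all triangulations of the $n$-gon by allowed diagonals of the product of the $1/X_{i,j}$ of its $n-3$ diagonals; more generally, it is defined for any cyclic ordering of such flavoured particles. The subspace $H_n[\alpha]$ is given by $X_{i,j}=b_{i,j}$ for the forbidden variables and by $-s_{I,J}=c_{I,J}$,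 where $s_{I,J}=(P_I+P_J)^2$ and $b,c$ are arbitrary constants, for the following $(I,J)$, added block by block for $\mathsf B_m$, $m\ge2$, $\mathsf B_1=(l_1,r_1)$: (C1) $s_{\mathsf B_m,l_i}$, $s_{\mathsf B_m,r_i}$, $s_{\mathsf B_m,\mathsf I}$ with $\mathsf I\in\mathrm{sub}[\mathsf B_i]$, $1\le i\le m-1$, except $s_{\mathsf B_m,l_1}$ and $s_{\mathsf B_m,r_{m-1}}$; (C2) if $\mathsf B_m$ is not an adjoint particle, $s_{\mathsf B_i,r_m}$, $2\le i\le m-1$; (C3) if $\mathrm{sub}[\mathsf B_m]\neq\emptyset$, $s_{l_m,r_m}$, $s_{\mathsf I,r_m}$ for all $\mathsf I\in\mathrm{sub}[\mathsf B_m]$ but the last, $s_{\mathsf B_i,\mathsf I}$ for $2\le i\le m-1$ and $\mathsf I\in\mathrm{sub}[\mathsf B_m]$, and recursively the constraints of $[(-L_m,l_m),\mathrm{sub}[\mathsf B_m]]$, where $L_m$ is the momentum of $\mathsf B_m$ without $r_m$. A set of allowed variables $Y$ is called a basis (together with the constant $1$) if, for all $b,c$, its members can take arbitrary values on $H_n[\alpha]$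 and these determine all other planar variables. For a shift variable $X_0\in Y$, let $\hat X(z)$ be the point of the same subspace with $\hat X_0=zX_0$ and all other members of $Y$ unchanged, and let $A_n(z)$ be the amplitude at $\hat X(z)$. We say that the shift *gives the recursion over $F$ with prefactors $\lambda$* if at every point $X\in H_n[\alpha]$ (for all complex constants $b,c$): 1. the deformed variables are those in $F$, all allowed: $\hat X_{F_i}(z)=X_{F_i}-\lambda_{F_i}(1-z)X_0$, and all other variables are unchanged; 2. if no allowed variable vanishes at $X$, there is no pole at infinity: $A_n(z)=O(z^{-2})$ as $z\to\infty$, and the residue of $\frac{z}{z-1}A_n(z)$ at infinity is $0$; 3. in that case also, with $z_{F_i}=1-X_{F_i}/(\lambda_{F_i}X_0)$ and $$T_{F_i}=\Big(\frac1{X_{F_i}}-\frac1{\lambda_{F_i}X_0}\Big)\hat A_L(z_{F_i})\,\hat A_R(z_{F_i}),$$ the residue of $\frac{z}{z-1}A_n(z)$ at $z_{F_i}$ is $-T_{F_i}$ whenever $z_{F_j}\ne z_{F_i}$ for all $F_j\neq F_i$, and $A_n=\sum_{X_{F_i}\in F}T_{F_i}$ whenever $z_{F_i}\neq z_{F_j}$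 for any two distinct non-crossing elements of $F$. Here $\hat A_L,\hat A_R$ are the amplitudes of the two polygons into which the diagonal $F_i$ cuts the $n$-gon (the flavour of the internal particle is fixed by flavour conservation), evaluated at $\hat X(z_{F_i})$. **Theorem.** (a) Let $n=2k\ge 6$ and $\alpha=[(1,2),(3,4),\dots,(n-1,n)]$. Then $Y=\{X_{2i-1,2i+1}\}_{1\le i\le n/2}\cup\{X_{3,2j+1}\}_{3\le j\le n/2-1}$ is a basis, and the shift $X_{3,5}\to zX_{3,5}$ gives the recursion over $F=F^{(1)}\cup F^{(2)}$, where $$F^{(1)}=\{X_{3,5},X_{2,5}\}\cup\{X_{3,2i}\}_{3\le i\le n/2},\qquad F^{(2)}=\{X_{4,2j-1}\}_{1\le j\le n/2,\ j\ne 2,3},$$ with $\lambda=1$ on $F^{(1)}$ and $\lambda=-1$ on $F^{(2)}$. The recursion is closed: for every element of $F$ except $X_{3,5}$ (whose term in the sum is zero), both $\hat A_L$ and $\hat A_R$ are, up to a cyclic relabelling, amplitudes of orderings of adjacent pairs with distinct flavours, with at least $2$ and fewer than $k$ pairs. (b) Let $\alpha=[(1,2),\mathsf B_2]$ with $\mathsf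 B_2=(3,\mathsf S_1,\dots,\mathsf S_s,n)$, $s\ge 1$. Let $Y=f[(1,2),\mathsf B_2]$, where $$f[(l_1,r_1),\mathsf B_2,\dots,\mathsf B_m]=\bigcup_{i=1}^m\{X_{l_i,l_{i+1}},X_{l_i,r_i}\}\cup\bigcup_{i=4}^m\{X_{l_2,l_i}\}\cup\bigcup_{i=2}^m f[(r_i,l_i),\mathrm{sub}[\mathsf B_i]]$$ ($l_{m+1}=l_1$; the terms $f[(r_i,l_i),\mathrm{sub}[\mathsf B_i]]$ with $\mathrm{sub}[\mathsf B_i]=\emptyset$ are empty, and those $X_{i,j}$ that do not belong to a diagonal are omitted). Then $Y$ is a basis, and the shift $X_{3,n}\to zX_{3,n}$ gives the recursion over $$F=\{X_{3,n}\}\cup\bigcup_{\mathsf I\in\mathrm{sub}[\mathsf B_2]}\{X_{1,l_{\mathsf I}},X_{3,l_{\mathsf I}}\}$$ (without the edge $X_{3,4}$), with $\lambda=-1$ on the $X_{1,l_{\mathsf I}}$ and $\lambda=1$ on $X_{3,n}$ and the $X_{3,l_{\mathsf I}}$. In particular there is no pole at infinity. Moreover, every element of $F$ crosses exactly one flavour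 line, that of the pair $(3,n)$. -/

import Mathlib

open Filter Topology Asymptotics
open scoped Classical

noncomputable section

/-! ### Flavours and colour orderings

Particles are numbered `1, …, n` in the order in which they occur in the colour ordering; particle
`i` is the edge between the vertices `i` and `i + 1` of the dual `n`-gon. -/

/-- Formal integer combinations of the flavour symbols `f_r`. -/
abbrev Flavor : Type := ℕ →₀ ℤ

/-- The flavour symbol `f_r` of a fundamental particle of flavour `r`; the anti-fundamental one
has `-f_r` and an adjoint particle has `0`. -/
def fl (r : ℕ) : Flavor := Finsupp.single r 1

/-- A sequence of blocks. `adj B` is an adjoint particle followed by the blocks `B`, and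
`pair r S B` is the block `(l, S, r)`, whose enclosing particles are a fundamental and an
anti-fundamental one of flavour `r` and whose sub-blocks are `S`, followed by the blocks `B`. -/
inductive Blocks : Type
  | nil : Blocks
  | adj : Blocks → Blocks
  | pair : ℕ → Blocks → Blocks → Blocks

/-- The number of particles. -/
def Blocks.size : Blocks → ℕ
  | .nil => 0
  | .adj B => 1 + B.size
  | .pair _ S B => S.size + 2 + B.size

/-- The flavour symbols of the particles, from left to right. -/
def Blocks.word : Blocks → List Flavor
  | .nil => []
  | .adj B => 0 :: B.word
  | .pair r S B => fl r :: (S.word ++ -fl r :: B.word)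

/-- The flavours of all fundamental/anti-fundamental pairs. -/
def Blocks.flavors : Blocks → List ℕ
  | .nil => []
  | .adj B => B.flavors
  | .pair r S B => r :: (S.flavors ++ B.flavors)

/-- The sequence of adjacent pairs `(1,2), (3,4), …` with the given flavours. -/
def adjacentPairs : List ℕ → Blocks
  | [] => .nil
  | r :: rs => .pair r .nil (adjacentPairs rs)

/-! ### Planar variables, flavour conservation, amplitudes -/

/-- The diagonals `(i, j)`, `i < j`, of the `n`-gon with vertices `1, …, n`. -/
def diagonals (n : ℕ) : Finset (ℕ × ℕ) :=
  (Finset.Icc 1 n ×ˢ Finset.Icc 1 n).filter fun D => D.1 + 2 ≤ D.2 ∧ D ≠ (1, n)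

/-- Values of the planar variables: `X (i, j)` is `X_{i,j}` for `(i, j) ∈ diagonals n`; the other
entries are never used. -/
abbrev Kin : Type := ℕ × ℕ → ℂ

/-- The chord between the vertices `a` and `b`, where the vertex `n + 1` is the vertex `1`. -/
def chord (n a b : ℕ) : ℕ × ℕ :=
  let v : ℕ → ℕ := fun a => if a = n + 1 then 1 else a
  (min (v a) (v b), max (v a) (v b))

/-- The planar variable `X_{a,b} = (p_a + ⋯ + p_{b-1})²` for `1 ≤ a, b ≤ n + 1`. It vanishes if
`a = b` or if the vertices `a`, `b` are neighbours (the particles are massless). -/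
def planar (n : ℕ) (X : Kin) (a b : ℕ) : ℂ :=
  if chord n a b ∈ diagonals n then X (chord n a b) else 0

/-- The total flavour of the particles `D.1, …, D.2 - 1` on one side of the diagonal `D`. If all
pairs have distinct flavours, the coefficient of `f_r` is non-zero if and only if `D` crosses the
flavour line of the pair of flavour `r`. -/
def charge (α : List Flavor) (D : ℕ × ℕ) : Flavor := ((α.take (D.2 - 1)).drop (D.1 - 1)).sum

/-- The diagonal is allowed by flavour conservation (`ϑ = 1`). -/
def Allowed (α : List Flavor) (D : ℕ × ℕ) : Prop :=
  charge α D = 0 ∨ ∃ r, charge α D = fl r ∨ charge α D = -fl r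

/-- The two diagonals intersect in the interior of the polygon. -/
def Crossing (D E : ℕ × ℕ) : Prop :=
  (D.1 < E.1 ∧ E.1 < D.2 ∧ D.2 < E.2) ∨ (E.1 < D.1 ∧ D.1 < E.2 ∧ E.2 < D.2)

/-- The planar cubic Feynman diagrams of the ordering that respect flavour conservation, as
triangulations of the dual polygon (sets of `n - 3` pairwise non-crossing diagonals). -/
def feynmanDiagrams (α : List Flavor) : Finset (Finset (ℕ × ℕ)) :=
  ((diagonals α.length).powersetCard (α.length - 3)).filter fun T =>
    (∀ D ∈ T, Allowed α D) ∧ ∀ D ∈ T, ∀ E ∈ T, ¬ Crossing D E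

/-- The amplitude `A_n[α]` at the kinematic point `X`. -/
def amplitude (α : List Flavor) (X : Kin) : ℂ :=
  ∑ T ∈ feynmanDiagrams α, ∏ D ∈ T, (X D)⁻¹

/-! The two factors of the channel `D = (i, j)`: the left one has the particles `i, …, j - 1, q`
and lives on the polygon with vertices `i, …, j`; the right one has the particles
`1, …, i - 1, -q, j, …, n` and lives on the polygon with vertices `1, …, i, j, …, n`. The flavour of
the internal particle `q` is fixed by flavour conservation. -/

def leftOrdering (α : List Flavor) (D : ℕ × ℕ) : List Flavor :=
  (α.take (D.2 - 1)).drop (D.1 - 1) ++ [-charge α D]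

def leftKin (D : ℕ × ℕ) (X : Kin) : Kin := fun E => X (E.1 + D.1 - 1, E.2 + D.1 - 1)

def rightOrdering (α : List Flavor) (D : ℕ × ℕ) : List Flavor :=
  α.take (D.1 - 1) ++ charge α D :: α.drop (D.2 - 1)

def rightKin (D : ℕ × ℕ) (X : Kin) : Kin :=
  let v : ℕ → ℕ := fun a => if a ≤ D.1 then a else a + (D.2 - D.1) - 1
  fun E => X (v E.1, v E.2)

/-! ### The subspace `H_n[α]`

A set of consecutive particles `a, …, b - 1` is written as the interval `(a, b)`. A pair of disjoint
intervals `I`, `J`, with `I` to the left of `J`, stands for the Mandelstam variable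
`s_{I,J} = (P_I + P_J)²`. -/

/-- `s_{I,J} = (P_I + P_J)² = P_I² + P_J² + 2 P_I · P_J` in terms of planar variables, where
`I = {a, …, b - 1}`, `J = {c, …, d - 1}` and `a < b ≤ c < d`. -/
def mandelstam (n : ℕ) (X : Kin) (p : (ℕ × ℕ) × (ℕ × ℕ)) : ℂ :=
  let a := p.1.1
  let b := p.1.2
  let c := p.2.1
  let d := p.2.2
  planar n X a b + planar n X c d +
    (planar n X a d + planar n X b c - planar n X a c - planar n X b d)

/-- The particles at the two ends of a block (equal for an adjoint particle) and the intervals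
occupied by its sub-blocks. -/
structure BlockPos where
  l : ℕ
  r : ℕ
  sub : List (ℕ × ℕ)

/-- A single particle as an interval. -/
def pt (a : ℕ) : ℕ × ℕ := (a, a + 1)

/-- All particles of a block as an interval. -/
def BlockPos.all (b : BlockPos) : ℕ × ℕ := (b.l, b.r + 1)

/-- The intervals occupied by the outermost blocks if the first particle is number `a`. -/
def Blocks.intervals (a : ℕ) : Blocks → List (ℕ × ℕ)
  | .nil => []
  | .adj B => pt a :: B.intervals (a + 1)
  | .pair _ S B => (a, a + S.size + 2) :: B.intervals (a + S.size + 2)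

/-- The block `(l, S, r)` with `l = a`. -/
def pairPos (a : ℕ) (S : Blocks) : BlockPos := ⟨a, a + S.size + 1, S.intervals (a + 1)⟩

/-- The positions of the outermost blocks if the first particle is number `a`. -/
def Blocks.positions (a : ℕ) : Blocks → List BlockPos
  | .nil => []
  | .adj B => ⟨a, a, []⟩ :: B.positions (a + 1)
  | .pair _ S B => pairPos a S :: B.positions (a + S.size + 2)

/-! In the following three sets the earlier blocks are the pair `B_1 = (l_1, r_1)`, of which only
`r_1` enters, and `prev = [B_2, …, B_{m-1}]`. -/

/-- `C_1`: the variables `s_{q,l_i}`, `s_{q,r_i}` and `s_{q,I}`, `I ∈ sub[B_i]`, for `1 ≤ i ≤ m - 1`,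
except `s_{q,l_1}` and `s_{q,r_{m-1}}`. -/
def C1 (r₁ : ℕ) (prev : List BlockPos) (q : ℕ × ℕ) : Set ((ℕ × ℕ) × (ℕ × ℕ)) :=
  {p | p.2 = q ∧
    (p.1 = pt r₁ ∨ ∃ b ∈ prev, p.1 = pt b.l ∨ p.1 = pt b.r ∨ p.1 ∈ b.sub) ∧
    p.1 ≠ pt ((prev.getLast?.map BlockPos.r).getD r₁)}

/-- `C_2`: the variables `s_{B_i,r_m}` for `2 ≤ i ≤ m - 1`. -/
def C2 (prev : List BlockPos) (b : BlockPos) : Set ((ℕ × ℕ) × (ℕ × ℕ)) :=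
  {p | (∃ b' ∈ prev, p.1 = b'.all) ∧ p.2 = pt b.r}

/-- `C_3`, for a block `B_m` with at least one sub-block: the variables `s_{l_m,r_m}`, the variables
`s_{I,r_m}` for all sub-blocks `I` of `B_m` but the last one, and the variables `s_{B_i,I}` for all
sub-blocks `I` of `B_m` and `2 ≤ i ≤ m - 1`. -/
def C3 (prev : List BlockPos) (b : BlockPos) : Set ((ℕ × ℕ) × (ℕ × ℕ)) :=
  {p | b.sub ≠ [] ∧ (p = (pt b.l, pt b.r) ∨ (p.1 ∈ b.sub.dropLast ∧ p.2 = pt b.r) ∨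
    ∃ b' ∈ prev, p.1 = b'.all ∧ p.2 ∈ b.sub)}

/-- The constrained variables that come with the blocks `B_m, B_{m+1}, …` (which start at particle
`a`) in an ordering `[(l_1, r_1), B_2, …, B_{m-1}, B_m, B_{m+1}, …]`. A block with sub-blocks `S` also
contributes the constraints of the ordering `[(-L, l), S]`, where `-L` is an off-shell particle. -/
def constraintsFrom (r₁ : ℕ) (prev : List BlockPos) (a : ℕ) : Blocks → Set ((ℕ × ℕ) × (ℕ × ℕ))
  | .nil => ∅
  | .adj B => C1 r₁ prev (pt a) ∪ constraintsFrom r₁ (prev ++ [⟨a, a, []⟩]) (a + 1) B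
  | .pair _ S B =>
      C1 r₁ prev (pairPos a S).all ∪ C2 prev (pairPos a S) ∪ C3 prev (pairPos a S) ∪
        constraintsFrom a [] (a + 1) S ∪
        constraintsFrom r₁ (prev ++ [pairPos a S]) (a + S.size + 2) B

/-- The flavour symbols of the ordering `[(1,2), B_2, …, B_m]`. -/
def ordering (r₁ : ℕ) (B : Blocks) : List Flavor := (Blocks.pair r₁ .nil B).word

/-- The Mandelstam variables that are set to (minus) constants on `H_n[(1,2), B_2, …, B_m]`. -/
def constraints (B : Blocks) : Set ((ℕ × ℕ) × (ℕ × ℕ)) := constraintsFrom 2 [] 3 B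

/-- `X` lies on the subspace given by `-s_{I,J} = c_{I,J}` for the variables in `H` and
`X_{i,j} = b_{i,j}` for the variables forbidden by flavour conservation. -/
def OnSubspace (α : List Flavor) (H : Set ((ℕ × ℕ) × (ℕ × ℕ)))
    (c : (ℕ × ℕ) × (ℕ × ℕ) → ℂ) (b : ℕ × ℕ → ℂ) (X : Kin) : Prop :=
  (∀ p ∈ H, -mandelstam α.length X p = c p) ∧
    ∀ D ∈ diagonals α.length, ¬ Allowed α D → X D = b D

/-! ### Bases and one-variable shifts -/

/-- The constant `1` and the planar variables in `Y` (allowed by flavour conservation) form a basis: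
for any constants they can take arbitrary values on the subspace, and these values determine all
planar variables. -/
def IsPlanarBasis (α : List Flavor) (H : Set ((ℕ × ℕ) × (ℕ × ℕ))) (Y : Set (ℕ × ℕ)) : Prop :=
  (∀ D ∈ Y, D ∈ diagonals α.length ∧ Allowed α D) ∧
    ∀ (c : (ℕ × ℕ) × (ℕ × ℕ) → ℂ) (b : ℕ × ℕ → ℂ) (y : ℕ × ℕ → ℂ),
      ∃ X : Kin, OnSubspace α H c b X ∧ (∀ D ∈ Y, X D = y D) ∧
        ∀ X' : Kin, OnSubspace α H c b X' → (∀ D ∈ Y, X' D = y D) →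
          ∀ D ∈ diagonals α.length, X' D = X D

/-- `Xh z` is the point to which `X` is deformed by the shift `X_{D₀} → z X_{D₀}`, with all constants
and all other variables in the basis `Y` fixed. -/
def IsShift (α : List Flavor) (H : Set ((ℕ × ℕ) × (ℕ × ℕ))) (c : (ℕ × ℕ) × (ℕ × ℕ) → ℂ)
    (b : ℕ × ℕ → ℂ) (Y : Set (ℕ × ℕ)) (D₀ : ℕ × ℕ) (X : Kin) (Xh : ℂ → Kin) : Prop :=
  ∀ z : ℂ, OnSubspace α H c b (Xh z) ∧ Xh z D₀ = z * X D₀ ∧ ∀ D ∈ Y, D ≠ D₀ → Xh z D = X D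

/-- `z / (z - 1) * A z` has no pole at infinity (as a differential form in `z`), and its residue there
vanishes. -/
def NoPoleAtInfinity (A : ℂ → ℂ) : Prop :=
  (A =O[cocompact ℂ] fun z => (z ^ 2)⁻¹) ∧
    ∀ᶠ R : ℝ in atTop, (∮ z in C(0, R), z / (z - 1) * A z) = 0

/-- The position `z_D` of the pole of the channel `D`. -/
def polePos (lam : ℕ × ℕ → ℂ) (D₀ : ℕ × ℕ) (X : Kin) (D : ℕ × ℕ) : ℂ :=
  1 - X D / (lam D * X D₀)

/-- The contribution `(1 / X_D - 1 / (λ_D X_{D₀})) * Â_L(z_D) * Â_R(z_D)` of the channel `D`. -/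
def channelTerm (α : List Flavor) (lam : ℕ × ℕ → ℂ) (D₀ : ℕ × ℕ) (X : Kin) (Xh : ℂ → Kin)
    (D : ℕ × ℕ) : ℂ :=
  (1 / X D - 1 / (lam D * X D₀)) *
    amplitude (leftOrdering α D) (leftKin D (Xh (polePos lam D₀ X D))) *
    amplitude (rightOrdering α D) (rightKin D (Xh (polePos lam D₀ X D)))

/-- The one-variable shift of `X_{D₀}` in the basis `Y` gives a recursion for the amplitude: the
deformed propagators are those in `F`, with prefactors `lam`; there is no pole at infinity; the
residues at the finite poles are given by products of amplitudes with fewer particles; and the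
amplitude is the sum of the contributions of these poles. -/
def IsRecursion (α : List Flavor) (H : Set ((ℕ × ℕ) × (ℕ × ℕ))) (Y : Set (ℕ × ℕ)) (D₀ : ℕ × ℕ)
    (F : Finset (ℕ × ℕ)) (lam : ℕ × ℕ → ℂ) : Prop :=
  (∀ D ∈ F, D ∈ diagonals α.length ∧ Allowed α D) ∧
  ∀ (c : (ℕ × ℕ) × (ℕ × ℕ) → ℂ) (b : ℕ × ℕ → ℂ) (X : Kin), OnSubspace α H c b X →
    (∃ Xh, IsShift α H c b Y D₀ X Xh) ∧
    ∀ Xh, IsShift α H c b Y D₀ X Xh →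
      (∀ z, ∀ D ∈ F, Xh z D = X D - lam D * (1 - z) * X D₀) ∧
      (∀ z, ∀ D ∈ diagonals α.length, D ∉ F → Xh z D = X D) ∧
      ((∀ D ∈ diagonals α.length, Allowed α D → X D ≠ 0) →
        NoPoleAtInfinity (fun z => amplitude α (Xh z)) ∧
        (∀ D ∈ F, (∀ E ∈ F, E ≠ D → polePos lam D₀ X E ≠ polePos lam D₀ X D) →
          Tendsto (fun z => (z - polePos lam D₀ X D) * (z / (z - 1) * amplitude α (Xh z)))
            (𝓝[≠] polePos lam D₀ X D) (𝓝 (-channelTerm α lam D₀ X Xh D))) ∧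
        ((∀ D ∈ F, ∀ E ∈ F, D ≠ E → ¬ Crossing D E → polePos lam D₀ X D ≠ polePos lam D₀ X E) →
          amplitude α X = ∑ D ∈ F, channelTerm α lam D₀ X Xh D))

/-! ### Adjacent pairs `[(1,2), (3,4), …, (2k-1,2k)]` -/

/-- `X_{2i-1,2i+1}`, `1 ≤ i ≤ k`, and `X_{3,2j+1}`, `3 ≤ j ≤ k - 1`. -/
def adjacentBasis (k : ℕ) : Set (ℕ × ℕ) :=
  {D | (∃ i, 1 ≤ i ∧ i ≤ k ∧ D = chord (2 * k) (2 * i - 1) (2 * i + 1)) ∨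
    ∃ j, 3 ≤ j ∧ j ≤ k - 1 ∧ D = (3, 2 * j + 1)}

/-- `X_{3,5}`, `X_{2,5}` and `X_{3,2i}`, `3 ≤ i ≤ k`. -/
def adjacentF1 (k : ℕ) : Finset (ℕ × ℕ) :=
  {(3, 5), (2, 5)} ∪ (Finset.Icc 3 k).image fun i => (3, 2 * i)

/-- `X_{4,2j-1}`, `1 ≤ j ≤ k`, without the edges `X_{4,3}` and `X_{4,5}` of the polygon. -/
def adjacentF2 (k : ℕ) : Finset (ℕ × ℕ) :=
  ((Finset.Icc 1 k).image fun j => chord (2 * k) 4 (2 * j - 1)) ∩ diagonals (2 * k)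

def adjacentLam (k : ℕ) (D : ℕ × ℕ) : ℂ :=
  if D ∈ adjacentF1 k then 1 else if D ∈ adjacentF2 k then -1 else 0

/-- `β` is, up to a cyclic rotation, an ordering of adjacent pairs with distinct flavours, of which
there are at least two and less than `k`; its amplitude is the amplitude of that ordering, with the
polygon relabelled accordingly. -/
def IsLowerAdjacent (k : ℕ) (β : List Flavor) : Prop :=
  ∃ (rs : List ℕ) (t : ℕ), rs.Nodup ∧ 2 ≤ rs.length ∧ rs.length < k ∧
    β.rotate t = (adjacentPairs rs).word ∧
    ∀ X : Kin, amplitude β X = amplitude (adjacentPairs rs).word fun E =>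
      X (chord β.length ((E.1 - 1 + t) % β.length + 1) ((E.2 - 1 + t) % β.length + 1))

/-! ### Preferred bases and the orderings `[(1,2), B_2]` -/

/-- The part of the preferred basis of `[(l_1,r_1), B_2, …, B_m]` that comes from the outermost blocks:
`X_{l_i,l_{i+1}}` (with `l_{m+1} = l_1`) and `X_{l_i,r_i}` for `1 ≤ i ≤ m`, and `X_{l_2,l_i}` for
`4 ≤ i ≤ m`. -/
def basisLevel (n l₁ r₁ : ℕ) (bs : List BlockPos) : Set (ℕ × ℕ) :=
  let ls := l₁ :: bs.map BlockPos.l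
  {D | (∃ i < ls.length, D = chord n (ls.getD i 0) (ls.getD ((i + 1) % ls.length) 0)) ∨
    D = chord n l₁ r₁ ∨ (∃ b ∈ bs, D = chord n b.l b.r) ∨
    ∃ i < ls.length, 3 ≤ i ∧ D = chord n (ls.getD 1 0) (ls.getD i 0)}

/-- The parts that come from the sub-blocks: a block `(l, S, r)` contributes the preferred basis of
`[(r, l), S]`, which is empty if there are no sub-blocks `S`. -/
def basisSub (n a : ℕ) : Blocks → Set (ℕ × ℕ)
  | .nil => ∅
  | .adj B => basisSub n (a + 1) B
  | .pair _ S B =>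
      {D | S ≠ .nil ∧ D ∈ basisLevel n (a + S.size + 1) a (S.positions (a + 1))} ∪
        basisSub n (a + 1) S ∪ basisSub n (a + S.size + 2) B

/-- The preferred basis of `[(1,2), B_2, …, B_m]` (edges of the polygon are no variables). -/
def preferredBasis (B : Blocks) : Set (ℕ × ℕ) :=
  {D | D ∈ diagonals (B.size + 2) ∧
    (D ∈ basisLevel (B.size + 2) 1 2 (B.positions 3) ∨ D ∈ basisSub (B.size + 2) 3 B)}

/-- `X_{1,l_I}` for the sub-blocks `I` of `B_2 = (3, S, n)`. -/
def twoBlockF1 (S : Blocks) : Finset (ℕ × ℕ) :=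
  ((S.intervals 4).map fun I => (1, I.1)).toFinset

/-- `X_{3,n}` and `X_{3,l_I}` for the sub-blocks `I` of `B_2 = (3, S, n)`, without the edge `X_{3,4}`
of the polygon. -/
def twoBlockF3 (S : Blocks) : Finset (ℕ × ℕ) :=
  {(3, S.size + 4)} ∪ (((S.intervals 4).map fun I => (3, I.1)).toFinset ∩ diagonals (S.size + 4))

def twoBlockLam (S : Blocks) (D : ℕ × ℕ) : ℂ :=
  if D ∈ twoBlockF1 S then -1 else if D ∈ twoBlockF3 S then 1 else 0

end

open Filter Topology Asymptotics
open scoped Classical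

noncomputable section

/-! ### Triangulations and the cut along a diagonal -/

/-! The shift moves the point along a fixed direction: the solution of the homogeneous constraints
that is 1 on the shifted diagonal D₀ and 0 on the rest of the basis. It equals `lam` on F and 0
elsewhere, so in A_n(z) a triangulation T contributes a constant times the product of 1/(λ_D X₀ (z -
z_D)) over D in T ∩ F. Every triangulation meets F, and those with at least two diagonals in F decay
like z⁻². If T ∩ F = {D}, the coefficient of 1/z is λ_D/X₀ times the other propagators. Flipping D ≠
D₀ to D₀ keeps these propagators and reverses the sign, and it is a bijection, so the coefficients
of 1/z cancel (`FlipShift.cancel`). Hence there is no pole and no residue at infinity.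

The recursion is proved triangulation by triangulation. Cutting along D identifies the product of
the two smaller amplitudes with the sum over the triangulations that contain D
(`amplitude_mul_amplitude`), and partial fractions (`sum_residues`) recover the term of T if |T ∩ F|
≥ 2. If |T ∩ F| = 1 the defect is again the coefficient of 1/z, which cancels in the sum.
`FlipShift` isolates the combinatorial input, and `FlipShift.isRecursion` draws the conclusion.

That Y is a basis is a statement about a square linear system. `embeds_constraints` injects the
constraints into the allowed variables outside Y, and `vanishes_of_constraints` shows by induction
over the blocks that the homogeneous system has only the zero solution; injectivity then gives
solvability (`isPlanarBasis_of_embeds`). Flavour conditions are treated through heights: the charge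
of a diagonal is the difference of the heights of its ends, and the height of a vertex records the
flavour lines around it.

It remains to verify `FlipShift`. For [(1,2), B₂] the set F consists of all allowed diagonals
between {1,2,3} and {4,…,n}. For adjacent pairs an even vertex is joined to odd ones only, and every
allowed diagonal across X_{3,5} ends at the vertex 4 and is a negative element of F. The recursion
closes for adjacent pairs because the internal particle replaces the missing partner of the pair
that the channel cuts. -/

theorem mem_diagonals {n : ℕ} {D : ℕ × ℕ} :
    D ∈ diagonals n ↔ 1 ≤ D.1 ∧ D.2 ≤ n ∧ D.1 + 2 ≤ D.2 ∧ (D.1 = 1 → D.2 ≠ n) := by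
  obtain ⟨a, b⟩ := D
  simp only [diagonals, Finset.mem_filter, Finset.mem_product, Finset.mem_Icc, ne_eq,
    Prod.mk.injEq, not_and]
  omega

/-- A set of pairwise non-crossing chords. -/
def NonCrossing (T : Finset (ℕ × ℕ)) : Prop := ∀ D ∈ T, ∀ E ∈ T, ¬ Crossing D E

theorem crossing_comm {D E : ℕ × ℕ} : Crossing D E ↔ Crossing E D := by
  simp only [Crossing]; tauto

theorem not_crossing_self (D : ℕ × ℕ) : ¬ Crossing D D := by
  simp only [Crossing]; omega

theorem NonCrossing.mono {S T : Finset (ℕ × ℕ)} (h : NonCrossing T) (hS : S ⊆ T) :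
    NonCrossing S := fun D hD E hE => h D (hS hD) E (hS hE)

theorem NonCrossing.insert {T : Finset (ℕ × ℕ)} {D : ℕ × ℕ} (h : NonCrossing T)
    (hD : ∀ E ∈ T, ¬ Crossing D E) : NonCrossing (insert D T) := by
  intro E hE E' hE'
  rw [Finset.mem_insert] at hE hE'
  rcases hE with rfl | hE <;> rcases hE' with rfl | hE'
  · exact not_crossing_self _
  · exact hD _ hE'
  · rw [crossing_comm]; exact hD _ hE
  · exact h _ hE _ hE'

/-- The chord of the big polygon that corresponds to a chord of the polygon left of `D`. -/
def leftDiag (D E : ℕ × ℕ) : ℕ × ℕ := (E.1 + D.1 - 1, E.2 + D.1 - 1)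

/-- The vertex of the big polygon that corresponds to a vertex of the polygon right of `D`. -/
def rightVertex (D : ℕ × ℕ) (a : ℕ) : ℕ := if a ≤ D.1 then a else a + (D.2 - D.1) - 1

/-- The chord of the big polygon that corresponds to a chord of the polygon right of `D`. -/
def rightDiag (D E : ℕ × ℕ) : ℕ × ℕ := (rightVertex D E.1, rightVertex D E.2)

theorem leftDiag_injOn (D : ℕ × ℕ) {m : ℕ} : Set.InjOn (leftDiag D) (diagonals m) := by
  intro E hE E' hE' h
  simp only [Finset.mem_coe, mem_diagonals] at hE hE'
  simp only [leftDiag, Prod.mk.injEq] at h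
  ext <;> omega

theorem rightVertex_lt {D : ℕ × ℕ} (hD : D.1 + 2 ≤ D.2) {a b : ℕ} :
    rightVertex D a < rightVertex D b ↔ a < b := by
  simp only [rightVertex]; split_ifs <;> omega

theorem rightVertex_inj {D : ℕ × ℕ} (hD : D.1 + 2 ≤ D.2) {a b : ℕ} :
    rightVertex D a = rightVertex D b ↔ a = b := by
  simp only [rightVertex]; split_ifs <;> omega

theorem rightDiag_injective {D : ℕ × ℕ} (hD : D.1 + 2 ≤ D.2) :
    Function.Injective (rightDiag D) := by
  intro E E' h
  simp only [rightDiag, Prod.mk.injEq, rightVertex_inj hD] at h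
  exact Prod.ext h.1 h.2

theorem crossing_rightDiag {D : ℕ × ℕ} (hD : D.1 + 2 ≤ D.2) {E E' : ℕ × ℕ} :
    Crossing (rightDiag D E) (rightDiag D E') ↔ Crossing E E' := by
  simp only [Crossing, rightDiag, rightVertex_lt hD]

theorem crossing_leftDiag {D : ℕ × ℕ} {m : ℕ} {E E' : ℕ × ℕ}
    (hE : E ∈ diagonals m) (hE' : E' ∈ diagonals m) :
    Crossing (leftDiag D E) (leftDiag D E') ↔ Crossing E E' := by
  rw [mem_diagonals] at hE hE'
  simp only [Crossing, leftDiag]; omega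

theorem leftDiag_spec {n : ℕ} {D E : ℕ × ℕ} (hD : D ∈ diagonals n)
    (hE : E ∈ diagonals (D.2 - D.1 + 1)) :
    leftDiag D E ∈ diagonals n ∧ leftDiag D E ≠ D ∧
      D.1 ≤ (leftDiag D E).1 ∧ (leftDiag D E).2 ≤ D.2 := by
  rw [mem_diagonals] at *
  obtain ⟨a, b⟩ := D
  simp only [leftDiag, ne_eq, Prod.mk.injEq] at *
  omega

/-- The right polygon contains the vertices `1` and `n`, so its chords may lie before `D`, after `D`
or around it, whereas those of the left polygon stay between the ends of `D`. -/
theorem rightDiag_spec {n : ℕ} {D E : ℕ × ℕ} (hD : D ∈ diagonals n)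
    (hE : E ∈ diagonals (n - (D.2 - D.1) + 1)) :
    rightDiag D E ∈ diagonals n ∧ rightDiag D E ≠ D ∧
      ((rightDiag D E).2 ≤ D.1 ∨ D.2 ≤ (rightDiag D E).1 ∨
        ((rightDiag D E).1 ≤ D.1 ∧ D.2 ≤ (rightDiag D E).2)) := by
  rw [mem_diagonals] at *
  obtain ⟨a, b⟩ := D
  simp only [rightDiag, rightVertex, ne_eq, Prod.mk.injEq] at *
  split_ifs <;> omega

theorem exists_leftDiag {n : ℕ} {D E : ℕ × ℕ} (hD : D ∈ diagonals n) (hE : E ∈ diagonals n)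
    (hne : E ≠ D) (h1 : D.1 ≤ E.1) (h2 : E.2 ≤ D.2) :
    ∃ E' ∈ diagonals (D.2 - D.1 + 1), leftDiag D E' = E := by
  refine ⟨(E.1 + 1 - D.1, E.2 + 1 - D.1), ?_, ?_⟩
  · rw [mem_diagonals] at *
    have : ¬ (E.1 = D.1 ∧ E.2 = D.2) := fun h => hne (Prod.ext h.1 h.2)
    simp only; omega
  · rw [mem_diagonals] at *
    ext <;> simp only [leftDiag] <;> omega

theorem exists_rightDiag {n : ℕ} {D E : ℕ × ℕ} (hD : D ∈ diagonals n) (hE : E ∈ diagonals n)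
    (hne : E ≠ D) (h : E.2 ≤ D.1 ∨ D.2 ≤ E.1 ∨ (E.1 ≤ D.1 ∧ D.2 ≤ E.2)) :
    ∃ E' ∈ diagonals (n - (D.2 - D.1) + 1), rightDiag D E' = E := by
  have hne' : ¬ (E.1 = D.1 ∧ E.2 = D.2) := fun h => hne (Prod.ext h.1 h.2)
  refine ⟨(if E.1 ≤ D.1 then E.1 else E.1 + 1 - (D.2 - D.1),
    if E.2 ≤ D.1 then E.2 else E.2 + 1 - (D.2 - D.1)), ?_, ?_⟩
  · rw [mem_diagonals] at *
    simp only; split_ifs <;> omega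
  · rw [mem_diagonals] at *
    ext <;> simp only [rightDiag, rightVertex] <;> split_ifs <;> omega

/-- The part of `T` on the left of `D`. -/
def leftPart (D : ℕ × ℕ) (T : Finset (ℕ × ℕ)) : Finset (ℕ × ℕ) :=
  (diagonals (D.2 - D.1 + 1)).filter fun E => leftDiag D E ∈ T

/-- The part of `T` on the right of `D`. -/
def rightPart (n : ℕ) (D : ℕ × ℕ) (T : Finset (ℕ × ℕ)) : Finset (ℕ × ℕ) :=
  (diagonals (n - (D.2 - D.1) + 1)).filter fun E => rightDiag D E ∈ T

theorem leftPart_subset (D : ℕ × ℕ) (T : Finset (ℕ × ℕ)) :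
    leftPart D T ⊆ diagonals (D.2 - D.1 + 1) := Finset.filter_subset _ _

theorem rightPart_subset (n : ℕ) (D : ℕ × ℕ) (T : Finset (ℕ × ℕ)) :
    rightPart n D T ⊆ diagonals (n - (D.2 - D.1) + 1) := Finset.filter_subset _ _

/-- A chord between the ends of `D` that is also before, after or around `D` is degenerate or `D`
itself, and `D` is in neither image. -/
theorem disjoint_leftDiag_rightDiag {n : ℕ} {D : ℕ × ℕ} (hD : D ∈ diagonals n)
    {L R : Finset (ℕ × ℕ)} (hL : L ⊆ diagonals (D.2 - D.1 + 1))
    (hR : R ⊆ diagonals (n - (D.2 - D.1) + 1)) :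
    Disjoint (L.image (leftDiag D)) (R.image (rightDiag D)) := by
  rw [Finset.disjoint_left]
  intro E hE hE'
  obtain ⟨E₁, h1, rfl⟩ := Finset.mem_image.1 hE
  obtain ⟨E₂, h2, h3⟩ := Finset.mem_image.1 hE'
  have a1 := leftDiag_spec hD (hL h1)
  have a2 := rightDiag_spec hD (hR h2)
  rw [h3] at a2
  have : ¬ ((leftDiag D E₁).1 = D.1 ∧ (leftDiag D E₁).2 = D.2) :=
    fun h => a1.2.1 (Prod.ext h.1 h.2)
  have := (mem_diagonals.1 a1.1)
  have := (mem_diagonals.1 hD)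
  omega

/-- A chord that does not cross `D` has both ends in one of the two polygons; if it differs from `D`
it is a diagonal there. -/
theorem erase_eq_parts {n : ℕ} {D : ℕ × ℕ} {T : Finset (ℕ × ℕ)} (hT : T ⊆ diagonals n)
    (hc : NonCrossing T) (hD : D ∈ T) :
    T.erase D = (leftPart D T).image (leftDiag D) ∪ (rightPart n D T).image (rightDiag D) := by
  ext E
  simp only [Finset.mem_erase, Finset.mem_union, Finset.mem_image, leftPart, rightPart,
    Finset.mem_filter]
  constructor
  · rintro ⟨hne, hE⟩
    have h1 := hc D hD E hE
    have h2 := mem_diagonals.1 (hT hE)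
    have h3 := mem_diagonals.1 (hT hD)
    simp only [Crossing] at h1
    by_cases h : D.1 ≤ E.1 ∧ E.2 ≤ D.2
    · obtain ⟨E', h4, h5⟩ := exists_leftDiag (hT hD) (hT hE) hne h.1 h.2
      exact Or.inl ⟨E', ⟨h4, h5 ▸ hE⟩, h5⟩
    · obtain ⟨E', h4, h5⟩ := exists_rightDiag (hT hD) (hT hE) hne (by omega)
      exact Or.inr ⟨E', ⟨h4, h5 ▸ hE⟩, h5⟩
  · rintro (⟨E', ⟨h1, h2⟩, rfl⟩ | ⟨E', ⟨h1, h2⟩, rfl⟩)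
    · exact ⟨(leftDiag_spec (hT hD) h1).2.1, h2⟩
    · exact ⟨(rightDiag_spec (hT hD) h1).2.1, h2⟩

theorem card_erase_eq {n : ℕ} {D : ℕ × ℕ} {T : Finset (ℕ × ℕ)} (hT : T ⊆ diagonals n)
    (hc : NonCrossing T) (hD : D ∈ T) :
    (T.erase D).card = (leftPart D T).card + (rightPart n D T).card := by
  have hD2 := (mem_diagonals.1 (hT hD)).2.2.1
  rw [erase_eq_parts hT hc hD, Finset.card_union_of_disjoint
    (disjoint_leftDiag_rightDiag (hT hD) (leftPart_subset D T) (rightPart_subset n D T)),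
    Finset.card_image_of_injOn ((leftDiag_injOn D).mono (Finset.coe_subset.2 (leftPart_subset D T))),
    Finset.card_image_of_injective _ (rightDiag_injective hD2)]

theorem nonCrossing_leftPart {D : ℕ × ℕ} {T : Finset (ℕ × ℕ)} (hc : NonCrossing T) :
    NonCrossing (leftPart D T) := by
  intro E hE E' hE'
  simp only [leftPart, Finset.mem_filter] at hE hE'
  rw [← crossing_leftDiag (D := D) hE.1 hE'.1]
  exact hc _ hE.2 _ hE'.2

theorem nonCrossing_rightPart {n : ℕ} {D : ℕ × ℕ} (hD : D.1 + 2 ≤ D.2) {T : Finset (ℕ × ℕ)}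
    (hc : NonCrossing T) : NonCrossing (rightPart n D T) := by
  intro E hE E' hE'
  simp only [rightPart, Finset.mem_filter] at hE hE'
  rw [← crossing_rightDiag hD]
  exact hc _ hE.2 _ hE'.2

/-- At most `n - 3` diagonals of an `n`-gon are pairwise non-crossing. -/
theorem card_le_of_nonCrossing (n : ℕ) (T : Finset (ℕ × ℕ)) (hT : T ⊆ diagonals n)
    (hc : NonCrossing T) : T.card ≤ n - 3 := by
  induction n using Nat.strong_induction_on generalizing T with
  | _ n ih =>
    rcases T.eq_empty_or_nonempty with rfl | ⟨D, hD⟩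
    · simp
    -- The two polygons have at least three vertices each and `n + 2` in total, so `(a - 3) + (b -
    -- 3) + 1 = n - 3`, the last `1` counting `D`.
    · have h1 := card_erase_eq hT hc hD
      have h2 := mem_diagonals.1 (hT hD)
      have h3 := ih (D.2 - D.1 + 1) (by omega) (leftPart D T) (Finset.filter_subset _ _)
        (nonCrossing_leftPart hc)
      have h4 := ih (n - (D.2 - D.1) + 1) (by omega) (rightPart n D T)
        (Finset.filter_subset _ _) (nonCrossing_rightPart h2.2.2.1 hc)
      have h5 := Finset.card_erase_add_one hD
      omega

/-- The triangulation of the polygon that is obtained by gluing triangulations of the two parts. -/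
def glue (D : ℕ × ℕ) (L R : Finset (ℕ × ℕ)) : Finset (ℕ × ℕ) :=
  insert D (L.image (leftDiag D) ∪ R.image (rightDiag D))

section glue

variable {n : ℕ} {D : ℕ × ℕ} {L R : Finset (ℕ × ℕ)}

theorem glue_subset (hD : D ∈ diagonals n) (hL : L ⊆ diagonals (D.2 - D.1 + 1))
    (hR : R ⊆ diagonals (n - (D.2 - D.1) + 1)) : glue D L R ⊆ diagonals n := by
  intro E hE
  simp only [glue, Finset.mem_insert, Finset.mem_union, Finset.mem_image] at hE
  rcases hE with rfl | ⟨E', h, rfl⟩ | ⟨E', h, rfl⟩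
  · exact hD
  · exact (leftDiag_spec hD (hL h)).1
  · exact (rightDiag_spec hD (hR h)).1

theorem nonCrossing_glue (hD : D ∈ diagonals n) (hL : L ⊆ diagonals (D.2 - D.1 + 1))
    (hR : R ⊆ diagonals (n - (D.2 - D.1) + 1)) (hcL : NonCrossing L) (hcR : NonCrossing R) :
    NonCrossing (glue D L R) := by
  have hD2 := mem_diagonals.1 hD
  have hLR : ∀ E ∈ L, ∀ E' ∈ R, ¬ Crossing (leftDiag D E) (rightDiag D E') := by
    intro E hE E' hE'
    have h1 := leftDiag_spec hD (hL hE)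
    have h2 := rightDiag_spec hD (hR hE')
    simp only [Crossing]; omega
  refine NonCrossing.insert ?_ ?_
  · intro E hE E' hE'
    simp only [Finset.mem_union, Finset.mem_image] at hE hE'
    rcases hE with ⟨E, h, rfl⟩ | ⟨E, h, rfl⟩ <;> rcases hE' with ⟨E', h', rfl⟩ | ⟨E', h', rfl⟩
    · rw [crossing_leftDiag (hL h) (hL h')]; exact hcL _ h _ h'
    · exact hLR _ h _ h'
    · rw [crossing_comm]; exact hLR _ h' _ h
    · rw [crossing_rightDiag hD2.2.2.1]; exact hcR _ h _ h'
  · intro E hE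
    simp only [Finset.mem_union, Finset.mem_image] at hE
    rcases hE with ⟨E, h, rfl⟩ | ⟨E, h, rfl⟩
    · have h1 := leftDiag_spec hD (hL h)
      simp only [Crossing]; omega
    · have h1 := rightDiag_spec hD (hR h)
      simp only [Crossing]; omega

theorem not_mem_images (hD : D ∈ diagonals n) (hL : L ⊆ diagonals (D.2 - D.1 + 1))
    (hR : R ⊆ diagonals (n - (D.2 - D.1) + 1)) :
    D ∉ L.image (leftDiag D) ∪ R.image (rightDiag D) := by
  simp only [Finset.mem_union, Finset.mem_image, not_or, not_exists, not_and]
  exact ⟨fun E h => (leftDiag_spec hD (hL h)).2.1, fun E h => (rightDiag_spec hD (hR h)).2.1⟩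

theorem card_glue (hD : D ∈ diagonals n) (hL : L ⊆ diagonals (D.2 - D.1 + 1))
    (hR : R ⊆ diagonals (n - (D.2 - D.1) + 1)) :
    (glue D L R).card = L.card + R.card + 1 := by
  have hD2 := (mem_diagonals.1 hD).2.2.1
  rw [glue, Finset.card_insert_of_notMem (not_mem_images hD hL hR),
    Finset.card_union_of_disjoint (disjoint_leftDiag_rightDiag hD hL hR),
    Finset.card_image_of_injOn ((leftDiag_injOn D).mono (by exact_mod_cast hL)),
    Finset.card_image_of_injective _ (rightDiag_injective hD2)]

theorem leftPart_glue (hD : D ∈ diagonals n) (hL : L ⊆ diagonals (D.2 - D.1 + 1))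
    (hR : R ⊆ diagonals (n - (D.2 - D.1) + 1)) : leftPart D (glue D L R) = L := by
  ext E
  simp only [leftPart, Finset.mem_filter, glue, Finset.mem_insert, Finset.mem_union]
  constructor
  · rintro ⟨hE, h | h | h⟩
    · exact absurd h (leftDiag_spec hD hE).2.1
    · obtain ⟨E', h', h''⟩ := Finset.mem_image.1 h
      rwa [leftDiag_injOn D hE (hL h') h''.symm]
    · exact absurd h (Finset.disjoint_left.1
        (disjoint_leftDiag_rightDiag hD (Finset.singleton_subset_iff.2 hE) hR) (by simp))
  · exact fun h => ⟨hL h, Or.inr (Or.inl (Finset.mem_image_of_mem _ h))⟩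

theorem rightPart_glue (hD : D ∈ diagonals n) (hL : L ⊆ diagonals (D.2 - D.1 + 1))
    (hR : R ⊆ diagonals (n - (D.2 - D.1) + 1)) : rightPart n D (glue D L R) = R := by
  have hD2 := (mem_diagonals.1 hD).2.2.1
  ext E
  simp only [rightPart, Finset.mem_filter, glue, Finset.mem_insert, Finset.mem_union]
  constructor
  · rintro ⟨hE, h | h | h⟩
    · exact absurd h (rightDiag_spec hD hE).2.1
    · exact absurd h (Finset.disjoint_right.1
        (disjoint_leftDiag_rightDiag hD hL (Finset.singleton_subset_iff.2 hE)) (by simp))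
    · obtain ⟨E', h', h''⟩ := Finset.mem_image.1 h
      rwa [rightDiag_injective hD2 h''.symm]
  · exact fun h => ⟨hR h, Or.inr (Or.inr (Finset.mem_image_of_mem _ h))⟩

end glue

/-! ### Heights and charges -/

/-- The total flavour of the particles before the vertex `v`. -/
def height (α : List Flavor) (v : ℕ) : Flavor := (α.take (v - 1)).sum

/-- Replaces charges of diagonals by differences of a function on the vertices; all flavour
conditions below are checked in this form. -/
theorem charge_eq_height (α : List Flavor) {D : ℕ × ℕ} (h : D.1 ≤ D.2) :
    charge α D = height α D.2 - height α D.1 := by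
  have h1 : α.take (D.2 - 1) = α.take (D.1 - 1) ++ (α.take (D.2 - 1)).drop (D.1 - 1) := by
    conv_lhs => rw [← List.take_append_drop (D.1 - 1) (α.take (D.2 - 1))]
    rw [List.take_take, min_eq_left (by omega)]
  simp only [charge, height]
  conv_rhs => rw [h1, List.sum_append]
  abel

section channels

variable {α : List Flavor} {D : ℕ × ℕ}

theorem length_leftOrdering (hD : D ∈ diagonals α.length) :
    (leftOrdering α D).length = D.2 - D.1 + 1 := by
  rw [mem_diagonals] at hD
  simp only [leftOrdering, List.length_append, List.length_drop, List.length_take,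
    List.length_singleton]
  omega

theorem length_rightOrdering (hD : D ∈ diagonals α.length) :
    (rightOrdering α D).length = α.length - (D.2 - D.1) + 1 := by
  rw [mem_diagonals] at hD
  simp only [rightOrdering, List.length_append, List.length_take, List.length_cons,
    List.length_drop]
  omega

/-- The internal particle is the last one of the left ordering, so it never belongs to the particles
that enter `charge` of a diagonal. -/
theorem charge_leftOrdering (hD : D ∈ diagonals α.length) {E : ℕ × ℕ}
    (hE : E ∈ diagonals (D.2 - D.1 + 1)) :
    charge (leftOrdering α D) E = charge α (leftDiag D E) := by
  rw [mem_diagonals] at hD hE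
  have key : (leftOrdering α D).take (E.2 - 1) = (α.take (E.2 + D.1 - 1 - 1)).drop (D.1 - 1) := by
    rw [leftOrdering, List.take_append_of_le_length, List.take_drop, List.take_take]
    · congr 2; omega
    · simp only [List.length_drop, List.length_take]; omega
  simp only [charge, key, leftDiag, List.drop_drop]
  congr 2; omega

/-- The internal particle carries the total flavour of the particles that it replaces, so the
heights beyond it do not change. -/
theorem height_rightOrdering (hD : D ∈ diagonals α.length) {a : ℕ} (ha : 1 ≤ a) :
    height (rightOrdering α D) a = height α (rightVertex D a) := by
  have hD' := mem_diagonals.1 hD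
  have hlen : (α.take (D.1 - 1)).length = D.1 - 1 := by
    rw [List.length_take]; omega
  simp only [height, rightVertex, rightOrdering]
  split_ifs with h
  · rw [List.take_append_of_le_length (by omega), List.take_take, min_eq_left (by omega)]
  · have h1 : a - 1 = (α.take (D.1 - 1)).length + ((a - 1 - D.1) + 1) := by omega
    rw [h1, List.take_length_add_append, List.take_succ_cons, List.sum_append, List.sum_cons,
      charge_eq_height α (by omega)]
    have h2 : α.take (a + (D.2 - D.1) - 1 - 1) =
        α.take (D.2 - 1) ++ (α.drop (D.2 - 1)).take (a - 1 - D.1) := by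
      rw [← List.take_add]; congr 1; omega
    rw [h2, List.sum_append]
    simp only [height]; abel

theorem charge_rightOrdering (hD : D ∈ diagonals α.length) {E : ℕ × ℕ}
    (hE : E ∈ diagonals (α.length - (D.2 - D.1) + 1)) :
    charge (rightOrdering α D) E = charge α (rightDiag D E) := by
  have hE' := mem_diagonals.1 hE
  have h2 : (rightDiag D E).1 < (rightDiag D E).2 := by
    simp only [rightDiag]; rw [rightVertex_lt (mem_diagonals.1 hD).2.2.1]; omega
  rw [charge_eq_height _ (by omega), charge_eq_height _ h2.le, height_rightOrdering hD (by omega),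
    height_rightOrdering hD (by omega)]
  rfl

/-! ### Factorisation of triangulations along a diagonal -/

theorem mem_feynmanDiagrams {T : Finset (ℕ × ℕ)} :
    T ∈ feynmanDiagrams α ↔ T ⊆ diagonals α.length ∧ T.card = α.length - 3 ∧
      (∀ D ∈ T, Allowed α D) ∧ NonCrossing T := by
  simp only [feynmanDiagrams, Finset.mem_filter, Finset.mem_powersetCard, NonCrossing, and_assoc]

theorem glue_mem (hD : D ∈ diagonals α.length) (hA : Allowed α D) {L R : Finset (ℕ × ℕ)}
    (hL : L ∈ feynmanDiagrams (leftOrdering α D)) (hR : R ∈ feynmanDiagrams (rightOrdering α D)) :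
    glue D L R ∈ feynmanDiagrams α := by
  rw [mem_feynmanDiagrams] at *
  rw [length_leftOrdering hD] at hL
  rw [length_rightOrdering hD] at hR
  refine ⟨glue_subset hD hL.1 hR.1, ?_, ?_, nonCrossing_glue hD hL.1 hR.1 hL.2.2.2 hR.2.2.2⟩
  · rw [card_glue hD hL.1 hR.1, hL.2.1, hR.2.1]
    have := mem_diagonals.1 hD
    omega
  · intro E hE
    simp only [glue, Finset.mem_insert, Finset.mem_union, Finset.mem_image] at hE
    rcases hE with rfl | ⟨E, h, rfl⟩ | ⟨E, h, rfl⟩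
    · exact hA
    · have := hL.2.2.1 E h
      rwa [Allowed, charge_leftOrdering hD (hL.1 h)] at this
    · have := hR.2.2.1 E h
      rwa [Allowed, charge_rightOrdering hD (hR.1 h)] at this

theorem parts_mem {T : Finset (ℕ × ℕ)} (hT : T ∈ feynmanDiagrams α) (hD : D ∈ T) :
    leftPart D T ∈ feynmanDiagrams (leftOrdering α D) ∧
      rightPart α.length D T ∈ feynmanDiagrams (rightOrdering α D) := by
  rw [mem_feynmanDiagrams] at hT
  obtain ⟨h1, h2, h3, h4⟩ := hT
  have hD1 := h1 hD
  have hD2 := mem_diagonals.1 hD1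
  have sL : leftPart D T ⊆ diagonals (D.2 - D.1 + 1) := Finset.filter_subset _ _
  have sR : rightPart α.length D T ⊆ diagonals (α.length - (D.2 - D.1) + 1) :=
    Finset.filter_subset _ _
  -- The two upper bounds add up to the number of diagonals of `T` other than `D`, so both are
  -- equalities and both parts are full triangulations.
  have cL := card_le_of_nonCrossing _ _ sL (nonCrossing_leftPart h4)
  have cR := card_le_of_nonCrossing _ _ sR (nonCrossing_rightPart hD2.2.2.1 h4)
  have c1 := card_erase_eq h1 h4 hD
  have c2 := Finset.card_erase_add_one hD
  rw [mem_feynmanDiagrams, mem_feynmanDiagrams, length_leftOrdering hD1, length_rightOrdering hD1]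
  refine ⟨⟨sL, by omega, ?_, nonCrossing_leftPart h4⟩,
    ⟨sR, by omega, ?_, nonCrossing_rightPart hD2.2.2.1 h4⟩⟩
  · intro E hE
    have := h3 _ (Finset.mem_filter.1 hE).2
    rwa [Allowed, ← charge_leftOrdering hD1 (sL hE)] at this
  · intro E hE
    have := h3 _ (Finset.mem_filter.1 hE).2
    rwa [Allowed, ← charge_rightOrdering hD1 (sR hE)] at this

/-- The product of the two amplitudes of a channel is the sum over the triangulations that contain
its diagonal. -/
theorem amplitude_mul_amplitude (hD : D ∈ diagonals α.length) (hA : Allowed α D) (X : Kin) :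
    amplitude (leftOrdering α D) (leftKin D X) * amplitude (rightOrdering α D) (rightKin D X) =
      ∑ T ∈ (feynmanDiagrams α).filter (D ∈ ·), ∏ E ∈ T.erase D, (X E)⁻¹ := by
  rw [amplitude, amplitude, Finset.sum_mul_sum, ← Finset.sum_product']
  symm
  refine Finset.sum_bij' (fun T _ => (leftPart D T, rightPart α.length D T))
    (fun p _ => glue D p.1 p.2) ?_ ?_ ?_ ?_ ?_
  · intro T hT
    rw [Finset.mem_filter] at hT
    exact Finset.mem_product.2 (parts_mem hT.1 hT.2)
  · intro p hp
    rw [Finset.mem_product] at hp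
    exact Finset.mem_filter.2 ⟨glue_mem hD hA hp.1 hp.2, Finset.mem_insert_self _ _⟩
  · intro T hT
    rw [Finset.mem_filter, mem_feynmanDiagrams] at hT
    simp only [glue]
    rw [← erase_eq_parts hT.1.1 hT.1.2.2.2 hT.2, Finset.insert_erase hT.2]
  · intro p hp
    simp only [Finset.mem_product, mem_feynmanDiagrams, length_leftOrdering hD,
      length_rightOrdering hD] at hp
    rw [leftPart_glue hD hp.1.1 hp.2.1, rightPart_glue hD hp.1.1 hp.2.1]
  · intro T hT
    rw [Finset.mem_filter, mem_feynmanDiagrams] at hT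
    have hD2 := (mem_diagonals.1 hD).2.2.1
    rw [erase_eq_parts hT.1.1 hT.1.2.2.2 hT.2, Finset.prod_union
      (disjoint_leftDiag_rightDiag hD (leftPart_subset D T) (rightPart_subset _ D T)),
      Finset.prod_image ((leftDiag_injOn D).mono (Finset.coe_subset.2 (leftPart_subset D T))),
      Finset.prod_image (fun _ _ _ _ h => rightDiag_injective hD2 h)]
    rfl

end channels

/-- A flip. The number of diagonals is kept, and the only possible crossing partner of `D'` has been
removed. -/
theorem insert_erase_mem_feynmanDiagrams {α : List Flavor} {T : Finset (ℕ × ℕ)} {D D' : ℕ × ℕ}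
    (hT : T ∈ feynmanDiagrams α) (hD : D ∈ T) (hD' : D' ∈ diagonals α.length)
    (hA : Allowed α D') (hc : ∀ E ∈ T, Crossing D' E → E = D) (hn : D' ∉ T) :
    insert D' (T.erase D) ∈ feynmanDiagrams α := by
  rw [mem_feynmanDiagrams] at *
  obtain ⟨h1, h2, h3, h4⟩ := hT
  refine ⟨?_, ?_, ?_, ?_⟩
  · exact Finset.insert_subset hD' ((Finset.erase_subset _ _).trans h1)
  · rw [Finset.card_insert_of_notMem (fun h => hn (Finset.mem_of_mem_erase h)),
      Finset.card_erase_add_one hD, h2]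
  · intro E hE
    rcases Finset.mem_insert.1 hE with rfl | hE
    · exact hA
    · exact h3 _ (Finset.mem_of_mem_erase hE)
  · refine (h4.mono (Finset.erase_subset _ _)).insert fun E hE hX => ?_
    exact (Finset.mem_erase.1 hE).1 (hc E (Finset.mem_of_mem_erase hE) hX)

/-- A triangulation is a maximal set of non-crossing diagonals. -/
theorem mem_of_not_crossing {α : List Flavor} {T : Finset (ℕ × ℕ)} {D : ℕ × ℕ}
    (hT : T ∈ feynmanDiagrams α) (hD : D ∈ diagonals α.length)
    (hc : ∀ E ∈ T, ¬ Crossing D E) : D ∈ T := by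
  rw [mem_feynmanDiagrams] at hT
  by_contra h
  have h1 := card_le_of_nonCrossing _ _ (Finset.insert_subset hD hT.1) (hT.2.2.2.insert hc)
  rw [Finset.card_insert_of_notMem h] at h1
  omega

/-! ### Rational functions of the shift parameter -/

theorem tendsto_norm_cocompact : Tendsto (fun z : ℂ => ‖z‖) (cocompact ℂ) atTop := by
  rw [← Metric.cobounded_eq_cocompact]
  exact tendsto_norm_cobounded_atTop

theorem isBigO_inv_sub (p : ℂ) :
    (fun z : ℂ => (z - p)⁻¹) =O[cocompact ℂ] fun z => z⁻¹ := by
  have h : (fun z : ℂ => z) =O[cocompact ℂ] fun z => z - p := by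
    refine IsBigO.of_bound 2 ?_
    filter_upwards [tendsto_norm_cocompact.eventually_ge_atTop (2 * ‖p‖)] with z hz
    have := norm_sub_norm_le z p
    linarith
  refine h.inv_rev ?_
  filter_upwards [tendsto_norm_cocompact.eventually_gt_atTop 0] with z hz h0
  exact absurd h0 (norm_pos_iff.1 hz)

theorem isBigO_inv_pow {m : ℕ} (hm : 2 ≤ m) :
    (fun z : ℂ => (z⁻¹) ^ m) =O[cocompact ℂ] fun z => (z ^ 2)⁻¹ := by
  refine IsBigO.of_bound 1 ?_
  filter_upwards [tendsto_norm_cocompact.eventually_ge_atTop 1] with z hz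
  rw [← inv_pow, one_mul, norm_pow, norm_pow]
  exact pow_le_pow_of_le_one (norm_nonneg _) (by rw [norm_inv]; exact inv_le_one_of_one_le₀ hz) hm

theorem isBigO_prod_inv_linear {ι : Type*} (s : Finset ι) (hs : 2 ≤ s.card) (μ p : ι → ℂ) :
    (fun z : ℂ => ∏ i ∈ s, (μ i * (z - p i))⁻¹) =O[cocompact ℂ] fun z => (z ^ 2)⁻¹ := by
  have h : (fun z : ℂ => ∏ i ∈ s, (μ i * (z - p i))⁻¹) =O[cocompact ℂ]
      fun z => ∏ _i ∈ s, z⁻¹ := by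
    refine IsBigO.finsetProd fun i _ => ?_
    simp only [mul_inv]
    exact (isBigO_inv_sub (p i)).const_mul_left _
  simp only [Finset.prod_const] at h
  exact h.trans (isBigO_inv_pow hs)

/-- Removing `1/z` from a simple pole gains one order of decay. It is applied once the coefficients
of `1/z` are known to sum to zero. -/
theorem isBigO_inv_sub_sub_inv (p : ℂ) :
    (fun z : ℂ => (z - p)⁻¹ - z⁻¹) =O[cocompact ℂ] fun z => (z ^ 2)⁻¹ := by
  have h : (fun z : ℂ => (z - p)⁻¹ * z⁻¹) =O[cocompact ℂ] fun z => z⁻¹ * z⁻¹ :=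
    (isBigO_inv_sub p).mul (isBigO_refl _ _)
  have h2 : (fun z : ℂ => p * ((z - p)⁻¹ * z⁻¹)) =O[cocompact ℂ] fun z => (z ^ 2)⁻¹ := by
    refine (h.const_mul_left p).congr_right fun z => ?_
    rw [sq, mul_inv]
  refine h2.congr' ?_ EventuallyEq.rfl
  filter_upwards [tendsto_norm_cocompact.eventually_gt_atTop ‖p‖] with z hz
  have h0 : z ≠ 0 := by
    rintro rfl; simp only [norm_zero] at hz; exact absurd hz (not_lt.2 (norm_nonneg _))
  have h1 : z - p ≠ 0 := by
    intro h; rw [sub_eq_zero] at h; rw [h] at hz; exact lt_irrefl _ hz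
  field_simp
  ring

/-- A function that is holomorphic near infinity and decays like `z⁻²` has no residue there. -/
theorem eventually_circleIntegral_eq_zero {f : ℂ → ℂ} {R₀ : ℝ}
    (hd : ∀ z, R₀ < ‖z‖ → DifferentiableAt ℂ f z)
    (hO : f =O[cocompact ℂ] fun z => (z ^ 2)⁻¹) :
    ∀ᶠ R : ℝ in atTop, (∮ z in C(0, R), f z) = 0 := by
  obtain ⟨C, hC⟩ := hO.bound
  rw [← Metric.cobounded_eq_cocompact, ← comap_norm_atTop, Filter.eventually_comap] at hC
  obtain ⟨R₁, hR₁⟩ := eventually_atTop.1 hC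
  filter_upwards [eventually_gt_atTop (max (max R₀ R₁) 1)] with R hR
  simp only [max_lt_iff] at hR
  -- Cauchy's theorem on an annulus makes the integral independent of the radius, and on the circle
  -- of radius `R'` it is at most `2πC/R'`, which tends to `0`.
  have hbound : ∀ R' : ℝ, R ≤ R' → ‖∮ z in C(0, R), f z‖ ≤ 2 * Real.pi * C * R'⁻¹ := by
    intro R' hR'
    have hR'0 : 0 < R' := by linarith
    rw [← Complex.circleIntegral_eq_of_differentiable_on_annulus_off_countable
      (by linarith : (0 : ℝ) < R) hR' Set.countable_empty (f := f)]
    · refine (circleIntegral.norm_integral_le_of_norm_le_const hR'0.le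
        (C := C * (R' ^ 2)⁻¹) ?_).trans (le_of_eq ?_)
      · intro z hz
        rw [mem_sphere_zero_iff_norm] at hz
        have := hR₁ R' (by linarith) z hz
        rwa [norm_inv, norm_pow, hz] at this
      · field_simp
    · intro z hz
      have : R ≤ ‖z‖ := by
        have := hz.2; simp only [Metric.mem_ball, dist_zero_right, not_lt] at this; exact this
      exact (hd z (by linarith)).continuousAt.continuousWithinAt
    · intro z hz
      have : R < ‖z‖ := by
        have := hz.1.2; simp only [Metric.mem_closedBall, dist_zero_right, not_le] at this
        exact this
      exact hd z (by linarith)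
  have hlim : Tendsto (fun R' : ℝ => 2 * Real.pi * C * R'⁻¹) atTop (𝓝 0) := by
    simpa using tendsto_inv_atTop_zero.const_mul (2 * Real.pi * C)
  exact norm_le_zero_iff.1 (ge_of_tendsto hlim (eventually_atTop.2 ⟨R, hbound⟩))

theorem noPoleAtInfinity_of_isBigO {A : ℂ → ℂ} {R₀ : ℝ}
    (hd : ∀ z, R₀ < ‖z‖ → DifferentiableAt ℂ A z)
    (hO : A =O[cocompact ℂ] fun z => (z ^ 2)⁻¹) : NoPoleAtInfinity A := by
  refine ⟨hO, eventually_circleIntegral_eq_zero (R₀ := max R₀ 1) ?_ ?_⟩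
  · intro z hz
    rw [max_lt_iff] at hz
    have h1 : z - 1 ≠ 0 := by
      intro h; rw [sub_eq_zero] at h; rw [h, norm_one] at hz; exact lt_irrefl _ hz.2
    have h2 : DifferentiableAt ℂ (fun z : ℂ => z / (z - 1)) z :=
      DifferentiableAt.div (by fun_prop) (by fun_prop) h1
    exact h2.mul (hd z hz.1)
  · have h1 : (fun z : ℂ => z / (z - 1)) =O[cocompact ℂ] fun _ => (1 : ℂ) := by
      have := (isBigO_refl (fun z : ℂ => z) (cocompact ℂ)).mul (isBigO_inv_sub 1)
      refine this.trans (IsBigO.of_bound 1 (Eventually.of_forall fun z => ?_))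
      by_cases hz : z = 0
      · simp [hz]
      · simp [hz]
    simpa using h1.mul hO

/-- Partial fractions of `z / ((z - 1) ∏ (z - z_i))` at `z = 1`. -/
theorem sum_residues {ι : Type*} [DecidableEq ι] (s : Finset ι) (p : ι → ℂ) (hp : Set.InjOn p s)
    (h1 : ∀ i ∈ s, p i ≠ 1) (hs : 2 ≤ s.card) :
    ∑ i ∈ s, p i / (1 - p i) * ∏ j ∈ s.erase i, (p i - p j)⁻¹ = ∏ i ∈ s, (1 - p i)⁻¹ := by
  -- The polynomial `X` has degree `1 < s.card`, so it equals its Lagrange interpolant at the nodes.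
  -- The barycentric formula for it, evaluated at `1`, is the claim.
  have hX := Lagrange.eq_interpolate (f := (Polynomial.X : Polynomial ℂ)) hp
    (by rw [Polynomial.degree_X]; exact_mod_cast (by omega : 1 < s.card))
  have h2 := Lagrange.eval_interpolate_not_at_node (s := s) (v := p) (x := 1)
    (fun i => Polynomial.eval (p i) Polynomial.X) (fun i hi => (h1 i hi).symm)
  rw [← hX, Polynomial.eval_X, Lagrange.eval_nodal] at h2
  have h3 : ∏ i ∈ s, (1 - p i) ≠ 0 :=
    Finset.prod_ne_zero_iff.2 fun i hi => sub_ne_zero.2 (h1 i hi).symm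
  rw [Finset.prod_inv_distrib]
  refine eq_inv_of_mul_eq_one_right ?_
  refine Eq.trans ?_ h2.symm
  congr 1
  refine Finset.sum_congr rfl fun i _ => ?_
  rw [Lagrange.nodalWeight, Polynomial.eval_X, div_eq_mul_inv]
  ring

/-! ### A criterion for one-variable recursions -/

/-- The direction in which the shift moves the planar variables. -/
def shiftDir (F : Finset (ℕ × ℕ)) (lam : ℕ × ℕ → ℂ) : Kin := fun D => if D ∈ F then lam D else 0

/-- The shift of `D₀` moves the variables in `F` with signs `lam`, every triangulation meets `F`, and
the triangulations that meet `F` in one diagonal come in pairs related by a flip of `D₀` to a diagonal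
with the opposite sign. -/
structure FlipShift (α : List Flavor) (H : Set ((ℕ × ℕ) × (ℕ × ℕ))) (Y : Set (ℕ × ℕ))
    (D₀ : ℕ × ℕ) (F : Finset (ℕ × ℕ)) (lam : ℕ × ℕ → ℂ) : Prop where
  basis : IsPlanarBasis α H Y
  mem : ∀ D ∈ F, D ∈ diagonals α.length ∧ Allowed α D
  sign : ∀ D ∈ F, lam D = 1 ∨ lam D = -1
  mem_F : D₀ ∈ F
  mem_Y : D₀ ∈ Y
  lam_eq : lam D₀ = 1
  -- With `lam_eq`, `mem` and `homogeneous`, this makes `shiftDir F lam` the solution of the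
  -- homogeneous system dual to `D₀`.
  not_mem : ∀ D ∈ Y, D ≠ D₀ → D ∉ F
  homogeneous : ∀ p ∈ H, mandelstam α.length (shiftDir F lam) p = 0
  meets : ∀ T ∈ feynmanDiagrams α, ∃ D ∈ T, D ∈ F
  flip : ∀ T ∈ feynmanDiagrams α, ∀ D ∈ F, D ≠ D₀ → T ∩ F = {D} →
    lam D = -1 ∧ insert D₀ (T.erase D) ∈ feynmanDiagrams α
  unflip : ∀ T ∈ feynmanDiagrams α, T ∩ F = {D₀} →
    ∃ D ∈ F, D ≠ D₀ ∧ insert D (T.erase D₀) ∈ feynmanDiagrams α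
  -- Makes the flip injective: two negative diagonals that flip to the same triangulation would
  -- otherwise be the two diagonals of a quadrilateral.
  not_crossing : ∀ D ∈ F, ∀ E ∈ F, lam D = -1 → lam E = -1 → ¬ Crossing D E

theorem planar_add (n : ℕ) (X Y : Kin) (a b : ℕ) :
    planar n (X + Y) a b = planar n X a b + planar n Y a b := by
  simp only [planar]; split_ifs <;> simp

theorem planar_smul (n : ℕ) (t : ℂ) (X : Kin) (a b : ℕ) :
    planar n (t • X) a b = t * planar n X a b := by
  simp only [planar]; split_ifs <;> simp

theorem mandelstam_add (n : ℕ) (X Y : Kin) (p : (ℕ × ℕ) × (ℕ × ℕ)) :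
    mandelstam n (X + Y) p = mandelstam n X p + mandelstam n Y p := by
  simp only [mandelstam, planar_add]; ring

theorem mandelstam_smul (n : ℕ) (t : ℂ) (X : Kin) (p : (ℕ × ℕ) × (ℕ × ℕ)) :
    mandelstam n (t • X) p = t * mandelstam n X p := by
  simp only [mandelstam, planar_smul]; ring

/-- In a basis, a homogeneous solution along `Y \ {D₀}` gives the shift. -/
theorem IsPlanarBasis.eq_of_isShift {α : List Flavor} {H : Set ((ℕ × ℕ) × (ℕ × ℕ))}
    {Y : Set (ℕ × ℕ)} {D₀ : ℕ × ℕ} (hY : IsPlanarBasis α H Y) {V : Kin}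
    (hV : ∀ p ∈ H, mandelstam α.length V p = 0)
    (hV' : ∀ D ∈ diagonals α.length, ¬ Allowed α D → V D = 0)
    (hD₀ : V D₀ = 1) (hne : ∀ D ∈ Y, D ≠ D₀ → V D = 0)
    {c : (ℕ × ℕ) × (ℕ × ℕ) → ℂ} {b : ℕ × ℕ → ℂ} {X : Kin} (hX : OnSubspace α H c b X)
    {Xh : ℂ → Kin} (hs : IsShift α H c b Y D₀ X Xh) (z : ℂ) :
    ∀ D ∈ diagonals α.length, Xh z D = X D - (1 - z) * X D₀ * V D := by
  -- `X₁` has the basis values of `Xh z`. Both `Xh z` and the translate of `X` along `V` lie on the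
  -- subspace with these values, so each agrees with `X₁` on the diagonals.
  obtain ⟨X₁, -, -, h3⟩ := hY.2 c b (Xh z)
  obtain ⟨s1, s2, s3⟩ := hs z
  have e1 := h3 (Xh z) s1 fun D _ => rfl
  have e2 := h3 (X + (-((1 - z) * X D₀)) • V) ?_ ?_
  · intro D hD
    rw [e1 D hD, ← e2 D hD]
    simp only [Pi.add_apply, Pi.smul_apply, smul_eq_mul]; ring
  · refine ⟨fun p hp => ?_, fun D hD hA => ?_⟩
    · rw [mandelstam_add, mandelstam_smul, hV p hp, ← hX.1 p hp]; ring
    · simp [hV' D hD hA, hX.2 D hD hA]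
  · intro D hD
    simp only [Pi.add_apply, Pi.smul_apply, smul_eq_mul]
    by_cases h : D = D₀
    · rw [h, s2, hD₀]; ring
    · rw [hne D hD h, s3 D hD h]; ring

theorem IsPlanarBasis.exists_isShift {α : List Flavor} {H : Set ((ℕ × ℕ) × (ℕ × ℕ))}
    {Y : Set (ℕ × ℕ)} {D₀ : ℕ × ℕ} (hY : IsPlanarBasis α H Y) (hD₀ : D₀ ∈ Y)
    (c : (ℕ × ℕ) × (ℕ × ℕ) → ℂ) (b : ℕ × ℕ → ℂ) (X : Kin) :
    ∃ Xh, IsShift α H c b Y D₀ X Xh := by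
  have h := fun z : ℂ => hY.2 c b fun D => if D = D₀ then z * X D₀ else X D
  choose Xh h1 h2 _ using h
  refine ⟨Xh, fun z => ⟨h1 z, ?_, fun D hD hne => ?_⟩⟩
  · rw [h2 z D₀ hD₀, if_pos rfl]
  · rw [h2 z D hD, if_neg hne]

namespace FlipShift

variable {α : List Flavor} {H : Set ((ℕ × ℕ) × (ℕ × ℕ))} {Y : Set (ℕ × ℕ)} {D₀ : ℕ × ℕ}
  {F : Finset (ℕ × ℕ)} {lam : ℕ × ℕ → ℂ}

theorem isShift_apply (h : FlipShift α H Y D₀ F lam) {c : (ℕ × ℕ) × (ℕ × ℕ) → ℂ}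
    {b : ℕ × ℕ → ℂ} {X : Kin} (hX : OnSubspace α H c b X) {Xh : ℂ → Kin}
    (hs : IsShift α H c b Y D₀ X Xh) (z : ℂ) :
    ∀ D ∈ diagonals α.length, Xh z D = X D - (1 - z) * X D₀ * shiftDir F lam D := by
  refine h.basis.eq_of_isShift h.homogeneous ?_ ?_ ?_ hX hs z
  · intro D hD hA
    exact if_neg fun hF => hA (h.mem D hF).2
  · rw [shiftDir, if_pos h.mem_F, h.lam_eq]
  · intro D hD hne
    exact if_neg (h.not_mem D hD hne)

theorem lam_ne_zero (h : FlipShift α H Y D₀ F lam) {D : ℕ × ℕ} (hD : D ∈ F) : lam D ≠ 0 := by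
  rcases h.sign D hD with h | h <;> simp [h]

theorem inv_lam (h : FlipShift α H Y D₀ F lam) {D : ℕ × ℕ} (hD : D ∈ F) :
    (lam D)⁻¹ = lam D := by
  rcases h.sign D hD with h | h <;> norm_num [h]

theorem sdiff_eq_erase {T : Finset (ℕ × ℕ)} {D : ℕ × ℕ} (h : T ∩ F = {D}) :
    T \ F = T.erase D := by
  rw [← Finset.sdiff_inter_self_left, h, Finset.erase_eq]

theorem insert_inter {T : Finset (ℕ × ℕ)} {D E : ℕ × ℕ} (h : T ∩ F = {D}) (hE : E ∈ F) :
    insert E (T.erase D) ∩ F = {E} := by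
  rw [← sdiff_eq_erase h]
  ext x
  simp only [Finset.mem_inter, Finset.mem_insert, Finset.mem_sdiff, Finset.mem_singleton]
  constructor
  · rintro ⟨rfl | h1, h2⟩
    · rfl
    · exact absurd h2 h1.2
  · rintro rfl; exact ⟨Or.inl rfl, hE⟩

/-- The triangulations that meet `F` in a single diagonal cancel. -/
theorem cancel (h : FlipShift α H Y D₀ F lam) (f : ℕ × ℕ → ℂ) :
    ∑ T ∈ (feynmanDiagrams α).filter (fun T => (T ∩ F).card = 1),
      (∏ E ∈ T \ F, f E) * ∏ E ∈ T ∩ F, lam E = 0 := by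
  rw [← Finset.sum_filter_add_sum_filter_not _ (fun T => T ∩ F = {D₀})]
  rw [add_eq_zero_iff_eq_neg, eq_comm, neg_eq_iff_eq_neg, ← Finset.sum_neg_distrib]
  have key : ∀ T ∈ ((feynmanDiagrams α).filter (fun T => (T ∩ F).card = 1)).filter
      (fun T => ¬ T ∩ F = {D₀}), T ∈ feynmanDiagrams α ∧ ∃ D ∈ F, D ≠ D₀ ∧ T ∩ F = {D} := by
    intro T hT
    simp only [Finset.mem_filter] at hT
    obtain ⟨D, hD⟩ := Finset.card_eq_one.1 hT.1.2
    have hDF : D ∈ T ∩ F := by rw [hD]; exact Finset.mem_singleton_self _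
    refine ⟨hT.1.1, D, (Finset.mem_inter.1 hDF).2, ?_, hD⟩
    rintro rfl; exact hT.2 hD
  -- The map replaces the only diagonal in `F` by `D₀`. It leaves `T \ F`, and hence the product
  -- over it, unchanged.
  refine Finset.sum_bij (fun T _ => insert D₀ (T \ F)) ?_ ?_ ?_ ?_
  · intro T hT
    obtain ⟨hT1, D, hD, hne, hTF⟩ := key T hT
    rw [sdiff_eq_erase hTF]
    simp only [Finset.mem_filter]
    have := insert_inter hTF h.mem_F
    exact ⟨⟨(h.flip T hT1 D hD hne hTF).2, by rw [this]; rfl⟩, this⟩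
  · intro T hT T' hT' heq
    obtain ⟨hT1, D, hD, hne, hTF⟩ := key T hT
    obtain ⟨hT1', D', hD', hne', hTF'⟩ := key T' hT'
    have hl := (h.flip T hT1 D hD hne hTF).1
    have hl' := (h.flip T' hT1' D' hD' hne' hTF').1
    have hs : T \ F = T' \ F := by
      have := congrArg (fun S => S \ F) heq
      simpa [Finset.insert_sdiff_of_mem _ h.mem_F] using this
    have hDT : D ∈ T := Finset.mem_of_mem_inter_left (hTF ▸ Finset.mem_singleton_self D)
    have hDT' : D' ∈ T' := Finset.mem_of_mem_inter_left (hTF' ▸ Finset.mem_singleton_self D')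
    -- `D'` crosses neither `D`, as both are negative, nor the common part `T \ F`. Maximality of
    -- `T` puts it into `T ∩ F = {D}`.
    have hmem : D' ∈ T := by
      refine mem_of_not_crossing hT1 (h.mem D' hD').1 fun E hE => ?_
      by_cases hEF : E ∈ F
      · have : E = D := by
          have : E ∈ T ∩ F := Finset.mem_inter.2 ⟨hE, hEF⟩
          rwa [hTF, Finset.mem_singleton] at this
        rw [this]; exact h.not_crossing _ hD' _ hD hl' hl
      · have : E ∈ T' \ F := hs ▸ Finset.mem_sdiff.2 ⟨hE, hEF⟩
        exact (mem_feynmanDiagrams.1 hT1').2.2.2 _ hDT' _ (Finset.mem_sdiff.1 this).1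
    have hDD : D' = D := by
      have : D' ∈ T ∩ F := Finset.mem_inter.2 ⟨hmem, hD'⟩
      rwa [hTF, Finset.mem_singleton] at this
    rw [← Finset.sdiff_union_inter T F, ← Finset.sdiff_union_inter T' F, hs, hTF, hTF', hDD]
  · intro T hT
    simp only [Finset.mem_filter] at hT
    -- The preimage is the triangulation from `unflip`; flipping it back restores `T`.
    obtain ⟨D, hD, hne, hins⟩ := h.unflip T hT.1.1 hT.2
    have h1 := insert_inter hT.2 hD
    have hD₀T : D₀ ∈ T := Finset.mem_of_mem_inter_left (hT.2 ▸ Finset.mem_singleton_self D₀)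
    refine ⟨insert D (T.erase D₀), ?_, ?_⟩
    · simp only [Finset.mem_filter]
      refine ⟨⟨hins, by rw [h1]; rfl⟩, ?_⟩
      rw [h1, Finset.singleton_inj]; exact hne
    · rw [← sdiff_eq_erase hT.2, Finset.insert_sdiff_of_mem _ hD, sdiff_idem,
        sdiff_eq_erase hT.2, Finset.insert_erase hD₀T]
  · intro T hT
    obtain ⟨hT1, D, hD, hne, hTF⟩ := key T hT
    have h1 := insert_inter hTF h.mem_F
    rw [Finset.insert_sdiff_of_mem _ h.mem_F, sdiff_idem, sdiff_eq_erase hTF, h1, hTF,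
      Finset.prod_singleton, Finset.prod_singleton, h.lam_eq, (h.flip T hT1 D hD hne hTF).1]
    ring

section shifted

variable {X : Kin} {Xh : ℂ → Kin}

theorem shifted_eq (h : FlipShift α H Y D₀ F lam) (hX₀ : X D₀ ≠ 0)
    (hF : ∀ z, ∀ D ∈ F, Xh z D = X D - lam D * (1 - z) * X D₀) {D : ℕ × ℕ} (hD : D ∈ F) (z : ℂ) :
    Xh z D = lam D * X D₀ * (z - polePos lam D₀ X D) := by
  have := h.lam_ne_zero hD
  rw [hF z D hD, polePos]; field_simp; ring

theorem amplitude_shifted (h : FlipShift α H Y D₀ F lam) (hX₀ : X D₀ ≠ 0)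
    (hF : ∀ z, ∀ D ∈ F, Xh z D = X D - lam D * (1 - z) * X D₀)
    (hn : ∀ z, ∀ D ∈ diagonals α.length, D ∉ F → Xh z D = X D) (z : ℂ) :
    amplitude α (Xh z) = ∑ T ∈ feynmanDiagrams α, (∏ E ∈ T \ F, (X E)⁻¹) *
      ∏ E ∈ T ∩ F, (lam E * X D₀ * (z - polePos lam D₀ X E))⁻¹ := by
  refine Finset.sum_congr rfl fun T hT => ?_
  rw [← Finset.prod_inter_mul_prod_sdiff T F, mul_comm]
  congr 1
  · refine Finset.prod_congr rfl fun E hE => ?_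
    rw [Finset.mem_sdiff] at hE
    rw [hn z E ((mem_feynmanDiagrams.1 hT).1 hE.1) hE.2]
  · refine Finset.prod_congr rfl fun E hE => ?_
    rw [h.shifted_eq hX₀ hF (Finset.mem_inter.1 hE).2]

/-- Two or more factors from `F` give `z⁻²`. For the triangulations with a single one, the `1/z`
parts are subtracted all at once, because `cancel` says that their coefficients sum to zero. -/
theorem noPoleAtInfinity (h : FlipShift α H Y D₀ F lam) (hX₀ : X D₀ ≠ 0)
    (hF : ∀ z, ∀ D ∈ F, Xh z D = X D - lam D * (1 - z) * X D₀)
    (hn : ∀ z, ∀ D ∈ diagonals α.length, D ∉ F → Xh z D = X D) :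
    NoPoleAtInfinity fun z => amplitude α (Xh z) := by
  simp only [h.amplitude_shifted hX₀ hF hn]
  -- Any radius beyond all poles would do; the sum of the norms of the pole positions bounds each of
  -- them.
  refine noPoleAtInfinity_of_isBigO (R₀ := ∑ D ∈ F, ‖polePos lam D₀ X D‖) ?_ ?_
  · intro z hz
    refine DifferentiableAt.fun_sum fun T _ => (differentiableAt_const _).mul ?_
    refine DifferentiableAt.fun_finsetProd fun E hE => ?_
    have hEF := (Finset.mem_inter.1 hE).2
    refine DifferentiableAt.inv (by fun_prop) (mul_ne_zero (mul_ne_zero (h.lam_ne_zero hEF) hX₀) ?_)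
    intro h0
    rw [sub_eq_zero] at h0
    have := Finset.single_le_sum (f := fun D => ‖polePos lam D₀ X D‖)
      (fun _ _ => norm_nonneg _) hEF
    rw [h0] at hz
    exact absurd hz (not_lt.2 this)
  · simp only [← Finset.sum_filter_add_sum_filter_not (feynmanDiagrams α)
      (fun T => (T ∩ F).card = 1)]
    refine IsBigO.add ?_ ?_
    · have hc := h.cancel fun E => (X E)⁻¹
      -- The difference of the two sides is `(X D₀)⁻¹ * z⁻¹` times the vanishing sum `hc`; here
      -- `(lam D)⁻¹ = lam D` is used.
      have heq : ∀ z : ℂ, ∑ T ∈ (feynmanDiagrams α).filter (fun T => (T ∩ F).card = 1),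
          (∏ E ∈ T \ F, (X E)⁻¹) * ∏ E ∈ T ∩ F, (lam E * X D₀ * (z - polePos lam D₀ X E))⁻¹ =
          ∑ T ∈ (feynmanDiagrams α).filter (fun T => (T ∩ F).card = 1),
          (∏ E ∈ T \ F, (X E)⁻¹) * (∏ E ∈ T ∩ F, lam E) * (X D₀)⁻¹ *
            ∑ E ∈ T ∩ F, ((z - polePos lam D₀ X E)⁻¹ - z⁻¹) := by
        intro z
        rw [← sub_eq_zero, ← Finset.sum_sub_distrib]
        rw [← mul_zero ((X D₀)⁻¹ * z⁻¹), ← hc, Finset.mul_sum]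
        refine Finset.sum_congr rfl fun T hT => ?_
        obtain ⟨D, hD⟩ := Finset.card_eq_one.1 (Finset.mem_filter.1 hT).2
        have hDF : D ∈ F := Finset.mem_of_mem_inter_right (hD ▸ Finset.mem_singleton_self D)
        rw [hD, Finset.prod_singleton, Finset.prod_singleton, Finset.sum_singleton, mul_inv,
          mul_inv, h.inv_lam hDF]
        ring
      simp only [heq]
      refine IsBigO.fun_sum fun T _ => IsBigO.const_mul_left ?_ _
      exact IsBigO.fun_sum fun E _ => isBigO_inv_sub_sub_inv _
    · refine IsBigO.fun_sum fun T hT => IsBigO.const_mul_left ?_ _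
      refine isBigO_prod_inv_linear _ ?_ _ _
      rw [Finset.mem_filter] at hT
      obtain ⟨D, hD, hDF⟩ := h.meets T hT.1
      have : 0 < (T ∩ F).card := Finset.card_pos.2 ⟨D, Finset.mem_inter.2 ⟨hD, hDF⟩⟩
      omega

theorem polePos_ne_one (h : FlipShift α H Y D₀ F lam) (hX₀ : X D₀ ≠ 0) {D : ℕ × ℕ} (hD : D ∈ F)
    (hXD : X D ≠ 0) : polePos lam D₀ X D ≠ 1 := by
  have := h.lam_ne_zero hD
  rw [polePos, ne_eq, sub_eq_self]
  positivity

theorem channelTerm_eq (h : FlipShift α H Y D₀ F lam) {D : ℕ × ℕ} (hD : D ∈ F) :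
    channelTerm α lam D₀ X Xh D = (1 / X D - 1 / (lam D * X D₀)) *
      ∑ T ∈ (feynmanDiagrams α).filter (D ∈ ·),
        ∏ E ∈ T.erase D, (Xh (polePos lam D₀ X D) E)⁻¹ := by
  rw [channelTerm, mul_assoc, amplitude_mul_amplitude (h.mem D hD).1 (h.mem D hD).2]

/-- Since no other element of `F` has its pole at `p`, only the terms whose triangulation contains
`D` are singular there, and their pole is simple. -/
theorem tendsto_residue (h : FlipShift α H Y D₀ F lam) (hX₀ : X D₀ ≠ 0)
    (hF : ∀ z, ∀ D ∈ F, Xh z D = X D - lam D * (1 - z) * X D₀)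
    (hn : ∀ z, ∀ D ∈ diagonals α.length, D ∉ F → Xh z D = X D)
    (hX : ∀ D ∈ diagonals α.length, Allowed α D → X D ≠ 0) {D : ℕ × ℕ} (hD : D ∈ F)
    (hne : ∀ E ∈ F, E ≠ D → polePos lam D₀ X E ≠ polePos lam D₀ X D) :
    Tendsto (fun z => (z - polePos lam D₀ X D) * (z / (z - 1) * amplitude α (Xh z)))
      (𝓝[≠] polePos lam D₀ X D) (𝓝 (-channelTerm α lam D₀ X Xh D)) := by
  set p := polePos lam D₀ X D with hp
  have hXD := hX D (h.mem D hD).1 (h.mem D hD).2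
  have hl := h.lam_ne_zero hD
  have hp1 : p ≠ 1 := h.polePos_ne_one hX₀ hD hXD
  have hfac : Tendsto (fun z : ℂ => z / (z - 1)) (𝓝[≠] p) (𝓝 (p / (p - 1))) := by
    have : ContinuousAt (fun z : ℂ => z / (z - 1)) p :=
      ContinuousAt.div (by fun_prop) (by fun_prop) (sub_ne_zero.2 hp1)
    exact this.tendsto.mono_left nhdsWithin_le_nhds
  have hcont : ∀ T ∈ feynmanDiagrams α, ∀ E ∈ T, E ≠ D →
      Tendsto (fun z => (Xh z E)⁻¹) (𝓝[≠] p) (𝓝 (Xh p E)⁻¹) := by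
    intro T hT E hE hED
    have hET := (mem_feynmanDiagrams.1 hT).1 hE
    by_cases hEF : E ∈ F
    · have : ContinuousAt (fun z => (Xh z E)⁻¹) p := by
        have heq : (fun z => Xh z E) = fun z => lam E * X D₀ * (z - polePos lam D₀ X E) :=
          funext fun z => h.shifted_eq hX₀ hF hEF z
        refine ContinuousAt.inv₀ (by rw [heq]; fun_prop) ?_
        rw [h.shifted_eq hX₀ hF hEF]
        exact mul_ne_zero (mul_ne_zero (h.lam_ne_zero hEF) hX₀)
          (sub_ne_zero.2 (hne E hEF hED).symm)
      exact this.tendsto.mono_left nhdsWithin_le_nhds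
    · simp only [hn _ E hET hEF]
      exact tendsto_const_nhds
  have hterm : ∀ T ∈ feynmanDiagrams α,
      Tendsto (fun z => (z - p) * ∏ E ∈ T, (Xh z E)⁻¹) (𝓝[≠] p)
        (𝓝 (if D ∈ T then (lam D * X D₀)⁻¹ * ∏ E ∈ T.erase D, (Xh p E)⁻¹ else 0)) := by
    intro T hT
    split_ifs with hDT
    · have h1 : Tendsto (fun z => (lam D * X D₀)⁻¹ * ∏ E ∈ T.erase D, (Xh z E)⁻¹) (𝓝[≠] p)
          (𝓝 ((lam D * X D₀)⁻¹ * ∏ E ∈ T.erase D, (Xh p E)⁻¹)) :=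
        (tendsto_finsetProd _ fun E hE =>
          hcont T hT E (Finset.mem_of_mem_erase hE) (Finset.ne_of_mem_erase hE)).const_mul _
      refine h1.congr' ?_
      filter_upwards [self_mem_nhdsWithin] with z hz
      have hz' : z - p ≠ 0 := sub_ne_zero.2 hz
      rw [← Finset.mul_prod_erase T _ hDT, h.shifted_eq hX₀ hF hD, ← hp]
      field_simp
    · have h1 : Tendsto (fun z => (z - p) * ∏ E ∈ T, (Xh z E)⁻¹) (𝓝[≠] p)
          (𝓝 ((p - p) * ∏ E ∈ T, (Xh p E)⁻¹)) := by
        refine Tendsto.mul ?_ (tendsto_finsetProd _ fun E hE =>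
          hcont T hT E hE fun h => hDT (h ▸ hE))
        exact (tendsto_id.sub_const p).mono_left nhdsWithin_le_nhds
      simpa using h1
  have hsum := hfac.mul (tendsto_finsetSum _ hterm)
  -- As `X D = lam D * X D₀ * (1 - p)`, the factor `p / (p - 1) * (lam D * X D₀)⁻¹` is minus the
  -- prefactor of `channelTerm`.
  have hval : p / (p - 1) * ∑ T ∈ feynmanDiagrams α,
      (if D ∈ T then (lam D * X D₀)⁻¹ * ∏ E ∈ T.erase D, (Xh p E)⁻¹ else 0) =
      -channelTerm α lam D₀ X Xh D := by
    rw [h.channelTerm_eq hD, ← Finset.sum_filter, ← Finset.mul_sum, ← hp, ← mul_assoc, ← neg_mul]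
    congr 1
    have h1 : 1 - p ≠ 0 := sub_ne_zero.2 hp1.symm
    have h2 : X D = lam D * X D₀ * (1 - p) := by rw [hp, polePos]; field_simp; ring
    rw [h2, show p - 1 = -(1 - p) by ring]
    field_simp
    ring
  rw [← hval]
  refine hsum.congr fun z => ?_
  rw [amplitude, Finset.mul_sum, Finset.mul_sum, Finset.mul_sum]
  refine Finset.sum_congr rfl fun T _ => ?_
  ring

/-- Exchanging the sums over channels and triangulations leaves one partial fraction identity per
triangulation. Only diagonals of a common triangulation occur in it, so distinct poles are needed
for non-crossing pairs only. -/
theorem sum_channels (h : FlipShift α H Y D₀ F lam) (hX₀ : X D₀ ≠ 0)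
    (hF : ∀ z, ∀ D ∈ F, Xh z D = X D - lam D * (1 - z) * X D₀)
    (hn : ∀ z, ∀ D ∈ diagonals α.length, D ∉ F → Xh z D = X D)
    (hX : ∀ D ∈ diagonals α.length, Allowed α D → X D ≠ 0)
    (hne : ∀ D ∈ F, ∀ E ∈ F, D ≠ E → ¬ Crossing D E → polePos lam D₀ X D ≠ polePos lam D₀ X E) :
    amplitude α X = ∑ D ∈ F, channelTerm α lam D₀ X Xh D := by
  have h1 : ∑ D ∈ F, channelTerm α lam D₀ X Xh D = ∑ T ∈ feynmanDiagrams α, ∑ D ∈ T ∩ F,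
      (1 / X D - 1 / (lam D * X D₀)) * ∏ E ∈ T.erase D, (Xh (polePos lam D₀ X D) E)⁻¹ := by
    simp only [Finset.inter_comm _ F, ← Finset.filter_mem_eq_inter, Finset.sum_filter]
    rw [Finset.sum_comm]
    refine Finset.sum_congr rfl fun D hD => ?_
    rw [h.channelTerm_eq hD, ← Finset.sum_filter, Finset.mul_sum]
  have hXF : ∀ D ∈ F, X D = lam D * X D₀ * (1 - polePos lam D₀ X D) := by
    intro D hD
    have := h.lam_ne_zero hD
    rw [polePos]; field_simp; ring
  have hpole : ∀ D ∈ F, polePos lam D₀ X D ≠ 1 := fun D hD =>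
    h.polePos_ne_one hX₀ hD (hX D (h.mem D hD).1 (h.mem D hD).2)
  -- With a single pole the identity fails by `1/(1 - p) - p/(1 - p) = 1`; the resulting defects sum
  -- to zero by `cancel`.
  have h2 : ∀ T ∈ feynmanDiagrams α, ∑ D ∈ T ∩ F,
      (1 / X D - 1 / (lam D * X D₀)) * ∏ E ∈ T.erase D, (Xh (polePos lam D₀ X D) E)⁻¹ =
      ∏ E ∈ T, (X E)⁻¹ - if (T ∩ F).card = 1 then
        (X D₀)⁻¹ * ((∏ E ∈ T \ F, (X E)⁻¹) * ∏ E ∈ T ∩ F, lam E) else 0 := by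
    intro T hT
    have hT' := mem_feynmanDiagrams.1 hT
    set s := T ∩ F with hs
    have hsF : ∀ D ∈ s, D ∈ F := fun D hD => (Finset.mem_inter.1 hD).2
    have hterm : ∀ D ∈ s,
        (1 / X D - 1 / (lam D * X D₀)) * ∏ E ∈ T.erase D, (Xh (polePos lam D₀ X D) E)⁻¹ =
        (∏ E ∈ T \ F, (X E)⁻¹) * (∏ E ∈ s, (lam E * X D₀)⁻¹) *
          (polePos lam D₀ X D / (1 - polePos lam D₀ X D) *
            ∏ E ∈ s.erase D, (polePos lam D₀ X D - polePos lam D₀ X E)⁻¹) := by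
      intro D hD
      have hDF := hsF D hD
      have hsplit : T.erase D = s.erase D ∪ T \ F := by
        ext E
        simp only [hs, Finset.mem_erase, Finset.mem_union, Finset.mem_inter, Finset.mem_sdiff]
        constructor
        · rintro ⟨a, b⟩; by_cases hE : E ∈ F <;> simp [a, b, hE]
        · rintro (⟨a, b, -⟩ | ⟨a, b⟩)
          · exact ⟨a, b⟩
          · exact ⟨fun hED => b (hED ▸ hDF), a⟩
      have hdis : Disjoint (s.erase D) (T \ F) := by
        rw [Finset.disjoint_left]
        intro E hE hE'
        exact (Finset.mem_sdiff.1 hE').2 (hsF E (Finset.mem_of_mem_erase hE))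
      rw [hsplit, Finset.prod_union hdis]
      have e1 : ∏ E ∈ T \ F, (Xh (polePos lam D₀ X D) E)⁻¹ = ∏ E ∈ T \ F, (X E)⁻¹ :=
        Finset.prod_congr rfl fun E hE => by
          rw [Finset.mem_sdiff] at hE
          rw [hn _ E (hT'.1 hE.1) hE.2]
      have e2 : ∏ E ∈ s.erase D, (Xh (polePos lam D₀ X D) E)⁻¹ =
          (∏ E ∈ s.erase D, (lam E * X D₀)⁻¹) *
            ∏ E ∈ s.erase D, (polePos lam D₀ X D - polePos lam D₀ X E)⁻¹ := by
        rw [← Finset.prod_mul_distrib]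
        refine Finset.prod_congr rfl fun E hE => ?_
        rw [h.shifted_eq hX₀ hF (hsF E (Finset.mem_of_mem_erase hE)), mul_inv]
      rw [e1, e2, ← Finset.mul_prod_erase s _ hD]
      have hl := h.lam_ne_zero hDF
      have hp : 1 - polePos lam D₀ X D ≠ 0 := sub_ne_zero.2 (hpole D hDF).symm
      have e3 : 1 / X D - 1 / (lam D * X D₀) =
          (lam D * X D₀)⁻¹ * (polePos lam D₀ X D / (1 - polePos lam D₀ X D)) := by
        rw [hXF D hDF]; field_simp; ring
      rw [e3]; ring
    rw [Finset.sum_congr rfl hterm, ← Finset.mul_sum]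
    have hprod : ∏ E ∈ T, (X E)⁻¹ = (∏ E ∈ T \ F, (X E)⁻¹) * (∏ E ∈ s, (lam E * X D₀)⁻¹) *
        ∏ E ∈ s, (1 - polePos lam D₀ X E)⁻¹ := by
      rw [← Finset.prod_inter_mul_prod_sdiff T F, ← hs, mul_comm, mul_assoc,
        ← Finset.prod_mul_distrib]
      congr 1
      refine Finset.prod_congr rfl fun E hE => ?_
      rw [hXF E (hsF E hE), mul_inv]
    rw [hprod]
    split_ifs with hcard
    · obtain ⟨D, hD⟩ := Finset.card_eq_one.1 hcard
      have hDF := hsF D (hD ▸ Finset.mem_singleton_self D)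
      have hp : 1 - polePos lam D₀ X D ≠ 0 := sub_ne_zero.2 (hpole D hDF).symm
      rw [hD]
      simp only [Finset.prod_singleton, Finset.sum_singleton, Finset.erase_singleton,
        Finset.prod_empty, mul_inv, h.inv_lam hDF]
      field_simp
      ring
    · obtain ⟨D, hD, hDF⟩ := h.meets T hT
      have : 0 < s.card := Finset.card_pos.2 ⟨D, Finset.mem_inter.2 ⟨hD, hDF⟩⟩
      rw [sum_residues s _ ?_ (fun E hE => hpole E (hsF E hE)) (by omega), sub_zero]
      intro D hD E hE heq
      by_contra hDE
      exact hne D (hsF D hD) E (hsF E hE) hDE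
        (hT'.2.2.2 D (Finset.mem_inter.1 hD).1 E (Finset.mem_inter.1 hE).1) heq
  rw [h1, Finset.sum_congr rfl h2, Finset.sum_sub_distrib, ← Finset.sum_filter, ← Finset.mul_sum,
    h.cancel, mul_zero, sub_zero, amplitude]

end shifted

theorem isRecursion (h : FlipShift α H Y D₀ F lam) : IsRecursion α H Y D₀ F lam := by
  refine ⟨h.mem, fun c b X hX => ⟨h.basis.exists_isShift h.mem_Y c b X, fun Xh hs => ?_⟩⟩
  have hF : ∀ z, ∀ D ∈ F, Xh z D = X D - lam D * (1 - z) * X D₀ := fun z D hD => by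
    rw [h.isShift_apply hX hs z D (h.mem D hD).1, shiftDir, if_pos hD]; ring
  have hn : ∀ z, ∀ D ∈ diagonals α.length, D ∉ F → Xh z D = X D := fun z D hD hDF => by
    rw [h.isShift_apply hX hs z D hD, shiftDir, if_neg hDF]; ring
  refine ⟨hF, hn, fun hne => ?_⟩
  have hX₀ := hne D₀ (h.mem _ h.mem_F).1 (h.mem _ h.mem_F).2
  exact ⟨h.noPoleAtInfinity hX₀ hF hn,
    fun D hD hp => h.tendsto_residue hX₀ hF hn hne hD hp,
    fun hp => h.sum_channels hX₀ hF hn hne hp⟩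

end FlipShift

/-! ### Heights along a sequence of blocks -/

theorem fl_apply (r s : ℕ) : fl r s = if r = s then 1 else 0 := Finsupp.single_apply

/-- A total flavour that a propagator may carry. -/
def AllowedFlavor (d : Flavor) : Prop := d = 0 ∨ ∃ r, d = fl r ∨ d = -fl r

theorem allowedFlavor_neg {d : Flavor} : AllowedFlavor (-d) ↔ AllowedFlavor d := by
  simp only [AllowedFlavor, neg_eq_iff_eq_neg, neg_neg, neg_zero]
  simp only [or_comm]

/-- An allowed flavour has at most one non-zero coefficient. Thus crossing one known flavour line
excludes crossing any other. -/
theorem AllowedFlavor.eq_fl {d : Flavor} (h : AllowedFlavor d) {r : ℕ} (hr : d r = 1) :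
    d = fl r := by
  rcases h with rfl | ⟨s, rfl | rfl⟩
  · simp at hr
  · rw [fl_apply] at hr
    split_ifs at hr with h
    · rw [h]
    · exact absurd hr (by norm_num)
  · rw [Finsupp.neg_apply, fl_apply] at hr
    split_ifs at hr; omega

theorem AllowedFlavor.eq_neg_fl {d : Flavor} (h : AllowedFlavor d) {r : ℕ} (hr : d r = -1) :
    d = -fl r := by
  rw [← neg_eq_iff_eq_neg]
  exact (allowedFlavor_neg.2 h).eq_fl (by rw [Finsupp.neg_apply, hr, neg_neg])

theorem AllowedFlavor.eq_zero_or_fl {d : Flavor} (h : AllowedFlavor d) (hd : ∀ s, 0 ≤ d s) :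
    d = 0 ∨ ∃ r, d = fl r := by
  rcases h with h | ⟨s, h | h⟩
  · exact Or.inl h
  · exact Or.inr ⟨s, h⟩
  · have := hd s
    rw [h, Finsupp.neg_apply, fl_apply, if_pos rfl] at this
    omega

/-- The heights `h` of the vertices are those of the blocks that start at the vertex `a`. -/
def Fits (h : ℕ → Flavor) (a : ℕ) : Blocks → Prop
  | .nil => True
  | .adj B => h (a + 1) = h a ∧ Fits h (a + 1) B
  | .pair r S B => h (a + 1) = h a + fl r ∧ Fits h (a + 1) S ∧ h (a + S.size + 2) = h a ∧
      Fits h (a + S.size + 2) B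

theorem Blocks.sum_word : ∀ B : Blocks, B.word.sum = 0
  | .nil => rfl
  | .adj B => by rw [word, List.sum_cons, B.sum_word, zero_add]
  | .pair r S B => by
    rw [word, List.sum_cons, List.sum_append, List.sum_cons, B.sum_word, S.sum_word]; abel

theorem Blocks.length_word : ∀ B : Blocks, B.word.length = B.size
  | .nil => rfl
  | .adj B => by rw [word, List.length_cons, B.length_word, size, add_comm]
  | .pair r S B => by
    rw [word, List.length_cons, List.length_append, List.length_cons, B.length_word,
      S.length_word, size]
    ring

theorem height_length_append (u v : List Flavor) {a : ℕ} (ha : a = u.length + 1) :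
    height (u ++ v) a = u.sum := by
  rw [height, ha, Nat.add_sub_cancel, List.take_left']
  rfl

/-- The induction carries the particles `u` before and `v` after the blocks, since the sub-blocks
occupy a contiguous part of the ordering. Heights return at the end of a block because its word sums
to zero. -/
theorem fits_height (α : List Flavor) : ∀ (B : Blocks) (u v : List Flavor) (a : ℕ),
    α = u ++ (B.word ++ v) → a = u.length + 1 → Fits (height α) a B
  | .nil, _, _, _, _, _ => trivial
  | .adj B, u, v, a, hα, ha => by
    have e1 : α = (u ++ [0]) ++ (B.word ++ v) := by simp [hα, Blocks.word]
    refine ⟨?_, fits_height α B (u ++ [0]) v (a + 1) e1 (by simp [ha])⟩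
    rw [e1, height_length_append _ _ (by simp [ha]), ← e1, hα, height_length_append _ _ ha]
    simp
  | .pair r S B, u, v, a, hα, ha => by
    have e1 : α = (u ++ [fl r]) ++ (S.word ++ (-fl r :: (B.word ++ v))) := by
      simp [hα, Blocks.word]
    have e2 : α = (u ++ (fl r :: (S.word ++ [-fl r]))) ++ (B.word ++ v) := by
      simp [hα, Blocks.word]
    have l2 : a + S.size + 2 = (u ++ (fl r :: (S.word ++ [-fl r]))).length + 1 := by
      simp [ha, Blocks.length_word]; ring
    have h0 : height α a = u.sum := by rw [hα, height_length_append _ _ ha]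
    refine ⟨?_, fits_height α S (u ++ [fl r]) _ (a + 1) e1 (by simp [ha]), ?_,
      fits_height α B _ v _ e2 l2⟩
    · rw [h0, e1, height_length_append _ _ (by simp [ha])]; simp
    · rw [h0, e2, height_length_append _ _ l2]; simp [Blocks.sum_word]

section fits

variable {h : ℕ → Flavor}

theorem Fits.height_end : ∀ {B : Blocks} {a : ℕ}, Fits h a B → h (a + B.size) = h a
  | .nil, _, _ => rfl
  | .adj B, a, hB => by
    rw [Blocks.size, ← add_assoc, hB.2.height_end, hB.1]
  | .pair r S B, a, hB => by
    rw [Blocks.size, show a + (S.size + 2 + B.size) = a + S.size + 2 + B.size by ring,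
      hB.2.2.2.height_end, hB.2.2.1]

/-- Every vertex lies inside each flavour line at most once. -/
theorem Fits.coeff : ∀ {B : Blocks} {a : ℕ}, Fits h a B → B.flavors.Nodup → ∀ v, a ≤ v →
    v ≤ a + B.size → ∀ s, h v s = h a s ∨ (h v s = h a s + 1 ∧ s ∈ B.flavors)
  | .nil, a, _, _, v, h1, h2, s => by
    rw [Blocks.size] at h2
    rw [show v = a by omega]; exact Or.inl rfl
  | .adj B, a, hB, hn, v, h1, h2, s => by
    rw [Blocks.size] at h2
    rcases Nat.eq_or_lt_of_le h1 with rfl | h1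
    · exact Or.inl rfl
    · rw [← hB.1]; exact hB.2.coeff hn v h1 (by omega) s
  | .pair r S B, a, hB, hn, v, h1, h2, s => by
    rw [Blocks.size] at h2
    rw [Blocks.flavors, List.nodup_cons, List.nodup_append, List.mem_append, not_or] at hn
    rw [Blocks.flavors, List.mem_cons, List.mem_append]
    rcases Nat.eq_or_lt_of_le h1 with rfl | h1
    · exact Or.inl rfl
    · by_cases h3 : a + S.size + 2 ≤ v
      · rw [← hB.2.2.1]
        rcases hB.2.2.2.coeff hn.2.2.1 v h3 (by omega) s with h | h
        · exact Or.inl h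
        · exact Or.inr ⟨h.1, Or.inr (Or.inr h.2)⟩
      · have := hB.2.1.coeff hn.2.1 v h1 (by omega) s
        rw [hB.1, Finsupp.add_apply, fl_apply] at this
        split_ifs at this with hrs
        · subst hrs
          rcases this with h | h
          · exact Or.inr ⟨h, Or.inl rfl⟩
          · exact absurd h.2 hn.1.1
        · rw [add_zero] at this
          rcases this with h | h
          · exact Or.inl h
          · exact Or.inr ⟨h.1, Or.inr (Or.inl h.2)⟩

/-- The vertices inside a block lie inside its flavour line. -/
theorem Fits.coeff_inside {r : ℕ} {S B : Blocks} {a : ℕ} (hB : Fits h a (.pair r S B))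
    (hn : (Blocks.pair r S B).flavors.Nodup) {v : ℕ} (h1 : a < v) (h2 : v ≤ a + S.size + 1) :
    h v r = h a r + 1 := by
  rw [Blocks.flavors, List.nodup_cons, List.nodup_append, List.mem_append, not_or] at hn
  have := hB.2.1.coeff hn.2.1 v h1 (by omega) r
  rw [hB.1, Finsupp.add_apply, fl_apply, if_pos rfl] at this
  rcases this with h | h
  · exact h
  · exact absurd h.2 hn.1.1

theorem Blocks.intervals_bounds {B : Blocks} : ∀ {a : ℕ}, ∀ I ∈ B.intervals a,
    a ≤ I.1 ∧ I.1 < I.2 ∧ I.2 ≤ a + B.size := by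
  induction B with
  | nil => intro a I hI; simp [intervals] at hI
  | adj B ih =>
    intro a I hI
    simp only [intervals, List.mem_cons, size] at *
    rcases hI with rfl | hI
    · simp only [pt]; omega
    · have := ih I hI; omega
  | pair r S B _ ih =>
    intro a I hI
    simp only [intervals, List.mem_cons, size] at *
    rcases hI with rfl | hI
    · simp only; omega
    · have := ih I hI; omega

theorem Fits.height_intervals : ∀ {B : Blocks} {a : ℕ}, Fits h a B → ∀ I ∈ B.intervals a,
    h I.1 = h a ∧ h I.2 = h a
  | .nil, _, _, I, hI => by simp [Blocks.intervals] at hI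
  | .adj B, a, hB, I, hI => by
    simp only [Blocks.intervals, List.mem_cons] at hI
    rcases hI with rfl | hI
    · exact ⟨rfl, hB.1⟩
    · rw [← hB.1]; exact hB.2.height_intervals I hI
  | .pair r S B, a, hB, I, hI => by
    simp only [Blocks.intervals, List.mem_cons] at hI
    rcases hI with rfl | hI
    · exact ⟨rfl, hB.2.2.1⟩
    · rw [← hB.2.2.1]; exact hB.2.2.2.height_intervals I hI

theorem Blocks.intervals_inj {B : Blocks} : ∀ {a : ℕ}, ∀ I ∈ B.intervals a,
    ∀ J ∈ B.intervals a, (I.1 = J.1 ∨ I.2 = J.2) → I = J := by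
  induction B with
  | nil => intro a I hI; simp [intervals] at hI
  | adj B ih =>
    intro a I hI J hJ hIJ
    simp only [intervals, List.mem_cons, pt] at *
    rcases hI with rfl | hI <;> rcases hJ with rfl | hJ
    · rfl
    · have := intervals_bounds J hJ; simp only at hIJ; omega
    · have := intervals_bounds I hI; simp only at hIJ; omega
    · exact ih I hI J hJ hIJ
  | pair r S B _ ih =>
    intro a I hI J hJ hIJ
    simp only [intervals, List.mem_cons] at *
    rcases hI with rfl | hI <;> rcases hJ with rfl | hJ
    · rfl
    · have := intervals_bounds J hJ; simp only at hIJ; omega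
    · have := intervals_bounds I hI; simp only at hIJ; omega
    · exact ih I hI J hJ hIJ

/-- A function that agrees at the two ends of each block is constant on the vertices between the
blocks. -/
theorem Fits.const_of_intervals {f : ℕ → ℂ} : ∀ {B : Blocks} {a : ℕ}, Fits h a B →
    B.flavors.Nodup → (∀ I ∈ B.intervals a, f I.1 = f I.2) →
    ∀ v, a ≤ v → v ≤ a + B.size → h v = h a → f v = f a
  | .nil, a, _, _, _, v, h1, h2, _ => by
    rw [Blocks.size] at h2
    rw [show v = a by omega]
  | .adj B, a, hB, hn, hf, v, h1, h2, h3 => by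
    simp only [Blocks.intervals, List.mem_cons, forall_eq_or_imp, pt] at hf
    rw [Blocks.size] at h2
    rcases Nat.eq_or_lt_of_le h1 with rfl | h1
    · rfl
    · rw [hf.1]
      exact hB.2.const_of_intervals hn hf.2 v h1 (by omega) (by rw [h3, hB.1])
  | .pair r S B, a, hB, hn, hf, v, h1, h2, h3 => by
    simp only [Blocks.intervals, List.mem_cons, forall_eq_or_imp] at hf
    rw [Blocks.size] at h2
    rcases Nat.eq_or_lt_of_le h1 with rfl | h1
    · rfl
    · by_cases h4 : a + S.size + 2 ≤ v
      · rw [hf.1]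
        rw [Blocks.flavors, List.nodup_cons, List.nodup_append] at hn
        exact hB.2.2.2.const_of_intervals hn.2.2.1 hf.2 v h4 (by omega) (by rw [h3, hB.2.2.1])
      · have := hB.coeff_inside hn h1 (by omega)
        rw [h3] at this; omega

theorem Blocks.intervals_eq_nil {B : Blocks} {a : ℕ} : B.intervals a = [] ↔ B = .nil := by
  cases B <;> simp [intervals]

theorem Blocks.size_pos {B : Blocks} (hB : B ≠ .nil) : 0 < B.size := by
  cases B
  · exact absurd rfl hB
  · rw [size]; omega
  · rw [size]; omega

theorem Blocks.size_of_intervals_eq_nil {B : Blocks} {a : ℕ} (hB : B.intervals a = []) :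
    B.size = 0 := by
  rw [intervals_eq_nil.1 hB, size]

/-- Without the last block nothing is known about the final vertex, hence `v < a + B.size`. This
matches the omission of the last sub-block in `C3`. -/
theorem Fits.const_of_dropLast {f : ℕ → ℂ} : ∀ {B : Blocks} {a : ℕ}, Fits h a B →
    B.flavors.Nodup → (∀ I ∈ (B.intervals a).dropLast, f I.1 = f I.2) →
    ∀ v, a ≤ v → v < a + B.size → h v = h a → f v = f a
  | .nil, a, _, _, _, v, h1, h2, _ => by
    rw [Blocks.size] at h2; omega
  | .adj B, a, hB, hn, hf, v, h1, h2, h3 => by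
    simp only [Blocks.intervals, pt] at hf
    rw [Blocks.size] at h2
    rcases Nat.eq_or_lt_of_le h1 with rfl | h1
    · rfl
    · by_cases hnil : B.intervals (a + 1) = []
      · have := Blocks.size_of_intervals_eq_nil hnil; omega
      · rw [List.dropLast_cons_of_ne_nil hnil] at hf
        simp only [List.mem_cons, forall_eq_or_imp] at hf
        rw [hf.1]
        exact hB.2.const_of_dropLast hn hf.2 v h1 (by omega) (by rw [h3, hB.1])
  | .pair r S B, a, hB, hn, hf, v, h1, h2, h3 => by
    simp only [Blocks.intervals] at hf
    rw [Blocks.size] at h2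
    rcases Nat.eq_or_lt_of_le h1 with rfl | h1
    · rfl
    · by_cases h4 : a + S.size + 2 ≤ v
      · by_cases hnil : B.intervals (a + S.size + 2) = []
        · have := Blocks.size_of_intervals_eq_nil hnil; omega
        · rw [List.dropLast_cons_of_ne_nil hnil] at hf
          simp only [List.mem_cons, forall_eq_or_imp] at hf
          rw [hf.1]
          rw [Blocks.flavors, List.nodup_cons, List.nodup_append] at hn
          exact hB.2.2.2.const_of_dropLast hn.2.2.1 hf.2 v h4 (by omega)
            (by rw [h3, hB.2.2.1])
      · have := hB.coeff_inside hn h1 (by omega)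
        rw [h3] at this; omega

theorem Blocks.lt_of_mem_dropLast {B : Blocks} : ∀ {a : ℕ}, ∀ I ∈ (B.intervals a).dropLast,
    I.2 < a + B.size := by
  induction B with
  | nil => intro a I hI; simp [intervals] at hI
  | adj B ih =>
    intro a I hI
    simp only [intervals, size] at *
    by_cases hnil : B.intervals (a + 1) = []
    · rw [hnil] at hI; simp at hI
    · rw [List.dropLast_cons_of_ne_nil hnil, List.mem_cons] at hI
      rcases hI with rfl | hI
      · have := size_pos (fun h => hnil (intervals_eq_nil.2 h)); simp only [pt]; omega
      · have := ih I hI; omega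
  | pair r S B _ ih =>
    intro a I hI
    simp only [intervals, size] at *
    by_cases hnil : B.intervals (a + S.size + 2) = []
    · rw [hnil] at hI; simp at hI
    · rw [List.dropLast_cons_of_ne_nil hnil, List.mem_cons] at hI
      rcases hI with rfl | hI
      · have := size_pos (fun h => hnil (intervals_eq_nil.2 h)); simp only; omega
      · have := ih I hI; omega

end fits

/-! ### The blocks to the left of a vertex -/

/-- The vertex `x` lies at the level of height `d` or inside one of its blocks. -/
def Near (d e : Flavor) : Prop := e = d ∨ ∃ r, e = d + fl r

theorem Near.allowedFlavor {d e : Flavor} (h : Near d e) : AllowedFlavor (d - e) := by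
  rcases h with rfl | ⟨r, rfl⟩
  · exact Or.inl (sub_self _)
  · exact Or.inr ⟨r, Or.inr (by abel)⟩

/-- The left-most and right-most particles and the sub-blocks of a block. -/
def BlockPos.pieces (b : BlockPos) : Set (ℕ × ℕ) := {p | p = pt b.l ∨ p = pt b.r ∨ p ∈ b.sub}

theorem pairPos_mem_pieces {a : ℕ} {S : Blocks} {p : ℕ × ℕ} : p ∈ (pairPos a S).pieces ↔
    p = (a, a + 1) ∨ p = (a + S.size + 1, a + S.size + 2) ∨ p ∈ S.intervals (a + 1) := Iff.rfl

theorem adj_mem_pieces {a : ℕ} {p : ℕ × ℕ} :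
    p ∈ (BlockPos.mk a a []).pieces ↔ p = (a, a + 1) := by
  simp [BlockPos.pieces, pt]

/-- `prev` is the list of blocks between the vertices `r₁ + 1` and `a`, with flavours in `P`. -/
structure IsPrefix (h : ℕ → Flavor) (r₁ : ℕ) (P : List ℕ) (prev : List BlockPos) (a : ℕ) :
    Prop where
  le : r₁ + 1 ≤ a
  height_eq : h a = h (r₁ + 1)
  last : (prev.getLast?.map BlockPos.r).getD r₁ = a - 1
  coeff : ∀ x, r₁ + 1 ≤ x → x ≤ a → ∀ s, h x s = h a s ∨ (h x s = h a s + 1 ∧ s ∈ P)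
  piece : ∀ b ∈ prev, ∀ p ∈ b.pieces, r₁ + 1 ≤ p.1 ∧ p.1 < p.2 ∧ p.2 ≤ a ∧
    Near (h a) (h p.1) ∧ Near (h a) (h p.2) ∧ (p.2 = p.1 + 1 ∨ h p.1 = h p.2)
  -- A piece is recognised by its right end, so the one ending at `a` is the one that `C1` leaves
  -- out.
  piece_inj : ∀ b ∈ prev, ∀ p ∈ b.pieces, ∀ b' ∈ prev, ∀ p' ∈ b'.pieces, p.2 = p'.2 → p = p'
  last_piece : r₁ + 1 < a → ∃ b ∈ prev, pt (a - 1) ∈ b.pieces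
  -- The left particle, the sub-blocks and the right particle lead through a block. The piece ending
  -- at `a` is dispensable for reaching the vertices before `a`.
  conn : ∀ f : ℕ → ℂ, (∀ b ∈ prev, ∀ p ∈ b.pieces, p ≠ pt (a - 1) → f p.1 = f p.2) →
    ∀ x, r₁ + 1 ≤ x → x < a → Near (h a) (h x) → f x = f (r₁ + 1)
  block : ∀ b ∈ prev, r₁ + 1 ≤ b.l ∧ b.l < b.r + 1 ∧ b.r + 1 ≤ a ∧ h b.l = h a ∧ h (b.r + 1) = h a
  block_inj : ∀ b ∈ prev, ∀ b' ∈ prev, b.l = b'.l → b.r = b'.r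
  -- The analogue for paths that jump over whole blocks and stay at the level.
  level : ∀ f : ℕ → ℂ, (∀ b ∈ prev, f b.l = f (b.r + 1)) →
    ∀ x, r₁ + 1 ≤ x → x ≤ a → h x = h a → f x = f a

namespace IsPrefix

variable {h : ℕ → Flavor} {r₁ a : ℕ} {P : List ℕ} {prev : List BlockPos}

theorem nil (h : ℕ → Flavor) (r₁ : ℕ) : IsPrefix h r₁ [] [] (r₁ + 1) where
  le := le_rfl
  height_eq := rfl
  last := rfl
  coeff x h1 h2 s := by rw [show x = r₁ + 1 by omega]; exact Or.inl rfl
  piece b hb := by simp at hb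
  piece_inj b hb := by simp at hb
  last_piece h := by omega
  conn f _ x h1 h2 := by omega
  block b hb := by simp at hb
  block_inj b hb := by simp at hb
  level f _ x h1 h2 _ := by rw [show x = r₁ + 1 by omega]

/-- Once the last piece may be used as well, the path also reaches `a`. -/
theorem conn_end (hP : IsPrefix h r₁ P prev a) {f : ℕ → ℂ}
    (hf : ∀ b ∈ prev, ∀ p ∈ b.pieces, f p.1 = f p.2) :
    ∀ x, r₁ + 1 ≤ x → x ≤ a → Near (h a) (h x) → f x = f (r₁ + 1) := by
  intro x h1 h2 h3
  have key := hP.conn f fun b hb p hp _ => hf b hb p hp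
  rcases Nat.lt_or_ge x a with h4 | h4
  · exact key x h1 h4 h3
  · obtain rfl : x = a := by omega
    rcases Nat.lt_or_ge (r₁ + 1) x with h5 | h5
    · obtain ⟨b, hb, hp⟩ := hP.last_piece h5
      have h6 := hP.piece b hb _ hp
      have h7 := hf b hb _ hp
      simp only [pt, Nat.sub_add_cancel (by omega : 1 ≤ x)] at h6 h7
      rw [← h7]
      exact key (x - 1) h6.1 (by omega) h6.2.2.2.1
    · rw [show x = r₁ + 1 by omega]

theorem snoc_adj (hP : IsPrefix h r₁ P prev a) (ha : h (a + 1) = h a) :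
    IsPrefix h r₁ P (prev ++ [⟨a, a, []⟩]) (a + 1) where
  le := by have := hP.le; omega
  height_eq := by rw [ha, hP.height_eq]
  last := by simp
  coeff x h1 h2 s := by
    rw [ha]
    rcases Nat.eq_or_lt_of_le h2 with rfl | h2
    · rw [ha]; exact Or.inl rfl
    · exact hP.coeff x h1 (by omega) s
  piece b hb p hp := by
    rw [ha]
    rw [List.mem_append, List.mem_singleton] at hb
    rcases hb with hb | rfl
    · have := hP.piece b hb p hp
      exact ⟨this.1, this.2.1, by omega, this.2.2.2⟩
    · rw [adj_mem_pieces] at hp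
      subst hp
      exact ⟨hP.le, by simp, by simp, Or.inl rfl, Or.inl ha, Or.inl rfl⟩
  piece_inj b hb p hp b' hb' p' hp' hpp := by
    rw [List.mem_append, List.mem_singleton] at hb hb'
    rcases hb with hb | rfl <;> rcases hb' with hb' | rfl
    · exact hP.piece_inj b hb p hp b' hb' p' hp' hpp
    · rw [adj_mem_pieces] at hp'
      have := hP.piece b hb p hp
      subst hp'; simp only at hpp; omega
    · rw [adj_mem_pieces] at hp
      have := hP.piece b' hb' p' hp'
      subst hp; simp only at hpp; omega
    · rw [adj_mem_pieces] at hp hp'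
      rw [hp, hp']
  last_piece _ := ⟨⟨a, a, []⟩, by simp, by rw [adj_mem_pieces]; rfl⟩
  conn f hf x h1 h2 h3 := by
    refine hP.conn_end (f := f) (fun b hb p hp => ?_) x h1 (by omega) (by rwa [← ha])
    refine hf b (by simp [hb]) p hp fun hpe => ?_
    have := hP.piece b hb p hp
    rw [hpe] at this
    simp only [pt] at this
    omega
  block b hb := by
    rw [ha]
    rw [List.mem_append, List.mem_singleton] at hb
    rcases hb with hb | rfl
    · have := hP.block b hb
      exact ⟨this.1, this.2.1, by omega, this.2.2.2⟩
    · exact ⟨hP.le, by simp, le_rfl, rfl, ha⟩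
  block_inj b hb b' hb' hbb := by
    rw [List.mem_append, List.mem_singleton] at hb hb'
    rcases hb with hb | rfl <;> rcases hb' with hb' | rfl
    · exact hP.block_inj b hb b' hb' hbb
    · have := hP.block b hb; simp only at hbb; omega
    · have := hP.block b' hb'; simp only at hbb; omega
    · rfl
  level f hf x h1 h2 h3 := by
    have h4 : f a = f (a + 1) := hf ⟨a, a, []⟩ (by simp)
    rcases Nat.eq_or_lt_of_le h2 with rfl | h2
    · rfl
    · rw [← h4]
      exact hP.level f (fun b hb => hf b (by simp [hb])) x h1 (by omega) (by rw [h3, ha])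

section pair

variable {r : ℕ} {S B : Blocks}

/-- The coefficient of `r` inside the block exceeds that at `a` by one, so an allowed difference
contains no further flavour. -/
theorem near_inside (hB : Fits h a (.pair r S B)) (hn : (Blocks.pair r S B).flavors.Nodup)
    {x : ℕ} (h1 : a < x) (h2 : x ≤ a + S.size + 1) (h3 : AllowedFlavor (h x - h a)) :
    h x = h (a + 1) := by
  have := h3.eq_fl (r := r) (by rw [Finsupp.sub_apply, hB.coeff_inside hn h1 h2]; ring)
  rw [hB.1, ← this]; abel

theorem snoc_pair (hP : IsPrefix h r₁ P prev a) (hB : Fits h a (.pair r S B))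
    (hn : (Blocks.pair r S B).flavors.Nodup) :
    IsPrefix h r₁ (P ++ r :: S.flavors) (prev ++ [pairPos a S]) (a + S.size + 2) where
  le := by have := hP.le; omega
  height_eq := by rw [hB.2.2.1, hP.height_eq]
  last := by simp [pairPos]
  coeff x h1 h2 s := by
    rw [hB.2.2.1, List.mem_append, List.mem_cons]
    by_cases h3 : x ≤ a
    · rcases hP.coeff x h1 h3 s with h | h
      · exact Or.inl h
      · exact Or.inr ⟨h.1, Or.inl h.2⟩
    · by_cases h4 : x ≤ a + S.size + 1
      · by_cases hrs : s = r
        · rw [hrs]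
          exact Or.inr ⟨hB.coeff_inside hn (by omega) h4, Or.inr (Or.inl rfl)⟩
        · rw [Blocks.flavors, List.nodup_cons, List.nodup_append] at hn
          have := hB.2.1.coeff hn.2.1 x (by omega) (by omega) s
          rw [hB.1, Finsupp.add_apply, fl_apply, if_neg (Ne.symm hrs), add_zero] at this
          rcases this with h | h
          · exact Or.inl h
          · exact Or.inr ⟨h.1, Or.inr (Or.inr h.2)⟩
      · rw [show x = a + S.size + 2 by omega, hB.2.2.1]; exact Or.inl rfl
  piece b hb p hp := by
    rw [hB.2.2.1]
    rw [List.mem_append, List.mem_singleton] at hb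
    rcases hb with hb | rfl
    · have := hP.piece b hb p hp
      exact ⟨this.1, this.2.1, by omega, this.2.2.2⟩
    · have hle := hP.le
      rw [pairPos_mem_pieces] at hp
      rcases hp with rfl | rfl | hp
      · exact ⟨hle, by simp, by simp only; omega, Or.inl rfl, Or.inr ⟨r, hB.1⟩, Or.inl rfl⟩
      · refine ⟨by simp only; omega, by simp, le_rfl, Or.inr ⟨r, ?_⟩, Or.inl hB.2.2.1, Or.inl rfl⟩
        rw [← hB.1, ← hB.2.1.height_end]
        congr 1; omega
      · have h1 := Blocks.intervals_bounds p hp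
        have h2 := hB.2.1.height_intervals p hp
        refine ⟨by omega, h1.2.1, by omega, Or.inr ⟨r, by rw [h2.1, hB.1]⟩,
          Or.inr ⟨r, by rw [h2.2, hB.1]⟩, Or.inr (by rw [h2.1, h2.2])⟩
  piece_inj b hb p hp b' hb' p' hp' hpp := by
    have hlow : ∀ p ∈ (pairPos a S).pieces, a < p.2 := by
      intro p hp
      rw [pairPos_mem_pieces] at hp
      rcases hp with rfl | rfl | hp
      · simp
      · simp only; omega
      · have := Blocks.intervals_bounds p hp; omega
    rw [List.mem_append, List.mem_singleton] at hb hb'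
    rcases hb with hb | rfl <;> rcases hb' with hb' | rfl
    · exact hP.piece_inj b hb p hp b' hb' p' hp' hpp
    · have h1 := hlow p' hp'
      have h2 := hP.piece b hb p hp
      omega
    · have h1 := hlow p hp
      have h2 := hP.piece b' hb' p' hp'
      omega
    · rw [pairPos_mem_pieces] at hp hp'
      rcases hp with rfl | rfl | hp <;> rcases hp' with rfl | rfl | hp'
      · rfl
      · simp only at hpp; omega
      · have := Blocks.intervals_bounds p' hp'; simp only at hpp; omega
      · simp only at hpp; omega
      · rfl
      · have := Blocks.intervals_bounds p' hp'; simp only at hpp; omega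
      · have := Blocks.intervals_bounds p hp; simp only at hpp; omega
      · have := Blocks.intervals_bounds p hp; simp only at hpp; omega
      · exact Blocks.intervals_inj p hp p' hp' (Or.inr hpp)
  last_piece _ := ⟨pairPos a S, by simp, by rw [pairPos_mem_pieces]; exact Or.inr (Or.inl rfl)⟩
  conn f hf x h1 h2 h3 := by
    rw [hB.2.2.1] at h3
    have hprev : ∀ y, r₁ + 1 ≤ y → y ≤ a → Near (h a) (h y) → f y = f (r₁ + 1) := by
      refine hP.conn_end (f := f) (fun b hb p hp => ?_)
      refine hf b (by simp [hb]) p hp fun hpe => ?_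
      have := hP.piece b hb p hp
      rw [hpe] at this
      simp only [pt] at this
      omega
    by_cases h4 : x ≤ a
    · exact hprev x h1 h4 h3
    -- The earlier pieces lead to `a`, the left particle to `a + 1`, and the sub-blocks onwards. The
    -- right particle of the new block is the omitted last piece.
    · have hin := near_inside hB hn (by omega) (by omega : x ≤ a + S.size + 1)
        (by rw [← neg_sub, allowedFlavor_neg]; exact h3.allowedFlavor)
      have hnS := hn
      rw [Blocks.flavors, List.nodup_cons, List.nodup_append] at hnS
      rw [hB.2.1.const_of_intervals (f := f) hnS.2.1 ?_ x (by omega) (by omega) hin]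
      · rw [← hprev a hP.le le_rfl (Or.inl rfl)]
        refine (hf (pairPos a S) (by simp) (a, a + 1) (pairPos_mem_pieces.2 (Or.inl rfl)) ?_).symm
        simp only [pt, ne_eq, Prod.mk.injEq]; omega
      · intro I hI
        refine hf (pairPos a S) (by simp) I (pairPos_mem_pieces.2 (Or.inr (Or.inr hI))) ?_
        have := Blocks.intervals_bounds I hI
        intro hIe
        rw [hIe] at this
        simp only [pt] at this
        omega
  block b hb := by
    rw [hB.2.2.1]
    rw [List.mem_append, List.mem_singleton] at hb
    rcases hb with hb | rfl
    · have := hP.block b hb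
      exact ⟨this.1, this.2.1, by omega, this.2.2.2⟩
    · exact ⟨hP.le, by simp only [pairPos]; omega, by simp only [pairPos]; omega, rfl, hB.2.2.1⟩
  block_inj b hb b' hb' hbb := by
    rw [List.mem_append, List.mem_singleton] at hb hb'
    rcases hb with hb | rfl <;> rcases hb' with hb' | rfl
    · exact hP.block_inj b hb b' hb' hbb
    · have := hP.block b hb; simp only [pairPos] at hbb; omega
    · have := hP.block b' hb'; simp only [pairPos] at hbb; omega
    · rfl
  level f hf x h1 h2 h3 := by
    have h4 : f a = f (a + S.size + 2) := hf (pairPos a S) (by simp)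
    by_cases h5 : x ≤ a
    · rw [← h4]
      exact hP.level f (fun b hb => hf b (by simp [hb])) x h1 h5 (by rw [h3, hB.2.2.1])
    · by_cases h6 : x ≤ a + S.size + 1
      · have := hB.coeff_inside hn (by omega) h6
        rw [h3, hB.2.2.1] at this; omega
      · rw [show x = a + S.size + 2 by omega]

end pair

/-- The constraints of type `C_1` with a block between the vertices `a` and `d`. -/
theorem C1_iff (hP : IsPrefix h r₁ P prev a) {d : ℕ} {p : (ℕ × ℕ) × (ℕ × ℕ)} :
    p ∈ C1 r₁ prev (a, d) ↔ p.2 = (a, d) ∧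
      ((r₁ + 1 < a ∧ p.1 = (r₁, r₁ + 1)) ∨ ∃ b ∈ prev, p.1 ∈ b.pieces ∧ p.1.2 < a) := by
  have hle := hP.le
  simp only [C1, Set.mem_ofPred_eq, hP.last]
  refine and_congr_right fun _ => ⟨?_, ?_⟩
  · rintro ⟨h1 | ⟨b, hb, hp⟩, h2⟩
    · refine Or.inl ⟨?_, h1⟩
      by_contra h3
      exact h2 (by rw [h1]; congr 1; omega)
    · refine Or.inr ⟨b, hb, hp, ?_⟩
      have h3 := hP.piece b hb _ hp
      rcases Nat.lt_or_ge p.1.2 a with h4 | h4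
      · exact h4
      -- A piece that ends at `a` equals the last piece by `piece_inj`, and that one is excluded.
      · obtain ⟨b', hb', hp'⟩ := hP.last_piece (by omega)
        exact absurd (hP.piece_inj b hb _ hp b' hb' _ hp' (by simp only [pt]; omega)) h2
  · rintro (⟨h1, h2⟩ | ⟨b, hb, hp, h2⟩)
    · refine ⟨Or.inl h2, ?_⟩
      rw [h2]; simp only [pt, ne_eq, Prod.mk.injEq]; omega
    · refine ⟨Or.inr ⟨b, hb, hp⟩, fun h3 => ?_⟩
      rw [h3] at h2; simp only [pt] at h2; omega

end IsPrefix

/-! ### The constraints and the basis variables determine all planar variables -/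

/-- The Mandelstam variable in terms of the planar variables `G`. -/
def mandel (G : ℕ → ℕ → ℂ) (p : (ℕ × ℕ) × (ℕ × ℕ)) : ℂ :=
  G p.1.1 p.1.2 + G p.2.1 p.2.2 +
    (G p.1.1 p.2.2 + G p.1.2 p.2.1 - G p.1.1 p.2.1 - G p.1.2 p.2.2)

/-- The preferred basis, with the vertex `1` written as `n + 1`: the part from the blocks that start
at the vertex `a`, at a level with first vertex `b₁`. -/
def basisPairs (b₁ a : ℕ) : Blocks → Set (ℕ × ℕ)
  | .nil => ∅
  | .adj B => {(a, a + 1), (b₁, a + 1)} ∪ basisPairs b₁ (a + 1) B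
  | .pair _ S B => {(a, a + S.size + 2), (b₁, a + S.size + 2), (a, a + S.size + 1)} ∪
      basisPairs (a + 1) (a + 1) S ∪ basisPairs b₁ (a + S.size + 2) B

/-- All allowed variables between the vertices `r₁ + 1` and `a` vanish. -/
def Vanishes (h : ℕ → Flavor) (G : ℕ → ℕ → ℂ) (r₁ a : ℕ) : Prop :=
  ∀ x y, r₁ + 1 ≤ x → x < y → y ≤ a → AllowedFlavor (h y - h x) → G x y = 0

/-- The variables that connect `r₁` to the vertices between the blocks are all equal. -/
def Levelled (h : ℕ → Flavor) (G : ℕ → ℕ → ℂ) (r₁ a : ℕ) : Prop :=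
  ∀ y, r₁ + 1 < y → y ≤ a → h y = h (r₁ + 1) → G r₁ y = G r₁ a

section vanish

variable {h : ℕ → Flavor} {G : ℕ → ℕ → ℂ} {r₁ a : ℕ} {P : List ℕ} {prev : List BlockPos}

/-- As `G a d = 0`, the constraint with a piece `p` says that `x ↦ G x d - G x a` takes equal values
at the two ends of `p`. At `r₁ + 1` this function vanishes by `hfan` and `hV`, and the pieces
transport the zero to every `x` near the level. The constraint with the particle `r₁` yields only
that `G r₁` has the same value at `a` and `d`. -/
theorem IsPrefix.chain_step (hP : IsPrefix h r₁ P prev a) (hedge : ∀ x, G x (x + 1) = 0)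
    (hV : Vanishes h G r₁ a) {d : ℕ} (had : G a d = 0) (hfan : G (r₁ + 1) d = 0)
    (hC : ∀ p ∈ C1 r₁ prev (a, d), mandel G p = 0) :
    (∀ x, r₁ + 1 ≤ x → x < a → Near (h a) (h x) → G x d = 0) ∧
      (r₁ + 1 < a → G r₁ d = G r₁ a) := by
  have hb₁ : r₁ + 1 < a → G (r₁ + 1) d - G (r₁ + 1) a = 0 := fun hlt => by
    rw [hfan, hV _ _ le_rfl hlt le_rfl (Or.inl (by rw [hP.height_eq, sub_self])), sub_zero]
  constructor
  · intro x h1 h2 h3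
    have h4 := hP.conn (fun x => G x d - G x a) ?_ x h1 h2 h3
    · simp only [hb₁ (by omega)] at h4
      rw [hV x a h1 h2 le_rfl h3.allowedFlavor, sub_zero] at h4
      exact h4
    · intro b hb p hp hpe
      have h5 := hP.piece b hb p hp
      have h6 : p.2 < a := by
        rcases Nat.lt_or_ge p.2 a with h | h
        · exact h
        · obtain ⟨b', hb', hp'⟩ := hP.last_piece (by omega)
          exact absurd (hP.piece_inj b hb _ hp b' hb' _ hp' (by simp only [pt]; omega)) hpe
      have h7 := hC (p, (a, d)) (hP.C1_iff.2 ⟨rfl, Or.inr ⟨b, hb, hp, h6⟩⟩)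
      have h8 : G p.1 p.2 = 0 := by
        rcases h5.2.2.2.2.2 with h | h
        · rw [h]; exact hedge _
        · exact hV _ _ h5.1 h5.2.1 h5.2.2.1 (Or.inl (by rw [h, sub_self]))
      simp only [mandel, h8, had] at h7
      linear_combination h7
  · intro hlt
    have h7 := hC ((r₁, r₁ + 1), (a, d)) (hP.C1_iff.2 ⟨rfl, Or.inl ⟨hlt, rfl⟩⟩)
    simp only [mandel, hedge, had] at h7
    linear_combination h7 + hb₁ hlt

/-- Every flavour line around `a` is also around `x`, so `h x - h a` has non-negative coefficients,
which leaves `0` or one `fl r`. -/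
theorem near_of_allowedFlavor (hP : IsPrefix h r₁ P prev a) {x : ℕ} (h1 : r₁ + 1 ≤ x)
    (h2 : x ≤ a) (h3 : AllowedFlavor (h a - h x)) : Near (h a) (h x) := by
  rw [← neg_sub, allowedFlavor_neg] at h3
  have hpos : ∀ s, 0 ≤ (h x - h a) s := fun s => by
    rw [Finsupp.sub_apply]
    rcases hP.coeff x h1 h2 s with h | h <;> omega
  rcases h3.eq_zero_or_fl hpos with h | ⟨r, h⟩
  · exact Or.inl (sub_eq_zero.1 h)
  · exact Or.inr ⟨r, by rw [← h]; abel⟩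

/-- The line of `r` encloses `y` but not `x`, so the charge is exactly `fl r`. Additional lines
around `x` have flavours in `P` and those around `y` have flavours of `S`; these are disjoint, so
they cannot compensate each other. -/
theorem heights_of_allowedFlavor (hP : IsPrefix h r₁ P prev a) {r : ℕ} {S B : Blocks}
    (hB : Fits h a (.pair r S B)) (hn : (P ++ (Blocks.pair r S B).flavors).Nodup)
    {x y : ℕ} (h1 : r₁ + 1 ≤ x) (h2 : x ≤ a) (h3 : a < y) (h4 : y ≤ a + S.size + 1)
    (h5 : AllowedFlavor (h y - h x)) : h x = h a ∧ h y = h (a + 1) := by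
  rw [List.nodup_append] at hn
  have hr : ∀ s ∈ P, s ≠ r ∧ s ∉ S.flavors := by
    intro s hs
    have := hn.2.2 s hs
    simp only [Blocks.flavors, List.mem_cons, List.mem_append] at this
    exact ⟨fun h => this r (Or.inl rfl) h, fun h => this s (Or.inr (Or.inl h)) rfl⟩
  have hnS := hn.2.1
  rw [Blocks.flavors, List.nodup_cons, List.nodup_append] at hnS
  have hxr : h x r = h a r := by
    rcases hP.coeff x h1 h2 r with h | h
    · exact h
    · exact absurd rfl (hr r h.2).1
  have hd : h y - h x = fl r :=
    h5.eq_fl (by rw [Finsupp.sub_apply, hB.coeff_inside hn.2.1 h3 h4, hxr]; ring)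
  have hx : h x = h a := by
    ext s
    by_cases hs : s = r
    · rw [hs, hxr]
    · have e1 := DFunLike.congr_fun hd s
      rw [Finsupp.sub_apply, fl_apply, if_neg (Ne.symm hs)] at e1
      have e2 := hB.2.1.coeff hnS.2.1 y (by omega) (by omega) s
      rw [hB.1, Finsupp.add_apply, fl_apply, if_neg (Ne.symm hs), add_zero] at e2
      rcases hP.coeff x h1 h2 s with h | h
      · exact h
      · have := (hr s h.2).2
        rcases e2 with e2 | e2
        · omega
        · exact absurd e2.2 this
  refine ⟨hx, ?_⟩
  rw [hB.1, ← hx, ← hd]; abel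

/-- The constraints determine the planar variables (homogeneous version). -/
theorem vanishes_of_constraints (hedge : ∀ x, G x (x + 1) = 0) (B : Blocks) :
    ∀ {r₁ a : ℕ} {P : List ℕ} {prev : List BlockPos}, IsPrefix h r₁ P prev a → Fits h a B →
      (P ++ B.flavors).Nodup → (∀ q ∈ basisPairs (r₁ + 1) a B, G q.1 q.2 = 0) →
      (∀ p ∈ constraintsFrom r₁ prev a B, mandel G p = 0) →
      Vanishes h G r₁ a → Levelled h G r₁ a →
      Vanishes h G r₁ (a + B.size) ∧ Levelled h G r₁ (a + B.size) := by
  induction B with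
  | nil => intro r₁ a P prev _ _ _ _ _ hV hL; exact ⟨hV, hL⟩
  | adj B ih =>
    intro r₁ a P prev hP hB hn hY hC hV hL
    rw [Blocks.size, ← add_assoc]
    have hle := hP.le
    have step := hP.chain_step hedge hV (hedge a) (hY (r₁ + 1, a + 1) (by simp [basisPairs]))
      (fun p hp => hC p (Or.inl hp))
    refine ih (hP.snoc_adj hB.1) hB.2 hn (fun q hq => hY q (Or.inr hq))
      (fun p hp => hC p (Or.inr hp)) ?_ ?_
    · intro x y h1 h2 h3 h4
      rcases Nat.eq_or_lt_of_le h3 with rfl | h3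
      · rcases Nat.eq_or_lt_of_le (Nat.le_of_lt_succ h2) with rfl | h2
        · exact hedge x
        · exact step.1 x h1 h2 (near_of_allowedFlavor hP h1 h2.le (by rwa [← hB.1]))
      · exact hV x y h1 h2 (by omega) h4
    · intro y h1 h2 h3
      rcases Nat.eq_or_lt_of_le h2 with rfl | h2
      · rfl
      · rw [hL y h1 (by omega) h3, step.2 (by omega)]
  | pair r S B ihS ihB =>
    intro r₁ a P prev hP hB hn hY hC hV hL
    rw [Blocks.size, show a + (S.size + 2 + B.size) = a + S.size + 2 + B.size by ring]
    have hle := hP.le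
    have hnB := (List.nodup_append.1 hn).2.1
    have hnS := hnB
    rw [Blocks.flavors, List.nodup_cons, List.nodup_append] at hnS
    have hC1 : ∀ p ∈ C1 r₁ prev (a, a + S.size + 2), mandel G p = 0 := fun p hp =>
      hC p (Or.inl (Or.inl (Or.inl (Or.inl hp))))
    have hC2 : ∀ p ∈ C2 prev (pairPos a S), mandel G p = 0 := fun p hp =>
      hC p (Or.inl (Or.inl (Or.inl (Or.inr hp))))
    have hC3 : ∀ p ∈ C3 prev (pairPos a S), mandel G p = 0 := fun p hp =>
      hC p (Or.inl (Or.inl (Or.inr hp)))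
    have had : G a (a + S.size + 2) = 0 :=
      hY (a, a + S.size + 2) (Or.inl (Or.inl (by simp)))
    have har : G a (a + S.size + 1) = 0 :=
      hY (a, a + S.size + 1) (Or.inl (Or.inl (by simp)))
    have hfan : G (r₁ + 1) (a + S.size + 2) = 0 :=
      hY (r₁ + 1, a + S.size + 2) (Or.inl (Or.inl (by simp)))
    have hrd : G (a + S.size + 1) (a + S.size + 2) = 0 := hedge _
    have hrh : h (a + S.size + 1) = h (a + 1) := by
      rw [← hB.2.1.height_end]; congr 1; omega
    -- The sub-blocks form a level of their own, with the left particle `a` in the role of `r₁` and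
    -- no earlier blocks.
    obtain ⟨hVS, hLS⟩ := ihS (IsPrefix.nil h a) hB.2.1 hnS.2.1
      (fun q hq => hY q (Or.inl (Or.inr hq))) (fun p hp => hC p (Or.inl (Or.inr hp)))
      (fun x y h1 h2 h3 _ => by omega) (fun y h1 h2 _ => by omega)
    rw [show a + 1 + S.size = a + S.size + 1 by ring] at hVS hLS
    have step := hP.chain_step hedge hV had hfan hC1
    -- By `Levelled` these variables equal the basis variable `X_{l,r}` of the block.
    have hin : ∀ y, a < y → y ≤ a + S.size + 1 → h y = h (a + 1) → G a y = 0 := by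
      intro y h1 h2 h3
      rcases Nat.eq_or_lt_of_le h1 with rfl | h1
      · exact hedge a
      · rw [hLS y h1 h2 h3, har]
    have hlevel_d : ∀ x, r₁ + 1 ≤ x → x ≤ a → h x = h a → G x (a + S.size + 2) = 0 := by
      intro x h1 h2 h3
      rcases Nat.eq_or_lt_of_le h2 with rfl | h2
      · exact had
      · exact step.1 x h1 h2 (Or.inl h3)
    have hblock : ∀ b ∈ prev, G b.l (b.r + 1) = 0 := by
      intro b hb
      have := hP.block b hb
      exact hV _ _ this.1 this.2.1 this.2.2.1 (Or.inl (by rw [this.2.2.2.1, this.2.2.2.2, sub_self]))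
    -- By `C2`, the difference of `G x` at the two ends of the right particle is the same at both
    -- ends `x` of each earlier block, and it vanishes at `x = a`.
    have hleft_r : ∀ x, r₁ + 1 ≤ x → x ≤ a → h x = h a → G x (a + S.size + 1) = 0 := by
      intro x h1 h2 h3
      have h4 := hP.level (fun x => G x (a + S.size + 1) - G x (a + S.size + 2)) ?_ x h1 h2 h3
      · simp only [had, har, hlevel_d x h1 h2 h3] at h4
        linear_combination h4
      · intro b hb
        have h5 := hC2 (b.all, (a + S.size + 1, a + S.size + 2)) ⟨⟨b, hb, rfl⟩, rfl⟩
        simp only [mandel, BlockPos.all, hblock b hb, hrd] at h5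
        linear_combination -h5
    -- By the constraints `s_{B_i,I}`, `G x I.2 - G x I.1` is the same at both ends of each earlier
    -- block, and it vanishes at `x = a`. Hence `G x` is constant along the sub-blocks, with the
    -- value `0` from `hleft_r`.
    have hleft : ∀ x, r₁ + 1 ≤ x → x ≤ a → h x = h a →
        ∀ y, a < y → y ≤ a + S.size + 1 → h y = h (a + 1) → G x y = 0 := by
      intro x h1 h2 h3
      have hconst : ∀ I ∈ S.intervals (a + 1), G x I.1 = G x I.2 := by
        intro I hI
        have hIb := Blocks.intervals_bounds I hI
        have hIh := hB.2.1.height_intervals I hI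
        have hI0 : G I.1 I.2 = 0 := hVS _ _ hIb.1 hIb.2.1 (by omega)
          (Or.inl (by rw [hIh.1, hIh.2, sub_self]))
        have h4 := hP.level (fun x => G x I.2 - G x I.1) ?_ x h1 h2 h3
        · simp only [hin I.1 (by omega) (by omega) hIh.1, hin I.2 (by omega) (by omega) hIh.2]
            at h4
          linear_combination -h4
        · intro b hb
          have h5 := hC3 (b.all, I) ⟨fun h0 => by simp only [pairPos] at h0; simp [h0] at hI,
            Or.inr (Or.inr ⟨b, hb, rfl, hI⟩)⟩
          simp only [mandel, BlockPos.all, hblock b hb, hI0] at h5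
          linear_combination h5
      have hall := hB.2.1.const_of_intervals (f := fun y => G x y) hnS.2.1 hconst
      intro y h4 h5 h6
      have e1 := hall y h4 (by omega) h6
      have e2 := hall (a + S.size + 1) (by omega) (by omega) hrh
      simp only [hleft_r x h1 h2 h3] at e1 e2
      rw [e1, ← e2]
    -- `s_{l,r}` gives the value at `a + 1`, and the `s_{I,r}` carry it along the sub-blocks. The
    -- last sub-block ends where the edge `hrd` begins, so no constraint is needed for it.
    have hright : ∀ w, a < w → w ≤ a + S.size + 1 → h w = h (a + 1) →
        G w (a + S.size + 2) = 0 := by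
      intro w h1 h2 h3
      rcases Nat.eq_or_lt_of_le h2 with rfl | h2
      · exact hrd
      · have hsub : S.intervals (a + 1) ≠ [] := fun h0 => by
          have := Blocks.size_of_intervals_eq_nil h0; omega
        have hr0 : ∀ w, a < w → w < a + S.size + 1 → h w = h (a + 1) →
            G w (a + S.size + 1) = 0 := fun w h1 h2 h3 =>
          hVS _ _ h1 h2 le_rfl (Or.inl (by rw [hrh, h3, sub_self]))
        have h4 := hC3 ((a, a + 1), (a + S.size + 1, a + S.size + 2)) ⟨hsub, Or.inl rfl⟩
        simp only [mandel, hedge, had, har, hr0 (a + 1) (by omega) (by omega) rfl] at h4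
        rw [hB.2.1.const_of_dropLast (f := fun y => G y (a + S.size + 2)) hnS.2.1 ?_ w h1
          (by omega) h3]
        · linear_combination -h4
        · intro I hI
          have hI' := List.mem_of_mem_dropLast hI
          have hIb := Blocks.intervals_bounds I hI'
          have hIl := Blocks.lt_of_mem_dropLast I hI
          have hIh := hB.2.1.height_intervals I hI'
          have hI0 : G I.1 I.2 = 0 := hVS _ _ hIb.1 hIb.2.1 (by omega)
            (Or.inl (by rw [hIh.1, hIh.2, sub_self]))
          have h5 := hC3 (I, (a + S.size + 1, a + S.size + 2))
            ⟨hsub, Or.inr (Or.inl ⟨hI, rfl⟩)⟩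
          simp only [mandel, hI0, hrd, hr0 I.1 (by omega) (by omega) hIh.1,
            hr0 I.2 (by omega) (by omega) hIh.2] at h5
          linear_combination h5
    refine ihB (hP.snoc_pair hB hnB) hB.2.2.2 ?_ (fun q hq => hY q (Or.inr hq))
      (fun p hp => hC p (Or.inr hp)) ?_ ?_
    · simpa [Blocks.flavors] using hn
    · intro x y h1 h2 h3 h4
      by_cases hya : y ≤ a
      · exact hV x y h1 h2 hya h4
      by_cases hyd : y = a + S.size + 2
      · subst hyd
        rw [hB.2.2.1] at h4
        rcases Nat.lt_trichotomy x a with hx | rfl | hx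
        · exact step.1 x h1 hx (near_of_allowedFlavor hP h1 hx.le h4)
        · exact had
        · rw [← neg_sub, allowedFlavor_neg] at h4
          exact hright x hx (by omega)
            (IsPrefix.near_inside hB hnB hx (by omega) h4)
      · by_cases hx : x ≤ a
        · have := heights_of_allowedFlavor hP hB hn h1 hx (by omega) (by omega : y ≤ _) h4
          exact hleft x h1 hx this.1 y (by omega) (by omega) this.2
        · exact hVS x y (by omega) h2 (by omega) h4
    · intro y h1 h2 h3
      by_cases hya : y ≤ a
      · rw [hL y h1 hya h3, step.2 (by omega)]
      · by_cases hyd : y = a + S.size + 2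
        · rw [hyd]
        · have := hB.coeff_inside hnB (by omega) (by omega : y ≤ a + S.size + 1)
          rw [h3, ← hP.height_eq] at this
          omega

end vanish

/-! ### There are not more constraints than variables outside the basis -/

/-- There is an injection from `A` to `Z`. -/
def Embeds (A : Set ((ℕ × ℕ) × (ℕ × ℕ))) (Z : Set (ℕ × ℕ)) : Prop :=
  ∃ φ : (ℕ × ℕ) × (ℕ × ℕ) → ℕ × ℕ, Set.InjOn φ A ∧ Set.MapsTo φ A Z

theorem Embeds.mono {A : Set ((ℕ × ℕ) × (ℕ × ℕ))} {Z Z' : Set (ℕ × ℕ)} (h : Embeds A Z)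
    (hZ : Z ⊆ Z') : Embeds A Z' := by
  obtain ⟨φ, h1, h2⟩ := h
  exact ⟨φ, h1, h2.mono_right hZ⟩

theorem Embeds.union {A A' : Set ((ℕ × ℕ) × (ℕ × ℕ))} {Z Z' : Set (ℕ × ℕ)} (h : Embeds A Z)
    (h' : Embeds A' Z') (hZ : ∀ q ∈ Z, q ∉ Z') : Embeds (A ∪ A') (Z ∪ Z') := by
  obtain ⟨φ, h1, h2⟩ := h
  obtain ⟨φ', h1', h2'⟩ := h'
  refine ⟨fun p => if p ∈ A then φ p else φ' p, ?_, ?_⟩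
  · intro p hp p' hp' heq
    simp only at heq
    by_cases hA : p ∈ A <;> by_cases hA' : p' ∈ A
    · rw [if_pos hA, if_pos hA'] at heq
      exact h1 hA hA' heq
    · rw [if_pos hA, if_neg hA'] at heq
      have := h2' (hp'.resolve_left hA')
      rw [← heq] at this
      exact absurd this (hZ _ (h2 hA))
    · rw [if_neg hA, if_pos hA'] at heq
      have := h2' (hp.resolve_left hA)
      rw [heq] at this
      exact absurd this (hZ _ (h2 hA'))
    · rw [if_neg hA, if_neg hA'] at heq
      exact h1' (hp.resolve_left hA) (hp'.resolve_left hA') heq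
  · intro p hp
    simp only
    split_ifs with hA
    · exact Or.inl (h2 hA)
    · exact Or.inr (h2' (hp.resolve_left hA))

theorem basisPairs_bounds {B : Blocks} : ∀ {b₁ a : ℕ}, b₁ ≤ a → ∀ q ∈ basisPairs b₁ a B,
    (q.1 = b₁ ∨ a ≤ q.1) ∧ q.1 < q.2 ∧ a < q.2 ∧ q.2 ≤ a + B.size := by
  induction B with
  | nil => intro b₁ a _ q hq; simp [basisPairs] at hq
  | adj B ih =>
    intro b₁ a hb q hq
    rw [Blocks.size]
    simp only [basisPairs, Set.mem_union, Set.mem_insert_iff, Set.mem_singleton_iff] at hq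
    rcases hq with (rfl | rfl) | hq
    · simp only; omega
    · exact ⟨Or.inl rfl, by simp only; omega, by simp only; omega, by simp only; omega⟩
    · have := ih (by omega) q hq; omega
  | pair r S B ihS ihB =>
    intro b₁ a hb q hq
    rw [Blocks.size]
    simp only [basisPairs, Set.mem_union, Set.mem_insert_iff, Set.mem_singleton_iff] at hq
    rcases hq with ((rfl | rfl | rfl) | hq) | hq
    · simp only; omega
    · exact ⟨Or.inl rfl, by simp only; omega, by simp only; omega, by simp only; omega⟩
    · simp only; omega
    · have := ihS le_rfl q hq; omega
    · have := ihB (by omega) q hq; omega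

theorem Fits.allowedFlavor_basisPairs {h : ℕ → Flavor} {B : Blocks} : ∀ {b₁ a : ℕ},
    Fits h a B → h b₁ = h a → ∀ q ∈ basisPairs b₁ a B, AllowedFlavor (h q.2 - h q.1) := by
  induction B with
  | nil => intro b₁ a _ _ q hq; simp [basisPairs] at hq
  | adj B ih =>
    intro b₁ a hB hb q hq
    simp only [basisPairs, Set.mem_union, Set.mem_insert_iff, Set.mem_singleton_iff] at hq
    rcases hq with (rfl | rfl) | hq
    · exact Or.inl (by simp only [hB.1, sub_self])
    · exact Or.inl (by simp only [hB.1, hb, sub_self])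
    · exact ih hB.2 (by rw [hb, hB.1]) q hq
  | pair r S B ihS ihB =>
    intro b₁ a hB hb q hq
    simp only [basisPairs, Set.mem_union, Set.mem_insert_iff, Set.mem_singleton_iff] at hq
    rcases hq with ((rfl | rfl | rfl) | hq) | hq
    · exact Or.inl (by simp only [hB.2.2.1, sub_self])
    · exact Or.inl (by simp only [hB.2.2.1, hb, sub_self])
    · refine Or.inr ⟨r, Or.inl ?_⟩
      have := hB.2.1.height_end
      rw [show a + 1 + S.size = a + S.size + 1 by ring, hB.1] at this
      simp only [this]; abel
    · exact ihS hB.2.1 rfl q hq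
    · exact ihB hB.2.2.2 (by rw [hb, hB.2.2.1]) q hq

/-- The variables outside the basis to which the constraints from the blocks at `a` are assigned. -/
def freePairs (h : ℕ → Flavor) (r₁ a : ℕ) (B : Blocks) : Set (ℕ × ℕ) :=
  {q | r₁ ≤ q.1 ∧ q.1 + 2 ≤ q.2 ∧ q.2 ≤ a + B.size ∧ (a < q.2 ∨ (q.1 = r₁ ∧ q.2 = a)) ∧
    (q.1 = r₁ → q.2 < a + B.size) ∧ AllowedFlavor (h q.2 - h q.1) ∧ q ∉ basisPairs (r₁ + 1) a B}

section embed

variable {h : ℕ → Flavor} {r₁ a : ℕ} {P : List ℕ} {prev : List BlockPos}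

/-- The constraint of a piece is sent to the variable from its right end to `d`. For `r₁` that would
be `(r₁ + 1, d)`, a basis variable, so `(r₁, a)` is taken instead. This lag by one block explains
the range of `q.2` for `q.1 = r₁` in `freePairs`. -/
theorem IsPrefix.embeds_C1 (hP : IsPrefix h r₁ P prev a) (d : ℕ) :
    Embeds (C1 r₁ prev (a, d)) {q | (q.2 = d ∧ r₁ + 1 < q.1 ∧ q.1 < a ∧ Near (h a) (h q.1)) ∨
      (q = (r₁, a) ∧ r₁ + 1 < a)} := by
  refine ⟨fun p => if p.1 = (r₁, r₁ + 1) then (r₁, a) else (p.1.2, d), ?_, ?_⟩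
  · intro p hp p' hp' heq
    rw [hP.C1_iff] at hp hp'
    refine Prod.ext ?_ (hp.1.trans hp'.1.symm)
    rcases hp.2 with ⟨-, h1⟩ | ⟨b, hb, h1, -⟩ <;> rcases hp'.2 with ⟨-, h1'⟩ | ⟨b', hb', h1', -⟩
    · rw [h1, h1']
    · have e := hP.piece b' hb' _ h1'
      simp only [h1, if_true] at heq
      rw [if_neg (fun h0 => by rw [h0] at e; simp only at e; omega), Prod.mk.injEq] at heq
      omega
    · have e := hP.piece b hb _ h1
      simp only [h1', if_true] at heq
      rw [if_neg (fun h0 => by rw [h0] at e; simp only at e; omega), Prod.mk.injEq] at heq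
      omega
    · have e := hP.piece b hb _ h1
      have e' := hP.piece b' hb' _ h1'
      simp only at heq
      rw [if_neg (fun h0 => by rw [h0] at e; simp only at e; omega),
        if_neg (fun h0 => by rw [h0] at e'; simp only at e'; omega), Prod.mk.injEq] at heq
      exact hP.piece_inj b hb _ h1 b' hb' _ h1' heq.1
  · intro p hp
    rw [hP.C1_iff] at hp
    rcases hp.2 with ⟨h0, h1⟩ | ⟨b, hb, h1, h2⟩
    · simp only [h1, if_true]
      exact Or.inr ⟨rfl, h0⟩
    · have e := hP.piece b hb _ h1
      simp only
      rw [if_neg (fun h0 => by rw [h0] at e; simp only at e; omega)]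
      exact Or.inl ⟨rfl, by simp only; omega, h2, e.2.2.2.2.1⟩

/-- Left ends are used because the right end of the last earlier block is `a`, and `X_{l,r}` of the
current block is a basis variable. -/
theorem IsPrefix.embeds_C2 (hP : IsPrefix h r₁ P prev a) (S : Blocks) :
    Embeds (C2 prev (pairPos a S))
      {q | q.2 = a + S.size + 1 ∧ r₁ + 1 ≤ q.1 ∧ q.1 < a ∧ h q.1 = h a} := by
  refine ⟨fun p => (p.1.1, p.2.1), ?_, ?_⟩
  · rintro p ⟨⟨b, hb, h1⟩, h2⟩ p' ⟨⟨b', hb', h1'⟩, h2'⟩ heq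
    refine Prod.ext ?_ (h2.trans h2'.symm)
    simp only [h1, h1', BlockPos.all, Prod.mk.injEq] at heq ⊢
    exact ⟨heq.1, by rw [hP.block_inj b hb b' hb' heq.1]⟩
  · rintro p ⟨⟨b, hb, h1⟩, h2⟩
    have := hP.block b hb
    simp only [Set.mem_ofPred_eq, h1, h2, BlockPos.all, pt, pairPos, true_and]
    exact ⟨this.1, by omega, this.2.2.2.1⟩

/-- `s_{l,r}` and `s_{I,r}` go to the right end of the first interval paired with the end of the
block, and `s_{B_i,I}` goes to the pair of left ends. -/
theorem IsPrefix.embeds_C3 (hP : IsPrefix h r₁ P prev a) {r : ℕ} {S B : Blocks}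
    (hB : Fits h a (.pair r S B)) :
    Embeds (C3 prev (pairPos a S))
      {q | (q.2 = a + S.size + 2 ∧ a < q.1 ∧ q.1 < a + S.size + 1 ∧ h q.1 = h (a + 1)) ∨
        (r₁ + 1 ≤ q.1 ∧ q.1 < a ∧ h q.1 = h a ∧ a < q.2 ∧ q.2 < a + S.size + 1 ∧
          h q.2 = h (a + 1))} := by
  have key : ∀ p ∈ C3 prev (pairPos a S), (p.2 = (a + S.size + 1, a + S.size + 2) ∧ a < p.1.2 ∧
      p.1.2 < a + S.size + 1 ∧ h p.1.2 = h (a + 1) ∧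
        (p.1 = (a, a + 1) ∨ p.1 ∈ S.intervals (a + 1))) ∨
      ((∃ b ∈ prev, p.1 = b.all) ∧ p.2 ∈ S.intervals (a + 1)) := by
    rintro p ⟨h0, h1 | ⟨h1, h2⟩ | ⟨b, hb, h1, h2⟩⟩
    · have : 0 < S.size := Blocks.size_pos fun hS => h0 (Blocks.intervals_eq_nil.2 hS)
      rw [h1]
      refine Or.inl ⟨rfl, ?_⟩
      simp only [pt, pairPos]
      exact ⟨by omega, by omega, trivial, Or.inl trivial⟩
    · have h3 := List.mem_of_mem_dropLast h1
      have h4 := Blocks.intervals_bounds _ h3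
      have h5 := Blocks.lt_of_mem_dropLast _ h1
      exact Or.inl ⟨h2, by omega, by omega, (hB.2.1.height_intervals _ h3).2, Or.inr h3⟩
    · exact Or.inr ⟨⟨b, hb, h1⟩, h2⟩
  refine ⟨fun p => if p.2 = (a + S.size + 1, a + S.size + 2) then (p.1.2, a + S.size + 2)
    else (p.1.1, p.2.1), ?_, ?_⟩
  · intro p hp p' hp' heq
    simp only at heq
    rcases key p hp with ⟨h1, h2, h3, h4, h5⟩ | ⟨⟨b, hb, h1⟩, h2⟩ <;>
      rcases key p' hp' with ⟨h1', h2', h3', h4', h5'⟩ | ⟨⟨b', hb', h1'⟩, h2'⟩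
    · rw [if_pos h1, if_pos h1', Prod.mk.injEq] at heq
      refine Prod.ext ?_ (h1.trans h1'.symm)
      rcases h5 with h5 | h5 <;> rcases h5' with h5' | h5'
      · rw [h5, h5']
      · have := Blocks.intervals_bounds _ h5'
        rw [h5] at heq; simp only at heq; omega
      · have := Blocks.intervals_bounds _ h5
        rw [h5'] at heq; simp only at heq; omega
      · exact Blocks.intervals_inj _ h5 _ h5' (Or.inr heq.1)
    · have e := Blocks.intervals_bounds _ h2'
      rw [if_pos h1, if_neg (fun h0 => by rw [h0] at e; simp only at e; omega),
        Prod.mk.injEq] at heq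
      omega
    · have e := Blocks.intervals_bounds _ h2
      rw [if_pos h1', if_neg (fun h0 => by rw [h0] at e; simp only at e; omega),
        Prod.mk.injEq] at heq
      omega
    · have e := Blocks.intervals_bounds _ h2
      have e' := Blocks.intervals_bounds _ h2'
      rw [if_neg (fun h0 => by rw [h0] at e; simp only at e; omega),
        if_neg (fun h0 => by rw [h0] at e'; simp only at e'; omega), Prod.mk.injEq] at heq
      refine Prod.ext ?_ (Blocks.intervals_inj _ h2 _ h2' (Or.inl heq.2))
      have hl := heq.1
      rw [h1, h1'] at hl ⊢
      exact Prod.ext hl (by simp only [BlockPos.all]; rw [hP.block_inj b hb b' hb' hl])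
  · intro p hp
    simp only
    rcases key p hp with ⟨h1, h2, h3, h4, -⟩ | ⟨⟨b, hb, h1⟩, h2⟩
    · rw [if_pos h1]
      exact Or.inl ⟨rfl, h2, h3, h4⟩
    · have e := Blocks.intervals_bounds _ h2
      have e' := hP.block b hb
      rw [if_neg (fun h0 => by rw [h0] at e; simp only at e; omega), h1]
      exact Or.inr ⟨e'.1, by simp only [BlockPos.all]; omega, e'.2.2.2.1, by simp only; omega,
        by simp only; omega, (hB.2.1.height_intervals _ h2).1⟩

/-- The families have disjoint targets, told apart by whether the ends lie before, inside, at the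
end of or beyond the current block. No target is a basis pair. -/
theorem embeds_constraints (B : Blocks) : ∀ {r₁ a : ℕ} {P : List ℕ} {prev : List BlockPos},
    IsPrefix h r₁ P prev a → Fits h a B → B.flavors.Nodup →
    AllowedFlavor (h (r₁ + 1) - h r₁) →
    Embeds (constraintsFrom r₁ prev a B) (freePairs h r₁ a B) := by
  induction B with
  | nil =>
    intro r₁ a P prev _ _ _ _
    exact ⟨fun p => p.1, fun p hp => by simp [constraintsFrom] at hp,
      fun p hp => by simp [constraintsFrom] at hp⟩
  | adj B ih =>
    intro r₁ a P prev hP hB hn hr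
    have hle := hP.le
    refine ((hP.embeds_C1 (a + 1)).union (ih (hP.snoc_adj hB.1) hB.2 hn hr) ?_).mono ?_
    · rintro ⟨x, y⟩ hq hq'
      simp only [freePairs, Set.mem_ofPred_eq, Prod.mk.injEq] at hq hq'
      omega
    · rintro ⟨x, y⟩ (hq | hq)
      · have hb : (x, y) ∉ basisPairs (r₁ + 1) a (.adj B) := by
          simp only [Set.mem_ofPred_eq, Prod.mk.injEq] at hq
          simp only [basisPairs, Set.mem_union, Set.mem_insert_iff, Set.mem_singleton_iff,
            Prod.mk.injEq, not_or]
          refine ⟨by omega, fun h0 => ?_⟩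
          have := basisPairs_bounds (by omega) _ h0
          simp only at this
          omega
        simp only [Set.mem_ofPred_eq, Prod.mk.injEq] at hq
        rw [freePairs, Blocks.size]
        refine ⟨by simp only; omega, by simp only; omega, by simp only; omega, by simp only; omega,
          by simp only; omega, ?_, hb⟩
        rcases hq with ⟨rfl, -, -, hq⟩ | ⟨⟨rfl, rfl⟩, -⟩
        · simp only [hB.1]; exact hq.allowedFlavor
        · simp only [hP.height_eq]; exact hr
      · have hb : (x, y) ∉ basisPairs (r₁ + 1) a (.adj B) := by
          simp only [freePairs, Set.mem_ofPred_eq] at hq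
          simp only [basisPairs, Set.mem_union, Set.mem_insert_iff, Set.mem_singleton_iff,
            Prod.mk.injEq, not_or]
          exact ⟨by omega, hq.2.2.2.2.2.2⟩
        simp only [freePairs, Set.mem_ofPred_eq, Blocks.size] at hq ⊢
        exact ⟨hq.1, hq.2.1, by omega, by omega, by omega, hq.2.2.2.2.2.1, hb⟩
  | pair r S B ihS ihB =>
    intro r₁ a P prev hP hB hn hr
    have hle := hP.le
    have hnS := hn
    rw [Blocks.flavors, List.nodup_cons, List.nodup_append] at hnS
    have hrS : AllowedFlavor (h (a + 1) - h a) := Or.inr ⟨r, Or.inl (by rw [hB.1]; abel)⟩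
    have hrh : h (a + S.size + 1) = h (a + 1) := by
      rw [← hB.2.1.height_end]; congr 1; omega
    refine (((((hP.embeds_C1 (a + S.size + 2)).union (hP.embeds_C2 S) ?_).union
      (hP.embeds_C3 hB) ?_).union (ihS (IsPrefix.nil h a) hB.2.1 hnS.2.1 hrS) ?_).union
      (ihB (hP.snoc_pair hB hn) hB.2.2.2 hnS.2.2.1 hr) ?_).mono ?_
    · rintro ⟨x, y⟩ hq hq'
      simp only [Set.mem_ofPred_eq, Prod.mk.injEq] at hq hq'
      omega
    · rintro ⟨x, y⟩ hq hq'
      simp only [Set.mem_union, Set.mem_ofPred_eq, Prod.mk.injEq] at hq hq'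
      omega
    · rintro ⟨x, y⟩ hq hq'
      simp only [Set.mem_union, freePairs, Set.mem_ofPred_eq, Prod.mk.injEq] at hq hq'
      omega
    · rintro ⟨x, y⟩ hq hq'
      simp only [Set.mem_union, freePairs, Set.mem_ofPred_eq, Prod.mk.injEq] at hq hq'
      omega
    · have hout : ∀ x y, ¬ ((x = a ∨ x = r₁ + 1) ∧ y = a + S.size + 2) →
          ¬ (x = a ∧ y = a + S.size + 1) → (x, y) ∉ basisPairs (a + 1) (a + 1) S →
          (x, y) ∉ basisPairs (r₁ + 1) (a + S.size + 2) B →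
          (x, y) ∉ basisPairs (r₁ + 1) a (.pair r S B) := by
        intro x y h1 h2 h3 h4
        simp only [basisPairs, Set.mem_union, Set.mem_insert_iff, Set.mem_singleton_iff,
          Prod.mk.injEq, not_or]
        exact ⟨⟨⟨by omega, by omega, by omega⟩, h3⟩, h4⟩
      have hS : ∀ x y, ¬ (a < x ∧ y < a + S.size + 2) →
          (x, y) ∉ basisPairs (a + 1) (a + 1) S := by
        intro x y h1 h2
        have := basisPairs_bounds le_rfl _ h2
        simp only at this
        omega
      have hBB : ∀ x y, ¬ (r₁ < x ∧ a + S.size + 2 < y) →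
          (x, y) ∉ basisPairs (r₁ + 1) (a + S.size + 2) B := by
        intro x y h1 h2
        have := basisPairs_bounds (by omega) _ h2
        simp only at this
        omega
      rintro ⟨x, y⟩ ((((hq | hq) | hq) | hq) | hq)
      · simp only [Set.mem_ofPred_eq, Prod.mk.injEq] at hq
        refine ⟨by simp only; omega, by simp only; omega, by simp only [Blocks.size]; omega,
          by simp only; omega, by simp only [Blocks.size]; omega, ?_,
          hout x y (by omega) (by omega) (hS x y (by omega)) (hBB x y (by omega))⟩
        rcases hq with ⟨rfl, -, -, hq⟩ | ⟨⟨rfl, rfl⟩, -⟩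
        · simp only [hB.2.2.1]; exact hq.allowedFlavor
        · simp only [hP.height_eq]; exact hr
      · simp only [Set.mem_ofPred_eq] at hq
        refine ⟨by simp only; omega, by simp only; omega, by simp only [Blocks.size]; omega,
          by simp only; omega, by simp only [Blocks.size]; omega, ?_,
          hout x y (by omega) (by omega) (hS x y (by omega)) (hBB x y (by omega))⟩
        simp only [hq.1, hrh, hq.2.2.2]; exact hrS
      · simp only [Set.mem_ofPred_eq] at hq
        refine ⟨by simp only; omega, by simp only; omega, by simp only [Blocks.size]; omega,
          by simp only; omega, by simp only [Blocks.size]; omega, ?_,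
          hout x y (by omega) (by omega) (hS x y (by omega)) (hBB x y (by omega))⟩
        rcases hq with hq | hq
        · simp only [hq.1, hq.2.2.2, hB.2.2.1]
          rw [← neg_sub, allowedFlavor_neg]; exact hrS
        · simp only [hq.2.2.1, hq.2.2.2.2.2]; exact hrS
      · simp only [freePairs, Set.mem_ofPred_eq] at hq
        exact ⟨by simp only; omega, by simp only; omega, by simp only [Blocks.size]; omega,
          by simp only; omega, by simp only [Blocks.size]; omega, hq.2.2.2.2.2.1,
          hout x y (by omega) (by omega) hq.2.2.2.2.2.2 (hBB x y (by omega))⟩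
      · simp only [freePairs, Set.mem_ofPred_eq] at hq
        exact ⟨by simp only; omega, by simp only; omega, by simp only [Blocks.size]; omega,
          by simp only; omega, by simp only [Blocks.size]; omega, hq.2.2.2.2.2.1,
          hout x y (by omega) (by omega) (hS x y (by omega)) hq.2.2.2.2.2.2⟩

end embed

/-! ### The preferred basis -/

theorem chord_comm (n a b : ℕ) : chord n a b = chord n b a := by
  simp only [chord, min_comm, max_comm]

theorem chord_self_notMem (n a : ℕ) : chord n a a ∉ diagonals n := by
  simp only [chord, mem_diagonals]; omega

theorem chord_succ_notMem (n a : ℕ) : chord n a (a + 1) ∉ diagonals n := by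
  simp only [chord, mem_diagonals]; split_ifs <;> omega

theorem chord_of_le {n a b : ℕ} (hab : a ≤ b) (hb : b ≤ n) : chord n a b = (a, b) := by
  simp only [chord]
  rw [if_neg (by omega), if_neg (by omega), min_eq_left hab, max_eq_right hab]

theorem chord_last {n a : ℕ} (h1 : 1 ≤ a) (h2 : a ≤ n) : chord n a (n + 1) = (1, a) := by
  simp only [chord, if_true]
  rw [if_neg (by omega), min_eq_right h1, max_eq_left h1]

theorem Blocks.intervals_start {B : Blocks} {a : ℕ} :
    ((B.intervals a).map Prod.fst).getD 0 (a + B.size) = a := by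
  cases B <;> simp [intervals, size, pt]

/-- Consecutive blocks abut, so each right end is the next left end; the default value supplies the
right end of the last block. -/
theorem Blocks.intervals_getElem {B : Blocks} : ∀ {a k : ℕ} (hk : k < (B.intervals a).length),
    (B.intervals a)[k] = (((B.intervals a).map Prod.fst).getD k (a + B.size),
      ((B.intervals a).map Prod.fst).getD (k + 1) (a + B.size)) := by
  induction B with
  | nil => intro a k hk; simp [intervals] at hk
  | adj B ih =>
    intro a k hk
    rw [size, ← add_assoc]
    cases k with
    | zero =>
      simp only [intervals, List.map_cons, List.getD_cons_zero, List.getD_cons_succ,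
        intervals_start]
      rfl
    | succ k =>
      simp only [intervals, List.map_cons, List.getD_cons_succ, List.getElem_cons_succ]
      exact ih _
  | pair r S B _ ih =>
    intro a k hk
    rw [size, show a + (S.size + 2 + B.size) = a + S.size + 2 + B.size by ring]
    cases k with
    | zero =>
      simp only [intervals, List.map_cons, List.getD_cons_zero, List.getD_cons_succ,
        intervals_start]
      rfl
    | succ k =>
      simp only [intervals, List.map_cons, List.getD_cons_succ, List.getElem_cons_succ]
      exact ih _

theorem Blocks.map_l_positions {B : Blocks} : ∀ {a : ℕ},
    (B.positions a).map BlockPos.l = (B.intervals a).map Prod.fst := by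
  induction B with
  | nil => intro a; rfl
  | adj B ih => intro a; simp [positions, intervals, pt, ih]
  | pair r S B _ ih => intro a; simp [positions, intervals, pairPos, ih]

/-- The chords of the outermost level of a preferred basis. -/
def IsLevelChord (n b₁ a : ℕ) (B : Blocks) (D : ℕ × ℕ) : Prop :=
  (∃ b ∈ B.positions a, D = chord n b.l b.r) ∨
    ∃ I ∈ B.intervals a, D = chord n I.1 I.2 ∨ D = chord n b₁ I.2

/-- `hl` identifies `l₁` with the vertex after the last block. The cyclic chain of left ends then
consists of the chords over single blocks and a closing chord, which is the last chord of the fan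
from `a`; the first chord of the fan is the one over the first block. -/
theorem mem_basisLevel {n l₁ r₁ a : ℕ} {B : Blocks} (hB : B ≠ .nil)
    (hl : ∀ x, chord n x l₁ = chord n x (a + B.size)) {D : ℕ × ℕ} :
    D ∈ basisLevel n l₁ r₁ (B.positions a) ↔ D = chord n l₁ r₁ ∨ IsLevelChord n a a B D := by
  simp only [basisLevel, Set.mem_ofPred_eq, Blocks.map_l_positions, List.length_cons]
  set L := B.intervals a with hL
  set m := L.map Prod.fst with hm
  have hlen : m.length = L.length := by rw [hm, List.length_map]
  have hpos : 0 < L.length := List.length_pos_iff.2 fun h => hB (Blocks.intervals_eq_nil.1 h)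
  -- `s k` is the left end of block `k`, and the default value makes `s L.length` the end of the
  -- sequence.
  set s : ℕ → ℕ := fun k => m.getD k (a + B.size) with hs
  have hs0 : s 0 = a := Blocks.intervals_start
  have hget : ∀ k, k < L.length → (l₁ :: m).getD (k + 1) 0 = s k := by
    intro k hk
    rw [List.getD_cons_succ, hs]
    simp only [List.getD_eq_getElem _ _ (hlen.symm ▸ hk)]
  have hlast : s L.length = a + B.size := by
    rw [hs]; simp only; rw [List.getD_eq_default _ _ hlen.le]
  have hmem : ∀ k, k < L.length → (s k, s (k + 1)) ∈ L := fun k hk => by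
    have := Blocks.intervals_getElem hk
    rw [hs]; simp only; rw [← this]; exact List.getElem_mem _
  have hmem' : ∀ I ∈ L, ∃ k, k < L.length ∧ I = (s k, s (k + 1)) := fun I hI => by
    obtain ⟨k, hk, rfl⟩ := List.getElem_of_mem hI
    exact ⟨k, hk, Blocks.intervals_getElem hk⟩
  have hone : (l₁ :: m).getD 1 0 = a := by rw [hget 0 hpos, hs0]
  rw [hlen, hone]
  constructor
  · rintro (⟨i, hi, rfl⟩ | rfl | ⟨b, hb, rfl⟩ | ⟨i, hi, h3, rfl⟩)
    · refine Or.inr (Or.inr ?_)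
      cases i with
      | zero =>
        rw [Nat.zero_add, Nat.mod_eq_of_lt (by omega), hone, List.getD_cons_zero]
        refine ⟨_, hmem (L.length - 1) (by omega), Or.inr ?_⟩
        simp only [Nat.sub_add_cancel hpos, hlast]
        rw [chord_comm, hl]
      | succ k =>
        rw [hget k (by omega)]
        refine ⟨_, hmem k (by omega), Or.inl ?_⟩
        by_cases hk : k + 1 < L.length
        · rw [Nat.mod_eq_of_lt (by omega), hget (k + 1) hk]
        · have he : k + 1 = L.length := by omega
          rw [he, Nat.mod_self, List.getD_cons_zero, hl]
          simp only [hlast]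
    · exact Or.inl rfl
    · exact Or.inr (Or.inl ⟨b, hb, rfl⟩)
    · obtain ⟨k, rfl⟩ : ∃ k, i = k + 1 + 1 := ⟨i - 2, by omega⟩
      rw [hget (k + 1) (by omega)]
      exact Or.inr (Or.inr ⟨_, hmem k (by omega), Or.inr rfl⟩)
  · rintro (rfl | ⟨b, hb, rfl⟩ | ⟨I, hI, hD⟩)
    · exact Or.inr (Or.inl rfl)
    · exact Or.inr (Or.inr (Or.inl ⟨b, hb, rfl⟩))
    · obtain ⟨k, hk, rfl⟩ := hmem' I hI
      have hcons : ∃ i, i < L.length + 1 ∧ chord n (s k) (s (k + 1)) =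
          chord n ((l₁ :: m).getD i 0) ((l₁ :: m).getD ((i + 1) % (L.length + 1)) 0) := by
        refine ⟨k + 1, by omega, ?_⟩
        rw [hget k hk]
        by_cases hk' : k + 1 < L.length
        · rw [Nat.mod_eq_of_lt (by omega), hget (k + 1) hk']
        · have he : k + 1 = L.length := by omega
          rw [he, hlast, Nat.mod_self, List.getD_cons_zero, hl]
      rcases hD with rfl | rfl
      · exact Or.inl hcons
      · simp only
        by_cases hk' : k + 1 < L.length
        · by_cases hk0 : k = 0
          · subst hk0
            rw [hs0] at hcons
            exact Or.inl hcons
          · exact Or.inr (Or.inr (Or.inr ⟨k + 1 + 1, by omega, by omega, by rw [hget _ hk']⟩))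
        · have he : k + 1 = L.length := by omega
          refine Or.inl ⟨0, by omega, ?_⟩
          rw [Nat.zero_add, Nat.mod_eq_of_lt (by omega), hone, List.getD_cons_zero, he, hlast,
            chord_comm n l₁, hl]

theorem IsLevelChord.exists_basisPairs {n b₁ : ℕ} {D : ℕ × ℕ} (hD : D ∈ diagonals n)
    {B : Blocks} : ∀ {a : ℕ}, IsLevelChord n b₁ a B D →
    ∃ q ∈ basisPairs b₁ a B, D = chord n q.1 q.2 := by
  induction B with
  | nil => rintro a (⟨b, hb, -⟩ | ⟨b, hb, -⟩) <;> simp [Blocks.positions, Blocks.intervals] at hb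
  | adj B ih =>
    rintro a (⟨b, hb, rfl⟩ | ⟨I, hI, hDI⟩)
    · simp only [Blocks.positions, List.mem_cons] at hb
      rcases hb with rfl | hb
      · exact absurd hD (chord_self_notMem _ _)
      · obtain ⟨q, hq, h⟩ := ih (Or.inl ⟨b, hb, rfl⟩)
        exact ⟨q, Or.inr hq, h⟩
    · simp only [Blocks.intervals, List.mem_cons] at hI
      rcases hI with rfl | hI
      · rcases hDI with h | h
        · exact ⟨(a, a + 1), Or.inl (by simp), h⟩
        · exact ⟨(b₁, a + 1), Or.inl (by simp), h⟩
      · obtain ⟨q, hq, h⟩ := ih (Or.inr ⟨I, hI, hDI⟩)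
        exact ⟨q, Or.inr hq, h⟩
  | pair r S B _ ih =>
    rintro a (⟨b, hb, rfl⟩ | ⟨I, hI, hDI⟩)
    · simp only [Blocks.positions, List.mem_cons] at hb
      rcases hb with rfl | hb
      · exact ⟨(a, a + S.size + 1), Or.inl (Or.inl (by simp)), rfl⟩
      · obtain ⟨q, hq, h⟩ := ih (Or.inl ⟨b, hb, rfl⟩)
        exact ⟨q, Or.inr hq, h⟩
    · simp only [Blocks.intervals, List.mem_cons] at hI
      rcases hI with rfl | hI
      · rcases hDI with h | h
        · exact ⟨(a, a + S.size + 2), Or.inl (Or.inl (by simp)), h⟩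
        · exact ⟨(b₁, a + S.size + 2), Or.inl (Or.inl (by simp)), h⟩
      · obtain ⟨q, hq, h⟩ := ih (Or.inr ⟨I, hI, hDI⟩)
        exact ⟨q, Or.inr hq, h⟩

theorem chord_end_comm (n a : ℕ) (S : Blocks) (x : ℕ) :
    chord n x (a + S.size + 1) = chord n x (a + 1 + S.size) := by
  rw [show a + S.size + 1 = a + 1 + S.size by ring]

theorem exists_basisPairs_of_basisSub {n : ℕ} {D : ℕ × ℕ} (hD : D ∈ diagonals n) {B : Blocks} :
    ∀ {b₁ a : ℕ}, D ∈ basisSub n a B → ∃ q ∈ basisPairs b₁ a B, D = chord n q.1 q.2 := by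
  induction B with
  | nil => intro b₁ a h; exact absurd h (Set.notMem_empty _)
  | adj B ih =>
    intro b₁ a h
    obtain ⟨q, hq, h⟩ := ih (b₁ := b₁) h
    exact ⟨q, Or.inr hq, h⟩
  | pair r S B ihS ihB =>
    rintro b₁ a ((⟨hS, h⟩ | h) | h)
    · rw [mem_basisLevel hS (chord_end_comm n a S)] at h
      rcases h with h | h
      · exact ⟨(a, a + S.size + 1), Or.inl (Or.inl (by simp)), by rw [h, chord_comm]⟩
      · obtain ⟨q, hq, h⟩ := h.exists_basisPairs hD
        exact ⟨q, Or.inl (Or.inr hq), h⟩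
    · obtain ⟨q, hq, h⟩ := ihS (b₁ := a + 1) h
      exact ⟨q, Or.inl (Or.inr hq), h⟩
    · obtain ⟨q, hq, h⟩ := ihB (b₁ := b₁) h
      exact ⟨q, Or.inr hq, h⟩

theorem level_or_sub_of_basisPairs {n : ℕ} {B : Blocks} : ∀ {b₁ a : ℕ}, ∀ q ∈ basisPairs b₁ a B,
    IsLevelChord n b₁ a B (chord n q.1 q.2) ∨ chord n q.1 q.2 ∈ basisSub n a B := by
  induction B with
  | nil => intro b₁ a q hq; exact absurd hq (Set.notMem_empty _)
  | adj B ih =>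
    intro b₁ a q hq
    simp only [basisPairs, Set.mem_union, Set.mem_insert_iff, Set.mem_singleton_iff] at hq
    rcases hq with (rfl | rfl) | hq
    · exact Or.inl (Or.inr ⟨(a, a + 1), by simp [Blocks.intervals, pt], Or.inl rfl⟩)
    · exact Or.inl (Or.inr ⟨(a, a + 1), by simp [Blocks.intervals, pt], Or.inr rfl⟩)
    · rcases ih q hq with (⟨b, hb, h⟩ | ⟨I, hI, h⟩) | h
      · exact Or.inl (Or.inl ⟨b, List.mem_cons_of_mem _ hb, h⟩)
      · exact Or.inl (Or.inr ⟨I, List.mem_cons_of_mem _ hI, h⟩)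
      · exact Or.inr h
  | pair r S B ihS ihB =>
    intro b₁ a q hq
    simp only [basisPairs, Set.mem_union, Set.mem_insert_iff, Set.mem_singleton_iff] at hq
    rcases hq with ((rfl | rfl | rfl) | hq) | hq
    · exact Or.inl (Or.inr ⟨(a, a + S.size + 2), by simp [Blocks.intervals], Or.inl rfl⟩)
    · exact Or.inl (Or.inr ⟨(a, a + S.size + 2), by simp [Blocks.intervals], Or.inr rfl⟩)
    · exact Or.inl (Or.inl ⟨pairPos a S, by simp [Blocks.positions], rfl⟩)
    · have hS : S ≠ .nil := by rintro rfl; exact absurd hq (Set.notMem_empty _)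
      rcases ihS q hq with h | h
      · refine Or.inr (Or.inl (Or.inl ⟨hS, ?_⟩))
        rw [mem_basisLevel hS (chord_end_comm n a S)]
        exact Or.inr h
      · exact Or.inr (Or.inl (Or.inr h))
    · rcases ihB q hq with (⟨b, hb, h⟩ | ⟨I, hI, h⟩) | h
      · exact Or.inl (Or.inl ⟨b, List.mem_cons_of_mem _ hb, h⟩)
      · exact Or.inl (Or.inr ⟨I, List.mem_cons_of_mem _ hI, h⟩)
      · exact Or.inr (Or.inr h)

/-- Writing the vertex `1` as `n + 1 = 3 + B.size` turns the cyclic definition into the recursive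
set `basisPairs`, which the induction over the blocks can use. The chord `X_{1,2}` of the first pair
is an edge and drops out. -/
theorem mem_preferredBasis {B : Blocks} (hB : B ≠ .nil) {D : ℕ × ℕ} :
    D ∈ preferredBasis B ↔ D ∈ diagonals (B.size + 2) ∧
      ∃ q ∈ basisPairs 3 3 B, D = chord (B.size + 2) q.1 q.2 := by
  have hl : ∀ x, chord (B.size + 2) x 1 = chord (B.size + 2) x (3 + B.size) := by
    intro x
    simp only [chord]
    rw [if_neg (by omega : ¬ 1 = B.size + 2 + 1), if_pos (by omega : 3 + B.size = B.size + 2 + 1)]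
  simp only [preferredBasis, Set.mem_ofPred_eq, mem_basisLevel hB hl]
  refine and_congr_right fun hD => ⟨?_, ?_⟩
  · rintro ((h | h) | h)
    · exact absurd hD (h ▸ chord_succ_notMem _ _)
    · exact h.exists_basisPairs hD
    · exact exists_basisPairs_of_basisSub hD h
  · rintro ⟨q, hq, rfl⟩
    rcases level_or_sub_of_basisPairs q hq with h | h
    · exact Or.inl (Or.inr h)
    · exact Or.inr h

/-! ### Solving the constraints -/

/-- A square system: the row of a diagonal is the constraint assigned to it, or else its own
coordinate. `hU` makes the map injective, hence surjective in finite dimension, which gives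
existence for all constants. -/
theorem isPlanarBasis_of_embeds {α : List Flavor} {H : Set ((ℕ × ℕ) × (ℕ × ℕ))}
    {Y : Set (ℕ × ℕ)} (hY : ∀ D ∈ Y, D ∈ diagonals α.length ∧ Allowed α D)
    (hE : Embeds H {D | D ∈ diagonals α.length ∧ Allowed α D ∧ D ∉ Y})
    (hU : ∀ X : Kin, (∀ p ∈ H, mandelstam α.length X p = 0) →
      (∀ D ∈ diagonals α.length, ¬ Allowed α D → X D = 0) → (∀ D ∈ Y, X D = 0) →
      ∀ D ∈ diagonals α.length, X D = 0) : IsPlanarBasis α H Y := by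
  refine ⟨hY, fun c b y => ?_⟩
  obtain ⟨φ, hinj, hmaps⟩ := hE
  let ext : (diagonals α.length → ℂ) → Kin := fun v D => if h : D ∈ diagonals α.length then
    v ⟨D, h⟩ else 0
  have ext_apply : ∀ v, ∀ D (h : D ∈ diagonals α.length), ext v D = v ⟨D, h⟩ :=
    fun v D h => dif_pos h
  have ext_add : ∀ v w, ext (v + w) = ext v + ext w := fun v w => by
    funext D; simp only [ext, Pi.add_apply]; split_ifs <;> simp
  have ext_smul : ∀ (t : ℂ) v, ext (t • v) = t • ext v := fun t v => by
    funext D; simp only [ext, Pi.smul_apply]; split_ifs <;> simp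
  let M : (diagonals α.length → ℂ) →ₗ[ℂ] (diagonals α.length → ℂ) :=
    { toFun := fun v D => if h : ∃ p ∈ H, φ p = D.1 then mandelstam α.length (ext v) h.choose
        else v D
      map_add' := fun v w => by
        funext D
        simp only [Pi.add_apply, ext_add, mandelstam_add]
        split_ifs <;> rfl
      map_smul' := fun t v => by
        funext D
        simp only [Pi.smul_apply, ext_smul, mandelstam_smul, RingHom.id_apply, smul_eq_mul]
        split_ifs <;> rfl }
  have hM : ∀ v, ∀ p (hp : p ∈ H), M v ⟨φ p, (hmaps hp).1⟩ = mandelstam α.length (ext v) p := by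
    intro v p hp
    have hex : ∃ p' ∈ H, φ p' = φ p := ⟨p, hp, rfl⟩
    have : hex.choose = p := hinj hex.choose_spec.1 hp hex.choose_spec.2
    change (if h : _ then _ else _) = _
    rw [dif_pos hex, this]
  have hM' : ∀ v, ∀ D (hD : D ∈ diagonals α.length), (¬ Allowed α D ∨ D ∈ Y) →
      M v ⟨D, hD⟩ = v ⟨D, hD⟩ := by
    intro v D hD h
    change (if h : _ then _ else _) = _
    rw [dif_neg]
    rintro ⟨p, hp, hpD⟩
    have := hmaps hp
    simp only at hpD
    rw [hpD] at this
    rcases h with h | h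
    · exact h this.2.1
    · exact this.2.2 h
  have hMinj : Function.Injective M := by
    rw [← LinearMap.ker_eq_bot, LinearMap.ker_eq_bot']
    intro v hv
    have := hU (ext v) (fun p hp => by rw [← hM v p hp, hv]; rfl)
      (fun D hD hA => by rw [ext_apply v D hD, ← hM' v D hD (Or.inl hA), hv]; rfl)
      (fun D hD => by
        rw [ext_apply v D (hY D hD).1, ← hM' v D (hY D hD).1 (Or.inr hD), hv]; rfl)
    funext D
    rw [← ext_apply v D.1 D.2, this D.1 D.2]; rfl
  -- The right-hand side is `-c` on the assigned rows, `y` on the basis and `b` on all others.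
  obtain ⟨v, hv⟩ := LinearMap.injective_iff_surjective.1 hMinj fun D =>
    if h : ∃ p ∈ H, φ p = D.1 then -c h.choose else if D.1 ∈ Y then y D.1 else b D.1
  have hon : OnSubspace α H c b (ext v) := by
    refine ⟨fun p hp => ?_, fun D hD hA => ?_⟩
    · have hex : ∃ p' ∈ H, φ p' = φ p := ⟨p, hp, rfl⟩
      have : hex.choose = p := hinj hex.choose_spec.1 hp hex.choose_spec.2
      rw [← hM v p hp, hv]
      simp only
      rw [dif_pos hex, this, neg_neg]
    · rw [ext_apply v D hD, ← hM' v D hD (Or.inl hA), hv]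
      simp only
      rw [dif_neg, if_neg fun h => hA (hY D h).2]
      rintro ⟨p, hp, hpD⟩
      have := hmaps hp
      rw [hpD] at this
      exact hA this.2.1
  have hy : ∀ D ∈ Y, ext v D = y D := by
    intro D hD
    rw [ext_apply v D (hY D hD).1, ← hM' v D (hY D hD).1 (Or.inr hD), hv]
    simp only
    rw [dif_neg, if_pos hD]
    rintro ⟨p, hp, hpD⟩
    have := hmaps hp
    rw [hpD] at this
    exact this.2.2 hD
  refine ⟨ext v, hon, hy, fun X' hX' hy' D hD => ?_⟩
  have := hU (X' + (-1 : ℂ) • ext v) ?_ ?_ ?_ D hD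
  · simp only [Pi.add_apply, Pi.smul_apply, smul_eq_mul] at this
    linear_combination this
  · intro p hp
    rw [mandelstam_add, mandelstam_smul]
    linear_combination hon.1 p hp - hX'.1 p hp
  · intro D hD hA
    simp only [Pi.add_apply, Pi.smul_apply, smul_eq_mul, hX'.2 D hD hA, hon.2 D hD hA]
    ring
  · intro D hD
    simp only [Pi.add_apply, Pi.smul_apply, smul_eq_mul, hy' D hD, hy D hD]
    ring

/-! ### Heights of an ordering `[(1,2), B_2, …, B_m]` -/

section ordering

variable {r₁ : ℕ} {B : Blocks}

theorem length_ordering : (ordering r₁ B).length = B.size + 2 := by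
  rw [ordering, Blocks.length_word, Blocks.size, Blocks.size]; ring

theorem ordering_eq : ordering r₁ B = fl r₁ :: -fl r₁ :: B.word := rfl

theorem height_ordering_one : height (ordering r₁ B) 1 = 0 := rfl

theorem height_ordering_two : height (ordering r₁ B) 2 = fl r₁ := by
  simp [height, ordering_eq]

theorem height_ordering_three : height (ordering r₁ B) 3 = 0 := by
  simp [height, ordering_eq]

theorem fits_ordering : Fits (height (ordering r₁ B)) 3 B :=
  fits_height _ B [fl r₁, -fl r₁] [] 3 (by simp [ordering_eq]) rfl

theorem height_ordering_end : height (ordering r₁ B) (3 + B.size) = 0 := by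
  rw [fits_ordering.height_end, height_ordering_three]

theorem allowed_iff {α : List Flavor} {x y : ℕ} (hxy : x ≤ y) :
    Allowed α (x, y) ↔ AllowedFlavor (height α y - height α x) := by
  rw [← charge_eq_height α (D := (x, y)) hxy]; rfl

theorem chord_cases {n x y : ℕ} (hx : 1 ≤ x) (hxy : x < y) (hy : y ≤ n + 1) :
    (y ≤ n ∧ chord n x y = (x, y)) ∨ (y = n + 1 ∧ chord n x y = (1, x)) := by
  rcases Nat.lt_or_ge n y with h | h
  · obtain rfl : y = n + 1 := by omega
    exact Or.inr ⟨rfl, chord_last hx (by omega)⟩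
  · exact Or.inl ⟨h, chord_of_le hxy.le h⟩

/-- The total flavour vanishes, so the vertices `n + 1` and `1` have the same height, and reading
one as the other changes only the sign of the charge. -/
theorem allowed_chord_ordering {x y : ℕ} (hx : 1 ≤ x) (hxy : x < y) (hy : y ≤ B.size + 2 + 1) :
    Allowed (ordering r₁ B) (chord (B.size + 2) x y) ↔
      AllowedFlavor (height (ordering r₁ B) y - height (ordering r₁ B) x) := by
  rcases chord_cases hx hxy hy with ⟨-, h⟩ | ⟨rfl, h⟩
  · rw [h, allowed_iff hxy.le]
  · rw [h, allowed_iff hx, height_ordering_one, sub_zero,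
      show B.size + 2 + 1 = 3 + B.size by ring, height_ordering_end, zero_sub, allowedFlavor_neg]

theorem isPlanarBasis_preferredBasis (hB : B ≠ .nil) (hn : (r₁ :: B.flavors).Nodup) :
    IsPlanarBasis (ordering r₁ B) (constraints B) (preferredBasis B) := by
  have hn' := List.nodup_cons.1 hn
  refine isPlanarBasis_of_embeds ?_ ?_ ?_
  · intro D hD
    rw [mem_preferredBasis hB] at hD
    obtain ⟨hD, q, hq, rfl⟩ := hD
    have hb := basisPairs_bounds le_rfl q hq
    refine ⟨by rwa [length_ordering], ?_⟩
    rw [allowed_chord_ordering (by omega) hb.2.1 (by omega)]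
    exact fits_ordering.allowedFlavor_basisPairs rfl q hq
  · obtain ⟨φ, h1, h2⟩ := embeds_constraints (r₁ := 2) B (IsPrefix.nil _ 2)
      (fits_ordering (r₁ := r₁)) hn'.2 (Or.inr ⟨r₁, Or.inr (by
        rw [height_ordering_three, height_ordering_two, zero_sub])⟩)
    -- Passing to chords keeps `φ` injective: only the vertex `n + 1` is renamed, and its new name
    -- `1` is not a left end in `freePairs`, where `2 ≤ q.1`.
    refine ⟨fun p => chord (B.size + 2) (φ p).1 (φ p).2, ?_, ?_⟩
    · intro p hp p' hp' heq
      refine h1 hp hp' ?_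
      have e := h2 hp
      have e' := h2 hp'
      simp only at heq
      generalize φ p = q at heq e ⊢
      generalize φ p' = q' at heq e' ⊢
      obtain ⟨a1, a2, a3, -, a5, -⟩ := e
      obtain ⟨b1, b2, b3, -, b5, -⟩ := e'
      rcases chord_cases (by omega) (by omega : q.1 < q.2) (by omega : q.2 ≤ B.size + 2 + 1) with
          ⟨c1, c2⟩ | ⟨c1, c2⟩ <;>
        rcases chord_cases (by omega) (by omega : q'.1 < q'.2) (by omega : q'.2 ≤ B.size + 2 + 1)
          with ⟨d1, d2⟩ | ⟨d1, d2⟩ <;> rw [c2, d2, Prod.mk.injEq] at heq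
      · exact Prod.ext heq.1 heq.2
      · omega
      · omega
      · exact Prod.ext heq.2 (by omega)
    · intro p hp
      have e := h2 hp
      simp only
      generalize φ p = q at e ⊢
      obtain ⟨a1, a2, a3, -, a5, a6, a7⟩ := e
      refine ⟨?_, ?_, ?_⟩
      · rw [length_ordering]
        rcases chord_cases (by omega) (by omega : q.1 < q.2) (by omega : q.2 ≤ B.size + 2 + 1) with
          ⟨c1, c2⟩ | ⟨c1, c2⟩ <;> rw [c2, mem_diagonals] <;> simp only <;> omega
      · rwa [allowed_chord_ordering (by omega) (by omega) (by omega)]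
      · intro hmem
        obtain ⟨-, q', hq', heq⟩ := (mem_preferredBasis hB).1 hmem
        have hb := basisPairs_bounds le_rfl q' hq'
        have hqq : q = q' := by
          rcases chord_cases (by omega) (by omega : q.1 < q.2) (by omega : q.2 ≤ B.size + 2 + 1)
              with ⟨c1, c2⟩ | ⟨c1, c2⟩ <;>
            rcases chord_cases (by omega) hb.2.1 (by omega : q'.2 ≤ B.size + 2 + 1)
              with ⟨d1, d2⟩ | ⟨d1, d2⟩ <;> rw [c2, d2, Prod.mk.injEq] at heq
          · exact Prod.ext heq.1 heq.2
          · omega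
          · omega
          · exact Prod.ext heq.2 (by omega)
        exact a7 (hqq ▸ hq')
  · rw [length_ordering]
    intro X hH hforb hYz
    have hedge : ∀ x, planar (B.size + 2) X x (x + 1) = 0 := fun x =>
      if_neg (chord_succ_notMem _ _)
    obtain ⟨hV, hL⟩ := vanishes_of_constraints (G := planar (B.size + 2) X) hedge B
      (IsPrefix.nil (height (ordering r₁ B)) 2) fits_ordering hn'.2
      (fun q hq => by
        rw [planar]
        split_ifs with hD
        · exact hYz _ ((mem_preferredBasis hB).2 ⟨hD, q, hq, rfl⟩)
        · rfl)
      hH (fun x y h1 h2 h3 _ => by omega) (fun y h1 h2 _ => by omega)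
    intro D hD
    by_cases hA : Allowed (ordering r₁ B) D
    swap
    · exact hforb D hD hA
    have hD' := mem_diagonals.1 hD
    obtain ⟨x, y⟩ := D
    simp only at hD'
    have hA' := (allowed_iff (by omega)).1 hA
    rcases Nat.lt_or_ge 2 x with hx | hx
    · have := hV x y hx (by omega) (by omega) hA'
      rwa [planar, chord_of_le (by omega) (by omega), if_pos hD] at this
    · by_cases hx2 : x = 2
      -- The line of `(1, 2)` is crossed, so the charge is `-fl r₁` and the other end is at the
      -- outer level. There `Levelled` equates the variable with `X_{2,n+1}`, an edge.
      · subst hx2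
        rw [height_ordering_two] at hA'
        have hlev : height (ordering r₁ B) y = height (ordering r₁ B) 3 := by
          have hc := (fits_ordering (r₁ := r₁)).coeff hn'.2 y (by omega) (by omega) r₁
          have hyr : height (ordering r₁ B) y r₁ = 0 := by
            rw [height_ordering_three] at hc
            rcases hc with h | h
            · rw [h]; rfl
            · exact absurd h.2 hn'.1
          have := hA'.eq_neg_fl (r := r₁) (by
            rw [Finsupp.sub_apply, fl_apply, if_pos rfl, hyr, zero_sub])
          rw [height_ordering_three]
          rw [sub_eq_neg_self] at this
          exact this
        have h2 := hL y (by omega) (by omega) hlev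
        rw [planar, chord_of_le (by omega) (by omega), if_pos hD] at h2
        rw [h2, planar, if_neg]
        rw [show 3 + B.size = B.size + 2 + 1 by ring, chord_last (by omega) (by omega),
          mem_diagonals]
        simp only; omega
      · obtain rfl : x = 1 := by omega
        rw [height_ordering_one, sub_zero] at hA'
        have := hV y (3 + B.size) (by omega) (by omega) le_rfl
          (by rwa [height_ordering_end, zero_sub, allowedFlavor_neg])
        rwa [planar, show 3 + B.size = B.size + 2 + 1 by ring,
          chord_last (by omega) (by omega), if_pos hD] at this

end ordering

/-! ### The orderings `[(1,2), B_2]` -/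

theorem Fits.exists_interval {h : ℕ → Flavor} : ∀ {B : Blocks} {a : ℕ}, Fits h a B →
    B.flavors.Nodup → ∀ v, a ≤ v → v < a + B.size → h v = h a → ∃ I ∈ B.intervals a, I.1 = v
  | .nil, a, _, _, v, h1, h2, _ => by rw [Blocks.size] at h2; omega
  | .adj B, a, hB, hn, v, h1, h2, h3 => by
    rw [Blocks.size] at h2
    rcases Nat.eq_or_lt_of_le h1 with rfl | h1
    · exact ⟨pt a, by simp [Blocks.intervals], rfl⟩
    · obtain ⟨I, hI, hv⟩ := hB.2.exists_interval hn v h1 (by omega) (by rw [h3, hB.1])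
      exact ⟨I, List.mem_cons_of_mem _ hI, hv⟩
  | .pair r S B, a, hB, hn, v, h1, h2, h3 => by
    rw [Blocks.size] at h2
    rcases Nat.eq_or_lt_of_le h1 with rfl | h1
    · exact ⟨(a, a + S.size + 2), by simp [Blocks.intervals], rfl⟩
    · by_cases h4 : a + S.size + 2 ≤ v
      · rw [Blocks.flavors, List.nodup_cons, List.nodup_append] at hn
        obtain ⟨I, hI, hv⟩ := hB.2.2.2.exists_interval hn.2.2.1 v h4 (by omega)
          (by rw [h3, hB.2.2.1])
        exact ⟨I, List.mem_cons_of_mem _ hI, hv⟩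
      · have := hB.coeff_inside hn h1 (by omega)
        rw [h3] at this; omega

/-- The constraints of `[(l_1, r_1), B_2, …]` involve `l_1` only through `s_{r_1,J}` with blocks `J`. -/
theorem constraints_shape {h : ℕ → Flavor} (B : Blocks) : ∀ {r₁ a : ℕ} {P : List ℕ}
    {prev : List BlockPos}, IsPrefix h r₁ P prev a → Fits h a B → B.flavors.Nodup →
    ∀ p ∈ constraintsFrom r₁ prev a B,
      (p.1 = (r₁, r₁ + 1) ∧ r₁ + 1 < p.2.1 ∧ p.2.1 < p.2.2 ∧ p.2.2 ≤ a + B.size ∧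
        h p.2.1 = h (r₁ + 1) ∧ h p.2.2 = h (r₁ + 1)) ∨
      (r₁ + 1 ≤ p.1.1 ∧ p.1.1 < p.1.2 ∧ p.1.2 < p.2.1 ∧ p.2.1 < p.2.2 ∧
        p.2.2 ≤ a + B.size) := by
  have hC1 : ∀ {r₁ a d e : ℕ} {P : List ℕ} {prev : List BlockPos}, IsPrefix h r₁ P prev a →
      a < d → d ≤ e → h d = h a → ∀ p ∈ C1 r₁ prev (a, d),
      (p.1 = (r₁, r₁ + 1) ∧ r₁ + 1 < p.2.1 ∧ p.2.1 < p.2.2 ∧ p.2.2 ≤ e ∧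
        h p.2.1 = h (r₁ + 1) ∧ h p.2.2 = h (r₁ + 1)) ∨
      (r₁ + 1 ≤ p.1.1 ∧ p.1.1 < p.1.2 ∧ p.1.2 < p.2.1 ∧ p.2.1 < p.2.2 ∧ p.2.2 ≤ e) := by
    intro r₁ a d e P prev hP had hde hd p hp
    rw [hP.C1_iff] at hp
    rcases hp with ⟨h1, ⟨h2, h3⟩ | ⟨b, hb, h2, h3⟩⟩
    · rw [h1]
      exact Or.inl ⟨h3, h2, had, hde, hP.height_eq, hd.trans hP.height_eq⟩
    · have := hP.piece b hb _ h2
      rw [h1]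
      exact Or.inr ⟨this.1, this.2.1, h3, had, hde⟩
  induction B with
  | nil => intro r₁ a P prev _ _ _ p hp; exact absurd hp (Set.notMem_empty _)
  | adj B ih =>
    intro r₁ a P prev hP hB hn p hp
    rw [Blocks.size, ← add_assoc]
    rcases hp with hp | hp
    · exact hC1 hP (by omega) (by omega) hB.1 p hp
    · exact ih (hP.snoc_adj hB.1) hB.2 hn p hp
  | pair r S B ihS ihB =>
    intro r₁ a P prev hP hB hn p hp
    have hnS := hn
    rw [Blocks.flavors, List.nodup_cons, List.nodup_append] at hnS
    have hle := hP.le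
    rw [Blocks.size, show a + (S.size + 2 + B.size) = a + S.size + 2 + B.size by ring]
    rcases hp with (((hp | ⟨⟨b, hb, h1⟩, h2⟩) | ⟨h0, h1⟩) | hp) | hp
    · exact hC1 hP (by omega) (by omega) hB.2.2.1 p hp
    · have := hP.block b hb
      right
      rw [h1, h2]
      simp only [BlockPos.all, pt, pairPos]
      omega
    · have hpos : 0 < S.size := Blocks.size_pos fun hS => h0 (Blocks.intervals_eq_nil.2 hS)
      right
      rcases h1 with h1 | ⟨h1, h2⟩ | ⟨b, hb, h1, h2⟩
      · rw [h1]
        simp only [pt, pairPos]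
        omega
      · have h3 := Blocks.intervals_bounds _ (List.mem_of_mem_dropLast h1)
        have h4 := Blocks.lt_of_mem_dropLast _ h1
        rw [h2]
        simp only [pt, pairPos]
        omega
      · have h3 := hP.block b hb
        have h4 := Blocks.intervals_bounds _ h2
        rw [h1]
        simp only [BlockPos.all]
        omega
    · rcases ihS (IsPrefix.nil h a) hB.2.1 hnS.2.1 p hp with h1 | h1
      · rw [h1.1]
        right
        simp only
        omega
      · right; omega
    · exact ihB (hP.snoc_pair hB hn) hB.2.2.2 hnS.2.2.1 p hp

section twoBlock

variable {r₁ r₂ : ℕ} {S : Blocks}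

theorem length_twoBlock : (ordering r₁ (.pair r₂ S .nil)).length = S.size + 4 := by
  rw [length_ordering, Blocks.size, Blocks.size]

theorem height_twoBlock_four : height (ordering r₁ (.pair r₂ S .nil)) 4 = fl r₂ := by
  have := (fits_ordering (r₁ := r₁) (B := .pair r₂ S .nil)).1
  rwa [height_ordering_three, zero_add] at this

theorem height_twoBlock_end : height (ordering r₁ (.pair r₂ S .nil)) (S.size + 4) = fl r₂ := by
  rw [← height_twoBlock_four (r₁ := r₁) (S := S),
    ← (fits_ordering (r₁ := r₁) (B := .pair r₂ S .nil)).2.1.height_end]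
  congr 1; ring

theorem mem_twoBlockF1 (hn : (r₁ :: r₂ :: S.flavors).Nodup) {x y : ℕ} :
    (x, y) ∈ twoBlockF1 S ↔ x = 1 ∧ 4 ≤ y ∧ y < S.size + 4 ∧
      height (ordering r₁ (.pair r₂ S .nil)) y = fl r₂ := by
  have hf := (fits_ordering (r₁ := r₁) (B := .pair r₂ S .nil)).2.1
  have hn' := (List.nodup_cons.1 (List.nodup_cons.1 hn).2).2
  simp only [twoBlockF1, List.mem_toFinset, List.mem_map, Prod.mk.injEq]
  constructor
  · rintro ⟨I, hI, rfl, rfl⟩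
    have h1 := Blocks.intervals_bounds I hI
    exact ⟨rfl, h1.1, by omega, by
      rw [(hf.height_intervals I hI).1, height_twoBlock_four]⟩
  · rintro ⟨rfl, h1, h2, h3⟩
    obtain ⟨I, hI, hy⟩ := hf.exists_interval hn' y h1 (by omega)
      (by rw [h3, height_twoBlock_four])
    exact ⟨I, hI, rfl, hy⟩

theorem mem_twoBlockF3 (hn : (r₁ :: r₂ :: S.flavors).Nodup) (hS : S ≠ .nil) {x y : ℕ} :
    (x, y) ∈ twoBlockF3 S ↔ x = 3 ∧ 5 ≤ y ∧ y ≤ S.size + 4 ∧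
      height (ordering r₁ (.pair r₂ S .nil)) y = fl r₂ := by
  have hf := (fits_ordering (r₁ := r₁) (B := .pair r₂ S .nil)).2.1
  have hn' := (List.nodup_cons.1 (List.nodup_cons.1 hn).2).2
  have hpos := Blocks.size_pos hS
  simp only [twoBlockF3, Finset.mem_union, Finset.mem_singleton, Finset.mem_inter,
    List.mem_toFinset, List.mem_map, Prod.mk.injEq, mem_diagonals]
  constructor
  · rintro (⟨rfl, rfl⟩ | ⟨⟨I, hI, rfl, rfl⟩, h2⟩)
    · exact ⟨rfl, by omega, le_rfl, height_twoBlock_end⟩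
    · have h1 := Blocks.intervals_bounds I hI
      exact ⟨rfl, by omega, by omega, by
        rw [(hf.height_intervals I hI).1, height_twoBlock_four]⟩
  · rintro ⟨rfl, h1, h2, h3⟩
    by_cases hy : y = S.size + 4
    · exact Or.inl ⟨rfl, hy⟩
    · obtain ⟨I, hI, hy⟩ := hf.exists_interval hn' y (by omega) (by omega)
        (by rw [h3, height_twoBlock_four])
      exact Or.inr ⟨⟨I, hI, rfl, hy⟩, by omega⟩

theorem mem_twoBlockF (hn : (r₁ :: r₂ :: S.flavors).Nodup) (hS : S ≠ .nil) {x y : ℕ} :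
    (x, y) ∈ twoBlockF1 S ∪ twoBlockF3 S ↔ (x, y) ∈ diagonals (S.size + 4) ∧ (x = 1 ∨ x = 3) ∧
      4 ≤ y ∧ height (ordering r₁ (.pair r₂ S .nil)) y = fl r₂ := by
  rw [Finset.mem_union, mem_twoBlockF1 hn, mem_twoBlockF3 hn hS, mem_diagonals]
  have hpos := Blocks.size_pos hS
  simp only
  constructor
  · rintro (⟨rfl, h1, h2, h3⟩ | ⟨rfl, h1, h2, h3⟩)
    · exact ⟨by omega, Or.inl rfl, h1, h3⟩
    · exact ⟨by omega, Or.inr rfl, by omega, h3⟩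
  · rintro ⟨h1, rfl | rfl, h2, h3⟩
    · exact Or.inl ⟨rfl, h2, by omega, h3⟩
    · exact Or.inr ⟨rfl, by omega, by omega, h3⟩

/-- The elements of `F` are the allowed diagonals that cross the flavour line of the second block. -/
theorem mem_twoBlockF_of_allowed (hn : (r₁ :: r₂ :: S.flavors).Nodup) (hS : S ≠ .nil)
    {D : ℕ × ℕ} (hD : D ∈ diagonals (S.size + 4))
    (hA : Allowed (ordering r₁ (.pair r₂ S .nil)) D) (h1 : D.1 ≤ 3) (h2 : 4 ≤ D.2) :
    D ∈ twoBlockF1 S ∪ twoBlockF3 S := by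
  obtain ⟨x, y⟩ := D
  simp only at h1 h2
  have hD' := mem_diagonals.1 hD
  simp only at hD'
  have hn' := (List.nodup_cons.1 hn).2
  have hnB : (Blocks.pair r₂ S .nil).flavors.Nodup := by simpa [Blocks.flavors] using hn'
  have hf := fits_ordering (r₁ := r₁) (B := .pair r₂ S .nil)
  have hr : r₁ ∉ (Blocks.pair r₂ S .nil).flavors := by
    simpa [Blocks.flavors] using (List.nodup_cons.1 hn).1
  have hr12 : r₁ ≠ r₂ := by
    rintro rfl; exact hr (by simp [Blocks.flavors])
  have hy2 := hf.coeff_inside hnB (v := y) (by omega) (by omega)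
  have hy1 := hf.coeff hnB y (by omega) (by rw [Blocks.size, Blocks.size]; omega) r₁
  rw [height_ordering_three] at hy2 hy1
  have hy1' : height (ordering r₁ (.pair r₂ S .nil)) y r₁ = 0 := by
    rcases hy1 with h | h
    · exact h
    · exact absurd h.2 hr
  rw [mem_twoBlockF hn hS]
  have hA' := (allowed_iff (by omega)).1 hA
  have hx : height (ordering r₁ (.pair r₂ S .nil)) x = 0 ∨ (x = 2 ∧
      height (ordering r₁ (.pair r₂ S .nil)) x = fl r₁) := by
    rcases (by omega : x = 1 ∨ x = 2 ∨ x = 3) with rfl | rfl | rfl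
    · exact Or.inl height_ordering_one
    · exact Or.inr ⟨rfl, height_ordering_two⟩
    · exact Or.inl height_ordering_three
  rcases hx with hx | ⟨rfl, hx⟩
  · rw [hx, sub_zero] at hA'
    have hx2 : x ≠ 2 := by
      rintro rfl
      rw [height_ordering_two] at hx
      have := DFunLike.congr_fun hx r₁
      rw [fl_apply, if_pos rfl] at this
      exact absurd this (by simp)
    refine ⟨hD, by omega, h2, hA'.eq_fl ?_⟩
    rw [hy2]; rfl
  -- From the vertex `2` the diagonal would cross the lines of `r₁` and `r₂` at once.
  · rw [hx] at hA'
    have := hA'.eq_fl (r := r₂) (by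
      rw [Finsupp.sub_apply, fl_apply, if_neg hr12, hy2]; rfl)
    have := DFunLike.congr_fun this r₁
    rw [Finsupp.sub_apply, fl_apply, fl_apply, if_pos rfl, if_neg hr12.symm, hy1'] at this
    omega

theorem charge_twoBlockF (hn : (r₁ :: r₂ :: S.flavors).Nodup) (hS : S ≠ .nil) {D : ℕ × ℕ}
    (hD : D ∈ twoBlockF1 S ∪ twoBlockF3 S) :
    charge (ordering r₁ (.pair r₂ S .nil)) D = fl r₂ := by
  obtain ⟨x, y⟩ := D
  obtain ⟨-, h1, h2, h3⟩ := (mem_twoBlockF hn hS).1 hD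
  rw [charge_eq_height _ (by simp only; omega)]
  rcases h1 with rfl | rfl
  · simp only [h3, height_ordering_one, sub_zero]
  · simp only [h3, height_ordering_three, sub_zero]

/-! ### The shift direction and the flips for `[(1,2), B_2]` -/

theorem shiftDir_twoBlock (hn : (r₁ :: r₂ :: S.flavors).Nodup) (hS : S ≠ .nil) {x y : ℕ}
    (hD : (x, y) ∈ diagonals (S.size + 4)) :
    shiftDir (twoBlockF1 S ∪ twoBlockF3 S) (twoBlockLam S) (x, y) =
      if 4 ≤ y ∧ height (ordering r₁ (.pair r₂ S .nil)) y = fl r₂ then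
        (if x = 1 then -1 else if x = 3 then 1 else 0) else 0 := by
  have hD' := mem_diagonals.1 hD
  simp only at hD'
  simp only [shiftDir, twoBlockLam]
  by_cases h1 : 4 ≤ y ∧ height (ordering r₁ (.pair r₂ S .nil)) y = fl r₂
  · rw [if_pos h1]
    by_cases hx1 : x = 1
    · rw [if_pos ((mem_twoBlockF hn hS).2 ⟨hD, Or.inl hx1, h1⟩),
        if_pos ((mem_twoBlockF1 hn).2 ⟨hx1, h1.1, by omega, h1.2⟩), if_pos hx1]
    · by_cases hx3 : x = 3
      · rw [if_pos ((mem_twoBlockF hn hS).2 ⟨hD, Or.inr hx3, h1⟩),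
          if_neg fun h => hx1 ((mem_twoBlockF1 hn).1 h).1,
          if_pos ((mem_twoBlockF3 hn hS).2 ⟨hx3, by omega, by omega, h1.2⟩), if_neg hx1,
          if_pos hx3]
      · rw [if_neg fun h => ((mem_twoBlockF hn hS).1 h).2.1.elim hx1 hx3, if_neg hx1, if_neg hx3]
  · rw [if_neg fun h => h1 ((mem_twoBlockF hn hS).1 h).2.2, if_neg h1]

/-- At vertices of height `fl r₂` the direction is `1` on chords from `3`, `-1` on chords to `n +
1`, and it is `0` among `4, …, n`. A Mandelstam variable is a mixed difference in both ends, so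
these constants drop out along sub-blocks; in `s_{l,r}` the values on `X_{3,n}` and `X_{4,n+1}`
compensate each other. -/
theorem twoBlock_homogeneous (hn : (r₁ :: r₂ :: S.flavors).Nodup) (hS : S ≠ .nil) :
    ∀ p ∈ constraints (.pair r₂ S .nil),
      mandelstam (S.size + 4) (shiftDir (twoBlockF1 S ∪ twoBlockF3 S) (twoBlockLam S)) p = 0 := by
  have hpos := Blocks.size_pos hS
  have hn' := (List.nodup_cons.1 (List.nodup_cons.1 hn).2).2
  have hf := (fits_ordering (r₁ := r₁) (B := .pair r₂ S .nil)).2.1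
  set h := height (ordering r₁ (.pair r₂ S .nil)) with hh
  have h4 : h 4 = fl r₂ := height_twoBlock_four
  set V := shiftDir (twoBlockF1 S ∪ twoBlockF3 S) (twoBlockLam S) with hV
  have g0 : ∀ x y, 4 ≤ x → x < y → y ≤ S.size + 4 → planar (S.size + 4) V x y = 0 := by
    intro x y h1 h2 h3
    rw [planar, chord_of_le h2.le h3]
    split_ifs with hD
    · rw [hV, shiftDir_twoBlock hn hS hD, if_neg (by omega : ¬ x = 1), if_neg (by omega : ¬ x = 3),
        ite_self]
    · rfl
  have g3 : ∀ y, 5 ≤ y → y ≤ S.size + 4 → h y = fl r₂ → planar (S.size + 4) V 3 y = 1 := by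
    intro y h1 h2 h3
    have hD : (3, y) ∈ diagonals (S.size + 4) := by rw [mem_diagonals]; simp only; omega
    rw [planar, chord_of_le (by omega) h2, if_pos hD, hV, shiftDir_twoBlock hn hS hD,
      if_pos ⟨by omega, h3⟩, if_neg (by omega), if_pos rfl]
  have g1 : ∀ x, 4 ≤ x → x < S.size + 4 → h x = fl r₂ →
      planar (S.size + 4) V x (S.size + 4 + 1) = -1 := by
    intro x h1 h2 h3
    have hD : (1, x) ∈ diagonals (S.size + 4) := by rw [mem_diagonals]; simp only; omega
    rw [planar, chord_last (by omega) h2.le, if_pos hD, hV, shiftDir_twoBlock hn hS hD,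
      if_pos ⟨h1, h3⟩, if_pos rfl]
  have g13 : planar (S.size + 4) V 3 (S.size + 4 + 1) = 0 := by
    have hD : (1, 3) ∈ diagonals (S.size + 4) := by rw [mem_diagonals]; simp only; omega
    rw [planar, chord_last (by omega) (by omega), if_pos hD, hV, shiftDir_twoBlock hn hS hD,
      if_neg (by omega)]
  have gedge : ∀ x, planar (S.size + 4) V x (x + 1) = 0 := fun x => if_neg (chord_succ_notMem _ _)
  have hend : h (S.size + 4) = fl r₂ := height_twoBlock_end
  have e1 : 3 + S.size + 1 = S.size + 4 := by ring
  rintro p ((((hp | ⟨⟨b, hb, h1⟩, h2⟩) | ⟨h0, h1⟩) | hp) | hp)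
  · have := (IsPrefix.nil h 2).C1_iff.1 hp
    simp at this
  · simp at hb
  · rcases h1 with h1 | ⟨h1, h2⟩ | ⟨b, hb, h1, h2⟩
    · rw [h1]
      simp only [mandelstam, pt, pairPos, e1, gedge, g13]
      rw [g0 4 (S.size + 4) (by omega) (by omega) (by omega),
        g3 (S.size + 4) (by omega) (by omega) hend, g1 4 (by omega) (by omega) h4]
      ring
    · have hI := List.mem_of_mem_dropLast h1
      have h3 := Blocks.intervals_bounds _ hI
      have h4' := Blocks.lt_of_mem_dropLast _ h1
      have h5 := hf.height_intervals _ hI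
      simp only [mandelstam, h2, pt, pairPos, e1, gedge]
      rw [g0 p.1.1 p.1.2 (by omega) (by omega) (by omega),
        g0 p.1.2 (S.size + 4) (by omega) (by omega) (by omega),
        g0 p.1.1 (S.size + 4) (by omega) (by omega) (by omega),
        g1 p.1.1 (by omega) (by omega) (h5.1.trans h4),
        g1 p.1.2 (by omega) (by omega) (h5.2.trans h4)]
      ring
    · simp at hb
  · rcases constraints_shape S (IsPrefix.nil h 3) hf hn' p hp with h1 | h1
    · obtain ⟨⟨a, b⟩, c, d⟩ := p
      simp only [Prod.mk.injEq] at h1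
      obtain ⟨⟨rfl, rfl⟩, h2, h3, h5, h6, h7⟩ := h1
      simp only [mandelstam, gedge]
      rw [g0 c d (by omega) h3 (by omega), g3 d (by omega) (by omega) (h7.trans h4),
        g3 c (by omega) (by omega) (h6.trans h4), g0 _ c (by omega) (by omega) (by omega),
        g0 _ d (by omega) (by omega) (by omega)]
      ring
    · simp only [mandelstam]
      rw [g0 _ _ (by omega) (by omega) (by omega), g0 _ _ (by omega) (by omega) (by omega),
        g0 _ _ (by omega) (by omega) (by omega), g0 _ _ (by omega) (by omega) (by omega),
        g0 _ _ (by omega) (by omega) (by omega), g0 _ _ (by omega) (by omega) (by omega)]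
      ring
  · exact absurd hp (Set.notMem_empty _)

/-- Diagonals across `(3, n)` join `{1, 2}` to `{4, …, n - 1}`, and those across `(1, 4)` join `{2,
3}` to `{5, …, n}`. If allowed, both kinds lie in `F`, so a triangulation with a single diagonal in
`F` may exchange it for `(3, n)` or `(1, 4)`. The negative diagonals share the vertex `1` and do not
cross. -/
theorem twoBlock_flipShift (hn : (r₁ :: r₂ :: S.flavors).Nodup) (hS : S ≠ .nil) :
    FlipShift (ordering r₁ (.pair r₂ S .nil)) (constraints (.pair r₂ S .nil))
      (preferredBasis (.pair r₂ S .nil)) (3, S.size + 4) (twoBlockF1 S ∪ twoBlockF3 S)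
      (twoBlockLam S) := by
  have hpos := Blocks.size_pos hS
  have hB : Blocks.pair r₂ S .nil ≠ .nil := by simp
  have hn2 : (r₁ :: (Blocks.pair r₂ S .nil).flavors).Nodup := by
    simpa [Blocks.flavors] using hn
  have hF : ∀ T ∈ feynmanDiagrams (ordering r₁ (.pair r₂ S .nil)), ∀ E ∈ T, E.1 ≤ 3 → 4 ≤ E.2 →
      E ∈ twoBlockF1 S ∪ twoBlockF3 S := by
    intro T hT E hE h1 h2
    rw [mem_feynmanDiagrams, length_twoBlock] at hT
    exact mem_twoBlockF_of_allowed hn hS (hT.1 hE) (hT.2.2.1 E hE) h1 h2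
  have hD₀ : (3, S.size + 4) ∈ twoBlockF1 S ∪ twoBlockF3 S := by
    rw [mem_twoBlockF hn hS, mem_diagonals]
    exact ⟨by simp only; omega, Or.inr rfl, by omega, height_twoBlock_end⟩
  have hD₁ : (1, 4) ∈ twoBlockF1 S ∪ twoBlockF3 S := by
    rw [mem_twoBlockF hn hS, mem_diagonals]
    exact ⟨by simp only; omega, Or.inl rfl, le_rfl, height_twoBlock_four⟩
  have hmem : ∀ D ∈ twoBlockF1 S ∪ twoBlockF3 S,
      D ∈ diagonals (ordering r₁ (.pair r₂ S .nil)).length ∧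
        Allowed (ordering r₁ (.pair r₂ S .nil)) D := by
    rintro ⟨x, y⟩ hD
    rw [length_twoBlock]
    exact ⟨((mem_twoBlockF hn hS).1 hD).1, Or.inr ⟨r₂, Or.inl (charge_twoBlockF hn hS hD)⟩⟩
  have hlam1 : ∀ y, (1, y) ∈ twoBlockF1 S ∪ twoBlockF3 S → twoBlockLam S (1, y) = -1 := by
    intro y hD
    rw [mem_twoBlockF hn hS, mem_diagonals] at hD
    rw [twoBlockLam, if_pos ((mem_twoBlockF1 hn).2
      ⟨rfl, hD.2.2.1, by have := hD.1; simp only at this; omega, hD.2.2.2⟩)]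
  have hlam3 : ∀ y, (3, y) ∈ twoBlockF1 S ∪ twoBlockF3 S → twoBlockLam S (3, y) = 1 := by
    intro y hD
    have h1 : (3, y) ∉ twoBlockF1 S := fun h => by
      rw [mem_twoBlockF1 hn] at h; omega
    rw [twoBlockLam, if_neg h1, if_pos ((Finset.mem_union.1 hD).resolve_left h1)]
  have hcase : ∀ D ∈ twoBlockF1 S ∪ twoBlockF3 S, D.1 = 1 ∨ D.1 = 3 := by
    rintro ⟨x, y⟩ hD
    exact ((mem_twoBlockF hn hS).1 hD).2.1
  -- If `(3, n)` is missing, maximality yields a diagonal across it, and this one starts before `3`.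
  have hmeets : ∀ T ∈ feynmanDiagrams (ordering r₁ (.pair r₂ S .nil)), (3, S.size + 4) ∉ T →
      ∃ E ∈ T, E ∈ twoBlockF1 S ∪ twoBlockF3 S ∧ E.1 < 3 := by
    intro T hT hT₀
    by_contra hcon
    push Not at hcon
    refine hT₀ (mem_of_not_crossing hT (hmem _ hD₀).1 fun E hE hX => ?_)
    have hE' := mem_diagonals.1 ((mem_feynmanDiagrams.1 hT).1 hE)
    rw [length_twoBlock] at hE'
    simp only [Crossing] at hX
    have := hcon E hE (hF T hT E hE (by omega) (by omega))
    omega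
  constructor
  · exact isPlanarBasis_preferredBasis hB hn2
  · exact hmem
  · rintro ⟨x, y⟩ hD
    rcases hcase _ hD with h | h <;> simp only at h <;> subst h
    · exact Or.inr (hlam1 y hD)
    · exact Or.inl (hlam3 y hD)
  · exact hD₀
  · rw [mem_preferredBasis hB]
    refine ⟨?_, (3, 3 + S.size + 1), Or.inl (Or.inl (by simp)), ?_⟩
    · have := (hmem _ hD₀).1
      rwa [length_ordering] at this
    · rw [chord_of_le (by simp only; omega) (by simp only [Blocks.size]; omega)]
      simp only [Prod.mk.injEq, true_and]; omega
  · exact hlam3 _ hD₀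
  · intro D hD hne hDF
    rw [mem_preferredBasis hB] at hD
    obtain ⟨-, q, hq, rfl⟩ := hD
    have hsz : (Blocks.pair r₂ S .nil).size + 2 = S.size + 4 := by
      rw [Blocks.size, Blocks.size]
    rw [hsz] at hne hDF
    have hlast : chord (S.size + 4) 3 (3 + S.size + 2) ∉ twoBlockF1 S ∪ twoBlockF3 S := by
      rw [show 3 + S.size + 2 = S.size + 4 + 1 by ring, chord_last (by omega) (by omega),
        mem_twoBlockF (r₁ := r₁) (r₂ := r₂) hn hS]
      omega
    simp only [basisPairs, Set.mem_union, Set.mem_insert_iff, Set.mem_singleton_iff] at hq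
    rcases hq with ((rfl | rfl | rfl) | hq) | hq
    · exact hlast hDF
    · exact hlast hDF
    · refine hne ?_
      rw [chord_of_le (by simp only; omega) (by simp only; omega)]
      simp only [Prod.mk.injEq, true_and]; omega
    · have hb := basisPairs_bounds le_rfl q hq
      rw [chord_of_le (by omega) (by omega)] at hDF
      have := hcase _ hDF
      simp only at this
      omega
    · exact absurd hq (Set.notMem_empty _)
  · rw [length_twoBlock]
    exact twoBlock_homogeneous hn hS
  · intro T hT
    by_cases h : (3, S.size + 4) ∈ T
    · exact ⟨_, h, hD₀⟩
    · obtain ⟨E, hE, hEF, -⟩ := hmeets T hT h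
      exact ⟨E, hE, hEF⟩
  · intro T hT D hD hne hTF
    have hDT : D ∈ T := Finset.mem_of_mem_inter_left (hTF ▸ Finset.mem_singleton_self D)
    have huniq : ∀ E ∈ T, E ∈ twoBlockF1 S ∪ twoBlockF3 S → E = D := fun E hE hEF => by
      have := Finset.mem_inter.2 ⟨hE, hEF⟩
      rwa [hTF, Finset.mem_singleton] at this
    have hT₀ : (3, S.size + 4) ∉ T := fun h => hne (huniq _ h hD₀).symm
    obtain ⟨E, hE, hEF, hE3⟩ := hmeets T hT hT₀
    obtain rfl := huniq E hE hEF
    refine ⟨?_, insert_erase_mem_feynmanDiagrams hT hDT (hmem _ hD₀).1 (hmem _ hD₀).2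
      (fun E' hE' hX => huniq E' hE' ?_) hT₀⟩
    · obtain ⟨x, y⟩ := E
      have := hcase _ hD
      simp only at this hE3
      obtain rfl : x = 1 := by omega
      exact hlam1 y hD
    · have hE'' := mem_diagonals.1 ((mem_feynmanDiagrams.1 hT).1 hE')
      rw [length_twoBlock] at hE''
      simp only [Crossing] at hX
      exact hF T hT E' hE' (by omega) (by omega)
  · intro T hT hTF
    have hDT : (3, S.size + 4) ∈ T :=
      Finset.mem_of_mem_inter_left (hTF ▸ Finset.mem_singleton_self _)
    have huniq : ∀ E ∈ T, E ∈ twoBlockF1 S ∪ twoBlockF3 S → E = (3, S.size + 4) :=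
      fun E hE hEF => by
        have := Finset.mem_inter.2 ⟨hE, hEF⟩
        rwa [hTF, Finset.mem_singleton] at this
    refine ⟨(1, 4), hD₁, by simp, insert_erase_mem_feynmanDiagrams hT hDT (hmem _ hD₁).1
      (hmem _ hD₁).2 (fun E' hE' hX => huniq E' hE' ?_) fun h => ?_⟩
    · have hE'' := mem_diagonals.1 ((mem_feynmanDiagrams.1 hT).1 hE')
      simp only [Crossing] at hX
      exact hF T hT E' hE' (by omega) (by omega)
    · have := huniq _ h hD₁
      simp at this
  · rintro ⟨x, y⟩ hD ⟨x', y'⟩ hE hl hl'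
    have h1 : ∀ x y, (x, y) ∈ twoBlockF1 S ∪ twoBlockF3 S → twoBlockLam S (x, y) = -1 → x = 1 := by
      intro x y hD hl
      rcases hcase _ hD with h | h <;> simp only at h <;> subst h
      · rfl
      · rw [hlam3 y hD] at hl
        norm_num at hl
    rw [h1 x y hD hl, h1 x' y' hE hl']
    simp only [Crossing]; omega

end twoBlock

/-! ### Adjacent pairs -/

theorem size_adjacentPairs : ∀ rs : List ℕ, (adjacentPairs rs).size = 2 * rs.length
  | [] => rfl
  | r :: rs => by
    rw [adjacentPairs, Blocks.size, Blocks.size, size_adjacentPairs rs, List.length_cons]; ring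

theorem flavors_adjacentPairs : ∀ rs : List ℕ, (adjacentPairs rs).flavors = rs
  | [] => rfl
  | r :: rs => by
    rw [adjacentPairs, Blocks.flavors, Blocks.flavors, flavors_adjacentPairs rs, List.nil_append]

theorem word_adjacentPairs_cons (r : ℕ) (rs : List ℕ) :
    (adjacentPairs (r :: rs)).word = fl r :: -fl r :: (adjacentPairs rs).word := rfl

theorem word_adjacentPairs_append (rs rs' : List ℕ) : (adjacentPairs (rs ++ rs')).word =
    (adjacentPairs rs).word ++ (adjacentPairs rs').word := by
  induction rs with
  | nil => rfl
  | cons r rs ih => rw [List.cons_append, word_adjacentPairs_cons, ih]; rfl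

theorem length_word_adjacentPairs (rs : List ℕ) :
    (adjacentPairs rs).word.length = 2 * rs.length := by
  rw [Blocks.length_word, size_adjacentPairs]

theorem sum_word_adjacentPairs (rs : List ℕ) : (adjacentPairs rs).word.sum = 0 :=
  Blocks.sum_word _

theorem mem_basisPairs_adjacentPairs {b : ℕ} {q : ℕ × ℕ} : ∀ {rs : List ℕ} {a : ℕ},
    q ∈ basisPairs b a (adjacentPairs rs) ↔ ∃ j < rs.length, q = (a + 2 * j, a + 2 * j + 2) ∨
      q = (b, a + 2 * j + 2) ∨ q = (a + 2 * j, a + 2 * j + 1) := by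
  intro rs
  induction rs with
  | nil => intro a; simp [adjacentPairs, basisPairs]
  | cons r rs ih =>
    intro a
    have hs : Blocks.nil.size = 0 := rfl
    simp only [adjacentPairs, basisPairs, Set.mem_union, Set.mem_insert_iff,
      Set.mem_singleton_iff, hs, Set.union_empty, ih, Nat.add_zero]
    constructor
    · rintro (h | ⟨j, hj, h⟩)
      · exact ⟨0, by simp, h⟩
      · refine ⟨j + 1, by simpa using hj, ?_⟩
        rw [show a + 2 * (j + 1) = a + 2 + 2 * j by ring]
        exact h
    · rintro ⟨j, hj, h⟩
      cases j with
      | zero => exact Or.inl h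
      | succ j =>
        refine Or.inr ⟨j, by simpa using hj, ?_⟩
        rw [show a + 2 * (j + 1) = a + 2 + 2 * j by ring] at h
        exact h

/-- For single pairs the chords `X_{l,r}` are edges. The case `i = 1` is `X_{1,3}`, the fan chord
from `3` to `n + 1`, while `X_{3,5}` is at once a fan chord and the chord over the first pair after
`(1, 2)`. -/
theorem adjacentBasis_eq {rs : List ℕ} (hrs : 2 ≤ rs.length) :
    adjacentBasis (rs.length + 1) = preferredBasis (adjacentPairs rs) := by
  have hne : adjacentPairs rs ≠ .nil := by
    intro h
    have := size_adjacentPairs rs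
    rw [h, Blocks.size] at this
    omega
  have hsz : (adjacentPairs rs).size + 2 = 2 * (rs.length + 1) := by
    rw [size_adjacentPairs]; ring
  ext D
  rw [mem_preferredBasis hne, hsz]
  simp only [adjacentBasis, Set.mem_ofPred_eq, mem_basisPairs_adjacentPairs]
  constructor
  · rintro (⟨i, h1, h2, rfl⟩ | ⟨j, h1, h2, rfl⟩)
    · constructor
      · rcases Nat.lt_or_ge i (rs.length + 1) with h | h
        · rw [chord_of_le (by omega) (by omega), mem_diagonals]; simp only; omega
        · obtain rfl : i = rs.length + 1 := by omega
          rw [chord_last (by omega) (by omega), mem_diagonals]; simp only; omega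
      · rcases Nat.lt_or_ge 1 i with h | h
        · exact ⟨_, ⟨i - 2, by omega, Or.inl rfl⟩, by
            simp only; congr 1 <;> omega⟩
        · obtain rfl : i = 1 := by omega
          refine ⟨_, ⟨rs.length - 1, by omega, Or.inr (Or.inl rfl)⟩, ?_⟩
          simp only
          rw [show 3 + 2 * (rs.length - 1) + 2 = 2 * (rs.length + 1) + 1 by omega,
            chord_last (by omega) (by omega), chord_of_le (by omega) (by omega)]
    · refine ⟨by rw [mem_diagonals]; simp only; omega,
        _, ⟨j - 2, by omega, Or.inr (Or.inl rfl)⟩, ?_⟩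
      simp only
      rw [chord_of_le (by omega) (by omega)]
      congr 1; omega
  · rintro ⟨hD, q, ⟨j, hj, rfl | rfl | rfl⟩, rfl⟩
    · exact Or.inl ⟨j + 2, by omega, by omega, by simp only; congr 1 <;> omega⟩
    · simp only at hD ⊢
      rcases Nat.lt_or_ge (j + 1) rs.length with h | h
      · rw [chord_of_le (by omega) (by omega)] at hD ⊢
        rcases Nat.eq_zero_or_pos j with rfl | h0
        · refine Or.inl ⟨2, by omega, by omega, ?_⟩
          rw [chord_of_le (by omega) (by omega)]
        · exact Or.inr ⟨j + 2, by omega, by omega, by congr 1; omega⟩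
      · refine Or.inl ⟨1, le_rfl, by omega, ?_⟩
        rw [show 3 + 2 * j + 2 = 2 * (rs.length + 1) + 1 by omega,
          chord_last (by omega) (by omega), chord_of_le (by omega) (by omega)]
    · exact absurd hD (chord_succ_notMem _ _)

/-- Without sub-blocks, `C3` and the nested constraints are empty. In `C1` the excluded particle is
`m - 1`, whence `x + 1 < m`; the second form is `C2`. -/
theorem constraints_adjacentPairs : ∀ (rs : List ℕ) {a : ℕ} {prev : List BlockPos}, 3 ≤ a →
    a % 2 = 1 → (∀ b ∈ prev, b.r = b.l + 1 ∧ b.sub = [] ∧ 3 ≤ b.l ∧ b.l % 2 = 1 ∧ b.r < a) →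
    (prev.getLast?.map BlockPos.r).getD 2 = a - 1 →
    ∀ p ∈ constraintsFrom 2 prev a (adjacentPairs rs),
      (∃ x m, 2 ≤ x ∧ x + 1 < m ∧ m % 2 = 1 ∧ m + 2 ≤ a + 2 * rs.length ∧
        p = ((x, x + 1), (m, m + 2))) ∨
      (∃ x m, 3 ≤ x ∧ x % 2 = 1 ∧ x + 2 ≤ m ∧ m % 2 = 1 ∧ m + 2 ≤ a + 2 * rs.length ∧
        p = ((x, x + 2), (m + 1, m + 2)))
  | [], a, prev, _, _, _, _, p, hp => absurd hp (Set.notMem_empty _)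
  | r :: rs, a, prev, ha, hodd, hprev, hlast, p, hp => by
    rw [List.length_cons]
    rcases hp with (((hp | hp) | hp) | hp) | hp
    · obtain ⟨h1, h2, h3⟩ := hp
      rw [hlast] at h3
      have h1' : p.2 = (a, a + 2) := h1
      obtain ⟨x, hx, hpx, hxa⟩ : ∃ x, 2 ≤ x ∧ p.1 = pt x ∧ x < a := by
        rcases h2 with h2 | ⟨b, hb, h2 | h2 | h2⟩
        · exact ⟨2, le_rfl, h2, by omega⟩
        · have := hprev b hb
          exact ⟨_, by omega, h2, by omega⟩
        · have := hprev b hb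
          exact ⟨_, by omega, h2, by omega⟩
        · rw [(hprev b hb).2.1] at h2
          simp at h2
      have hne : x ≠ a - 1 := by rintro rfl; exact h3 hpx
      exact Or.inl ⟨x, a, hx, by omega, hodd, by omega, Prod.ext hpx h1'⟩
    · obtain ⟨⟨b, hb, h1⟩, h2⟩ := hp
      obtain ⟨e1, -, e3, e4, e5⟩ := hprev b hb
      refine Or.inr ⟨b.l, a, e3, e4, by omega, hodd, by omega, Prod.ext ?_ h2⟩
      rw [h1, BlockPos.all, e1]
    · exact absurd rfl hp.1
    · exact absurd hp (Set.notMem_empty _)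
    · rcases constraints_adjacentPairs rs (a := a + 2) (prev := prev ++ [pairPos a .nil])
        (by omega) (by omega) (fun b hb => by
          rcases List.mem_append.1 hb with hb | hb
          · have := hprev b hb
            exact ⟨this.1, this.2.1, this.2.2.1, this.2.2.2.1, by omega⟩
          · rw [List.mem_singleton] at hb
            subst hb
            exact ⟨rfl, rfl, ha, hodd, by simp only [pairPos, Blocks.size]; omega⟩)
        (by simp [pairPos, Blocks.size]) p hp with ⟨x, m, h⟩ | ⟨x, m, h⟩
      · exact Or.inl ⟨x, m, h.1, h.2.1, h.2.2.1, by omega, h.2.2.2.2⟩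
      · exact Or.inr ⟨x, m, h.1, h.2.1, h.2.2.1, h.2.2.2.1, by omega, h.2.2.2.2.2⟩

section adjacent

variable {r₁ : ℕ} {rs : List ℕ}

theorem length_ordering_adjacentPairs :
    (ordering r₁ (adjacentPairs rs)).length = 2 * (rs.length + 1) := by
  rw [length_ordering, size_adjacentPairs]; ring

theorem height_adjacentPairs {h : ℕ → Flavor} : ∀ {rs : List ℕ} {a : ℕ},
    Fits h a (adjacentPairs rs) → h a = 0 →
    (∀ j ≤ rs.length, h (a + 2 * j) = 0) ∧
      ∀ j (hj : j < rs.length), h (a + 2 * j + 1) = fl rs[j]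
  | [], a, _, h0 => by
    refine ⟨fun j hj => ?_, fun j hj => by simp at hj⟩
    obtain rfl : j = 0 := by simpa using hj
    exact h0
  | r :: rs, a, hf, h0 => by
    obtain ⟨f1, -, f3, f4⟩ := hf
    have ih := height_adjacentPairs f4 (f3.trans h0)
    constructor
    · intro j hj
      cases j with
      | zero => exact h0
      | succ j =>
        rw [show a + 2 * (j + 1) = a + 2 + 2 * j by ring]
        exact ih.1 j (by simpa using hj)
    · intro j hj
      cases j with
      | zero => rw [h0, zero_add] at f1; exact f1
      | succ j =>
        rw [show a + 2 * (j + 1) + 1 = a + 2 + 2 * j + 1 by ring]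
        exact ih.2 j (by simpa using hj)

theorem height_ordering_adjacentPairs :
    (∀ j ≤ rs.length + 1, height (ordering r₁ (adjacentPairs rs)) (2 * j + 1) = 0) ∧
    ∀ j (hj : j < (r₁ :: rs).length),
      height (ordering r₁ (adjacentPairs rs)) (2 * j + 2) = fl (r₁ :: rs)[j] := by
  have h := height_adjacentPairs (rs := r₁ :: rs) (a := 1)
    (fits_height (ordering r₁ (adjacentPairs rs)) (adjacentPairs (r₁ :: rs)) [] [] 1
      (by simp [ordering, adjacentPairs]) rfl) height_ordering_one
  refine ⟨fun j hj => ?_, fun j hj => ?_⟩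
  · rw [show 2 * j + 1 = 1 + 2 * j by ring]; exact h.1 j hj
  · rw [show 2 * j + 2 = 1 + 2 * j + 1 by ring]; exact h.2 j hj

theorem not_allowedFlavor_fl_sub_fl {r s : ℕ} (hrs : r ≠ s) : ¬ AllowedFlavor (fl r - fl s) := by
  intro h
  have h1 := h.eq_fl (r := r) (by
    rw [Finsupp.sub_apply, fl_apply, fl_apply, if_pos rfl, if_neg hrs.symm]; rfl)
  have h2 := DFunLike.congr_fun h1 s
  rw [Finsupp.sub_apply, fl_apply, fl_apply, if_pos rfl, if_neg hrs] at h2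
  omega

/-- Odd vertices have height `0`, and an even vertex lies under the line of its own pair only. Two
even vertices therefore give the difference of two distinct flavours. -/
theorem allowed_adjacentPairs (hn : (r₁ :: rs).Nodup) {x y : ℕ}
    (hD : (x, y) ∈ diagonals (2 * (rs.length + 1))) :
    Allowed (ordering r₁ (adjacentPairs rs)) (x, y) ↔ x % 2 = 1 ∨ y % 2 = 1 := by
  have hD' := mem_diagonals.1 hD
  simp only at hD'
  have hh := height_ordering_adjacentPairs (r₁ := r₁) (rs := rs)
  rw [allowed_iff (by omega)]
  have hodd : ∀ v, v % 2 = 1 → v ≤ 2 * (rs.length + 1) →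
      height (ordering r₁ (adjacentPairs rs)) v = 0 := by
    intro v h1 h2
    have := hh.1 (v / 2) (by omega)
    rwa [show 2 * (v / 2) + 1 = v by omega] at this
  have heven : ∀ v, 1 ≤ v → v % 2 = 0 → v ≤ 2 * (rs.length + 1) →
      ∃ (h : v / 2 - 1 < (r₁ :: rs).length),
      height (ordering r₁ (adjacentPairs rs)) v = fl (r₁ :: rs)[v / 2 - 1] := by
    intro v h0 h1 h2
    have hlt : v / 2 - 1 < (r₁ :: rs).length := by rw [List.length_cons]; omega
    have := hh.2 (v / 2 - 1) hlt
    rw [show 2 * (v / 2 - 1) + 2 = v by omega] at this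
    exact ⟨hlt, this⟩
  rcases Nat.mod_two_eq_zero_or_one x with hx | hx <;>
    rcases Nat.mod_two_eq_zero_or_one y with hy | hy
  · obtain ⟨h1, e1⟩ := heven x (by omega) hx (by omega)
    obtain ⟨h2, e2⟩ := heven y (by omega) hy (by omega)
    rw [e1, e2]
    refine iff_of_false (not_allowedFlavor_fl_sub_fl fun h => ?_) (by omega)
    have := (hn.getElem_inj_iff).1 h
    omega
  · obtain ⟨h1, e1⟩ := heven x (by omega) hx (by omega)
    rw [e1, hodd y hy (by omega), zero_sub]
    exact iff_of_true (Or.inr ⟨_, Or.inr rfl⟩) (Or.inr hy)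
  · obtain ⟨h2, e2⟩ := heven y (by omega) hy (by omega)
    rw [e2, hodd x hx (by omega), sub_zero]
    exact iff_of_true (Or.inr ⟨_, Or.inl rfl⟩) (Or.inl hx)
  · rw [hodd x hx (by omega), hodd y hy (by omega), sub_zero]
    exact iff_of_true (Or.inl rfl) (Or.inl hx)

theorem mem_adjacentF1 {k x y : ℕ} : (x, y) ∈ adjacentF1 k ↔
    (x = 3 ∧ y = 5) ∨ (x = 2 ∧ y = 5) ∨ (x = 3 ∧ y % 2 = 0 ∧ 6 ≤ y ∧ y ≤ 2 * k) := by
  simp only [adjacentF1, Finset.mem_union, Finset.mem_insert, Finset.mem_singleton,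
    Finset.mem_image, Finset.mem_Icc, Prod.mk.injEq, or_assoc]
  refine or_congr_right (or_congr_right ⟨?_, fun h => ⟨y / 2, by omega, by omega, by omega⟩⟩)
  rintro ⟨i, h1, h2, h3⟩
  omega

theorem mem_adjacentF2 {k x y : ℕ} (hk : 3 ≤ k) : (x, y) ∈ adjacentF2 k ↔
    (x = 1 ∧ y = 4) ∨ (x = 4 ∧ y % 2 = 1 ∧ 7 ≤ y ∧ y ≤ 2 * k) := by
  simp only [adjacentF2, Finset.mem_inter, Finset.mem_image, Finset.mem_Icc, mem_diagonals]
  constructor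
  · rintro ⟨⟨j, h1, h2⟩, h3⟩
    rcases Nat.lt_or_ge j 3 with hj | hj
    · rw [chord_comm, chord_of_le (by omega) (by omega), Prod.mk.injEq] at h2
      omega
    · rw [chord_of_le (by omega) (by omega), Prod.mk.injEq] at h2
      omega
  · rintro (⟨rfl, rfl⟩ | ⟨rfl, h1, h2, h3⟩)
    · exact ⟨⟨1, by omega, by rw [chord_comm, chord_of_le (by omega) (by omega)]⟩, by omega⟩
    · refine ⟨⟨(y + 1) / 2, by omega, ?_⟩, by omega⟩
      rw [chord_of_le (by omega) (by omega), Prod.mk.injEq]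
      omega

theorem adjacentLam_F1 {k : ℕ} {D : ℕ × ℕ} (hD : D ∈ adjacentF1 k) : adjacentLam k D = 1 :=
  if_pos hD

theorem adjacentLam_F2 {k : ℕ} (hk : 3 ≤ k) {D : ℕ × ℕ} (hD : D ∈ adjacentF2 k) :
    adjacentLam k D = -1 := by
  obtain ⟨x, y⟩ := D
  rw [adjacentLam, if_neg, if_pos hD]
  rw [mem_adjacentF2 hk] at hD
  rw [mem_adjacentF1]
  omega

/-- On odd right ends, the rows `2`, `3` and `4` of the direction all drop by one from `5` to `7`
and stay constant afterwards, so mixed differences over `(x, x + 1)` vanish. For the block `(3, 5)`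
the value on `X_{3,5}` compensates the one on `X_{3,m+1}`. -/
theorem adjacent_homogeneous (hrs : 2 ≤ rs.length) :
    ∀ p ∈ constraints (adjacentPairs rs), mandelstam (2 * (rs.length + 1))
      (shiftDir (adjacentF1 (rs.length + 1) ∪ adjacentF2 (rs.length + 1))
        (adjacentLam (rs.length + 1))) p = 0 := by
  set k := rs.length + 1 with hk
  have hk3 : 3 ≤ k := by omega
  set V := shiftDir (adjacentF1 k ∪ adjacentF2 k) (adjacentLam k) with hV
  have hV1 : ∀ D ∈ adjacentF1 k, V D = 1 := fun D hD => by
    rw [hV, shiftDir, if_pos (Finset.mem_union_left _ hD), adjacentLam_F1 hD]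
  have hV2 : ∀ D ∈ adjacentF2 k, V D = -1 := fun D hD => by
    rw [hV, shiftDir, if_pos (Finset.mem_union_right _ hD), adjacentLam_F2 hk3 hD]
  have hdiag : ∀ D ∈ adjacentF1 k ∪ adjacentF2 k, D ∈ diagonals (2 * k) := by
    rintro ⟨x, y⟩ hD
    rw [Finset.mem_union, mem_adjacentF1, mem_adjacentF2 hk3] at hD
    rw [mem_diagonals]; simp only; omega
  have gpos : ∀ x y, (x = 3 ∧ y = 5) ∨ (x = 2 ∧ y = 5) ∨
      (x = 3 ∧ y % 2 = 0 ∧ 6 ≤ y ∧ y ≤ 2 * k) → planar (2 * k) V x y = 1 := by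
    intro x y h
    rw [planar, chord_of_le (by omega) (by omega),
      if_pos (hdiag _ (Finset.mem_union_left _ (mem_adjacentF1.2 h))), hV1 _ (mem_adjacentF1.2 h)]
  have gneg : ∀ y, y % 2 = 1 → 7 ≤ y → y ≤ 2 * k + 1 → planar (2 * k) V 4 y = -1 := by
    intro y h1 h2 h3
    have hmem : chord (2 * k) 4 y ∈ adjacentF2 k := by
      rcases chord_cases (by omega : 1 ≤ 4) (by omega : 4 < y) h3 with ⟨h, e⟩ | ⟨h, e⟩ <;>
        rw [e, mem_adjacentF2 hk3] <;> omega
    rw [planar, if_pos (hdiag _ (Finset.mem_union_right _ hmem)), hV2 _ hmem]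
  have gzero : ∀ x y, 2 ≤ x → x < y → y ≤ 2 * k + 1 → ¬ ((x = 3 ∧ y = 5) ∨ (x = 2 ∧ y = 5) ∨
      (x = 3 ∧ y % 2 = 0 ∧ 6 ≤ y) ∨ (x = 4 ∧ y % 2 = 1 ∧ 7 ≤ y)) → planar (2 * k) V x y = 0 := by
    intro x y h1 h2 h3 h4
    rw [planar]
    split_ifs with hD
    · rw [hV, shiftDir, if_neg]
      rcases chord_cases (by omega : 1 ≤ x) h2 h3 with ⟨h, e⟩ | ⟨h, e⟩ <;>
        rw [e, Finset.mem_union, mem_adjacentF1, mem_adjacentF2 hk3] <;> omega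
    · rfl
  intro p hp
  rcases constraints_adjacentPairs rs (prev := []) le_rfl rfl (by simp) rfl p hp with
    ⟨x, m, h1, h2, h3, h4, rfl⟩ | ⟨x, m, h1, h2, h3, h4, h5, rfl⟩
  · simp only [mandelstam]
    rw [gzero x (x + 1) (by omega) (by omega) (by omega) (by omega),
      gzero m (m + 2) (by omega) (by omega) (by omega) (by omega)]
    rcases (by omega : x = 2 ∨ x = 3 ∨ x = 4 ∨ 5 ≤ x) with rfl | rfl | rfl | hx
    · rw [gzero 2 (m + 2) (by omega) (by omega) (by omega) (by omega),
        gzero 3 (m + 2) (by omega) (by omega) (by omega) (by omega)]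
      by_cases hm : m = 5
      · rw [gpos 3 m (by omega), gpos 2 m (by omega)]; ring
      · rw [gzero 3 m (by omega) (by omega) (by omega) (by omega),
          gzero 2 m (by omega) (by omega) (by omega) (by omega)]; ring
    · rw [gzero 3 (m + 2) (by omega) (by omega) (by omega) (by omega),
        gneg (m + 2) (by omega) (by omega) (by omega)]
      by_cases hm : m = 5
      · rw [gpos 3 m (by omega), gzero 4 m (by omega) (by omega) (by omega) (by omega)]; ring
      · rw [gzero 3 m (by omega) (by omega) (by omega) (by omega),
          gneg m (by omega) (by omega) (by omega)]; ring
    · rw [gneg (m + 2) (by omega) (by omega) (by omega), gneg m (by omega) (by omega) (by omega),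
        gzero 5 m (by omega) (by omega) (by omega) (by omega),
        gzero 5 (m + 2) (by omega) (by omega) (by omega) (by omega)]; ring
    · rw [gzero x (m + 2) (by omega) (by omega) (by omega) (by omega),
        gzero x m (by omega) (by omega) (by omega) (by omega),
        gzero (x + 1) m (by omega) (by omega) (by omega) (by omega),
        gzero (x + 1) (m + 2) (by omega) (by omega) (by omega) (by omega)]; ring
  · simp only [mandelstam]
    rw [gzero (m + 1) (m + 2) (by omega) (by omega) (by omega) (by omega),
      gzero (x + 2) (m + 1) (by omega) (by omega) (by omega) (by omega),
      gzero (x + 2) (m + 2) (by omega) (by omega) (by omega) (by omega),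
      gzero x (m + 2) (by omega) (by omega) (by omega) (by omega)]
    by_cases hx : x = 3
    · rw [gpos x (x + 2) (by omega), gpos x (m + 1) (by omega)]; ring
    · rw [gzero x (x + 2) (by omega) (by omega) (by omega) (by omega),
        gzero x (m + 1) (by omega) (by omega) (by omega) (by omega)]; ring

/-- A diagonal across `(3, 5)` ends at `4`, so if allowed its other end is odd and it is negative.
If conversely `(3, 5)` is the only diagonal in `F`, then the absence of `(2, 5)` and of the `(3,
2i)` forces the triangle beyond `(3, 5)` to have an odd third vertex, and `(3, 5)` flips to the
diagonal from `4` to that vertex. -/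
theorem adjacent_flipShift (hn : (r₁ :: rs).Nodup) (hrs : 2 ≤ rs.length) :
    FlipShift (ordering r₁ (adjacentPairs rs)) (constraints (adjacentPairs rs))
      (adjacentBasis (rs.length + 1)) (3, 5)
      (adjacentF1 (rs.length + 1) ∪ adjacentF2 (rs.length + 1)) (adjacentLam (rs.length + 1)) := by
  have hlen := length_ordering_adjacentPairs (r₁ := r₁) (rs := rs)
  have hallow := fun {x y} => allowed_adjacentPairs hn (x := x) (y := y)
  have hbasis : IsPlanarBasis (ordering r₁ (adjacentPairs rs)) (constraints (adjacentPairs rs))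
      (adjacentBasis (rs.length + 1)) := by
    rw [adjacentBasis_eq hrs]
    refine isPlanarBasis_preferredBasis (fun h => ?_) (by rwa [flavors_adjacentPairs])
    have := size_adjacentPairs rs
    rw [h, Blocks.size] at this
    omega
  have hhom := adjacent_homogeneous hrs
  set k := rs.length + 1 with hk
  set α := ordering r₁ (adjacentPairs rs) with hα
  have hk3 : 3 ≤ k := by omega
  have hF : ∀ {x y}, (x, y) ∈ adjacentF1 k ∪ adjacentF2 k ↔
      ((x = 3 ∧ y = 5) ∨ (x = 2 ∧ y = 5) ∨ (x = 3 ∧ y % 2 = 0 ∧ 6 ≤ y ∧ y ≤ 2 * k)) ∨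
      ((x = 1 ∧ y = 4) ∨ (x = 4 ∧ y % 2 = 1 ∧ 7 ≤ y ∧ y ≤ 2 * k)) := fun {x y} => by
    rw [Finset.mem_union, mem_adjacentF1, mem_adjacentF2 hk3]
  have hmem : ∀ D ∈ adjacentF1 k ∪ adjacentF2 k, D ∈ diagonals α.length ∧ Allowed α D := by
    rintro ⟨x, y⟩ hD
    rw [hF] at hD
    have hd : (x, y) ∈ diagonals (2 * k) := by rw [mem_diagonals]; simp only; omega
    exact ⟨by rwa [hlen], (hallow hd).2 (by omega)⟩
  have hT : ∀ {T}, T ∈ feynmanDiagrams α → ∀ {x y}, (x, y) ∈ T →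
      (1 ≤ x ∧ x + 2 ≤ y ∧ y ≤ 2 * k ∧ ¬ (x = 1 ∧ y = 2 * k)) ∧ (x % 2 = 1 ∨ y % 2 = 1) := by
    intro T hT x y hE
    rw [mem_feynmanDiagrams, hlen] at hT
    have h1 := mem_diagonals.1 (hT.1 hE)
    simp only at h1
    exact ⟨by omega, (hallow (hT.1 hE)).1 (hT.2.2.1 _ hE)⟩
  have hX : ∀ {T}, T ∈ feynmanDiagrams α → ∀ {x y x' y'}, (x, y) ∈ T → (x', y') ∈ T →
      ¬ (x < x' ∧ x' < y ∧ y < y') := by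
    intro T hT' x y x' y' hE hE' h
    exact (mem_feynmanDiagrams.1 hT').2.2.2 _ hE _ hE' (Or.inl h)
  have hfour : ∀ {T}, T ∈ feynmanDiagrams α → ∀ {x y}, (x, y) ∈ T → x = 4 ∨ y = 4 →
      (x, y) ∈ adjacentF2 k := by
    intro T hT' x y hE h
    have := hT hT' hE
    rw [mem_adjacentF2 hk3]; omega
  have hD₀ : (3, 5) ∈ adjacentF1 k ∪ adjacentF2 k := hF.2 (by omega)
  have hmeets : ∀ T ∈ feynmanDiagrams α, (3, 5) ∉ T → ∃ E ∈ T, E ∈ adjacentF2 k := by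
    intro T hT' h0
    by_contra hcon
    push Not at hcon
    refine h0 (mem_of_not_crossing hT' (hmem _ hD₀).1 ?_)
    rintro ⟨x, y⟩ hE hX'
    simp only [Crossing] at hX'
    exact hcon _ hE (hfour hT' hE (by omega))
  constructor
  · exact hbasis
  · exact hmem
  · intro D hD
    rcases Finset.mem_union.1 hD with h | h
    · exact Or.inl (adjacentLam_F1 h)
    · exact Or.inr (adjacentLam_F2 hk3 h)
  · exact hD₀
  · exact Or.inl ⟨2, by omega, by omega, by rw [chord_of_le (by omega) (by omega)]⟩
  · exact adjacentLam_F1 (mem_adjacentF1.2 (by omega))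
  · rintro ⟨x, y⟩ hD hne hDF
    rw [hF] at hDF
    have hodd : x % 2 = 1 ∧ y % 2 = 1 := by
      rcases hD with ⟨i, h1, h2, h3⟩ | ⟨j, h1, h2, h3⟩
      · rcases chord_cases (by omega : 1 ≤ 2 * i - 1) (by omega : 2 * i - 1 < 2 * i + 1)
          (by omega : 2 * i + 1 ≤ 2 * k + 1) with ⟨-, e⟩ | ⟨-, e⟩ <;>
          rw [e, Prod.mk.injEq] at h3 <;> omega
      · rw [Prod.mk.injEq] at h3; omega
    refine hne (Prod.ext ?_ ?_) <;> simp only <;> omega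
  · rw [hlen]; exact hhom
  · intro T hT'
    by_cases h : (3, 5) ∈ T
    · exact ⟨_, h, hD₀⟩
    · obtain ⟨E, hE, hEF⟩ := hmeets T hT' h
      exact ⟨E, hE, Finset.mem_union_right _ hEF⟩
  · intro T hT' D hD hne hTF
    have hDT : D ∈ T := Finset.mem_of_mem_inter_left (hTF ▸ Finset.mem_singleton_self D)
    have huniq : ∀ E ∈ T, E ∈ adjacentF1 k ∪ adjacentF2 k → E = D := fun E hE hEF => by
      have := Finset.mem_inter.2 ⟨hE, hEF⟩
      rwa [hTF, Finset.mem_singleton] at this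
    have hT₀ : (3, 5) ∉ T := fun h => hne (huniq _ h hD₀).symm
    obtain ⟨E, hE, hEF⟩ := hmeets T hT' hT₀
    obtain rfl := huniq E hE (Finset.mem_union_right _ hEF)
    refine ⟨adjacentLam_F2 hk3 hEF, insert_erase_mem_feynmanDiagrams hT' hDT (hmem _ hD₀).1
      (hmem _ hD₀).2 ?_ hT₀⟩
    rintro ⟨x, y⟩ hE' hX'
    simp only [Crossing] at hX'
    exact huniq _ hE' (Finset.mem_union_right _ (hfour hT' hE' (by omega)))
  · intro T hT' hTF
    have hDT : (3, 5) ∈ T := Finset.mem_of_mem_inter_left (hTF ▸ Finset.mem_singleton_self _)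
    have huniq : ∀ {x y}, (x, y) ∈ T → (x, y) ∈ adjacentF1 k ∪ adjacentF2 k → x = 3 ∧ y = 5 :=
      fun {x y} hE hEF => by
        have := Finset.mem_inter.2 ⟨hE, hEF⟩
        rwa [hTF, Finset.mem_singleton, Prod.mk.injEq] at this
    have hno4 : ∀ {x y}, (x, y) ∈ T → x ≠ 4 ∧ y ≠ 4 := fun {x y} hE => by
      by_contra hcon
      have := huniq hE (Finset.mem_union_right _ (hfour hT' hE (by omega)))
      omega
    have key : ∀ D ∈ adjacentF2 k, (∀ E ∈ T, Crossing D E → E = (3, 5)) →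
        ∃ D ∈ adjacentF1 k ∪ adjacentF2 k, D ≠ (3, 5) ∧
          insert D (T.erase (3, 5)) ∈ feynmanDiagrams α := by
      rintro ⟨x, y⟩ hD hc
      have hDF := Finset.mem_union_right (adjacentF1 k) hD
      have hne : (x, y) ≠ (3, 5) := by
        rw [mem_adjacentF2 hk3] at hD
        rw [Ne, Prod.mk.injEq]; omega
      refine ⟨(x, y), hDF, hne, insert_erase_mem_feynmanDiagrams hT' hDT (hmem _ hDF).1
        (hmem _ hDF).2 hc fun h => ?_⟩
      have := huniq h hDF
      exact hne (Prod.ext this.1 this.2)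
    -- The third vertex of the triangle beyond `(3, 5)` is the smallest `x > 5` joined to `3`, if
    -- there is one.
    by_cases hex : ∃ x, 5 < x ∧ (3, x) ∈ T
    · obtain ⟨hx5, hx⟩ := Nat.find_spec hex
      have hmin : ∀ y, 5 < y → (3, y) ∈ T → Nat.find hex ≤ y := fun y h1 h2 =>
        Nat.find_min' hex ⟨h1, h2⟩
      set x := Nat.find hex
      have hx' := hT hT' hx
      have hxF : (3, x) ∉ adjacentF1 k ∪ adjacentF2 k := fun h => by
        have := huniq hx h; omega
      rw [hF] at hxF
      refine key (4, x) ((mem_adjacentF2 hk3).2 (by omega)) ?_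
      rintro ⟨u, v⟩ hE hc
      simp only [Crossing] at hc
      have h1 := hT hT' hE
      have h2 := hX hT' hx hE
      have h3 := hX hT' hE hx
      have h4 := hno4 hE
      have hu : u = 3 := by omega
      subst hu
      have h5 := fun h => hmin v h hE
      rw [Prod.mk.injEq]
      omega
    · push Not at hex
      have h3 : ∀ {x y}, (x, y) ∈ T → x = 3 → y = 5 := by
        rintro x y hE rfl
        have h1 := hT hT' hE
        have h2 := hno4 hE
        by_contra h
        exact hex y (by omega) hE
      -- Otherwise the third vertex is `1` or `2`. Without `(1, 3)` nothing in `T` crosses `(2, 5)`,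
      -- which would then be a second diagonal of `T` in `F`.
      have h13 : (1, 3) ∈ T := by
        by_contra h
        have h25 : (2, 5) ∈ adjacentF1 k ∪ adjacentF2 k := hF.2 (by omega)
        have := huniq (mem_of_not_crossing hT' (hmem _ h25).1 ?_) h25
        · omega
        · rintro ⟨u, v⟩ hE hc
          simp only [Crossing] at hc
          have h1 := hT hT' hE
          have h2 := hno4 hE
          have h4 := h3 hE
          have h5 : ¬ (u = 1 ∧ v = 3) := by rintro ⟨rfl, rfl⟩; exact h hE
          omega
      refine key (1, 4) ((mem_adjacentF2 hk3).2 (by omega)) ?_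
      rintro ⟨u, v⟩ hE hc
      simp only [Crossing] at hc
      have h1 := hT hT' hE
      have h2 := hX hT' h13 hE
      have h4 := h3 hE
      rw [Prod.mk.injEq]
      omega
  · rintro ⟨x, y⟩ hD ⟨x', y'⟩ hE hl hl'
    have hneg : ∀ D ∈ adjacentF1 k ∪ adjacentF2 k, adjacentLam k D = -1 → D ∈ adjacentF2 k := by
      intro D hD hl
      refine (Finset.mem_union.1 hD).resolve_left fun h => ?_
      rw [adjacentLam_F1 h] at hl
      norm_num at hl
    have h1 := (mem_adjacentF2 hk3).1 (hneg _ hD hl)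
    have h2 := (mem_adjacentF2 hk3).1 (hneg _ hE hl')
    simp only [Crossing]; omega

end adjacent

/-! ### Cyclic invariance of the amplitudes -/

theorem amplitude_congr {α : List Flavor} {X X' : Kin}
    (h : ∀ D ∈ diagonals α.length, X D = X' D) : amplitude α X = amplitude α X' :=
  Finset.sum_congr rfl fun T hT => Finset.prod_congr rfl fun D hD => by
    rw [h D ((mem_feynmanDiagrams.1 hT).1 hD)]

/-- The rotation of the `n`-gon by one step and its inverse. -/
def rotateDiag (n : ℕ) (D : ℕ × ℕ) : ℕ × ℕ :=
  if D.2 = n then (1, D.1 + 1) else (D.1 + 1, D.2 + 1)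

def unrotateDiag (n : ℕ) (D : ℕ × ℕ) : ℕ × ℕ :=
  if D.1 = 1 then (D.2 - 1, n) else (D.1 - 1, D.2 - 1)

section rotate

variable {n : ℕ} {D E : ℕ × ℕ}

theorem rotateDiag_mem (hD : D ∈ diagonals n) : rotateDiag n D ∈ diagonals n := by
  rw [mem_diagonals] at hD
  rw [rotateDiag]
  split_ifs <;> rw [mem_diagonals] <;> simp only <;> omega

theorem unrotateDiag_mem (hD : D ∈ diagonals n) : unrotateDiag n D ∈ diagonals n := by
  rw [mem_diagonals] at hD
  rw [unrotateDiag]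
  split_ifs <;> rw [mem_diagonals] <;> simp only <;> omega

theorem unrotateDiag_rotateDiag (hD : D ∈ diagonals n) :
    unrotateDiag n (rotateDiag n D) = D := by
  rw [mem_diagonals] at hD
  obtain ⟨x, y⟩ := D
  simp only [rotateDiag, unrotateDiag] at hD ⊢
  by_cases h : y = n
  · rw [if_pos h, if_pos rfl]; simp [h]
  · rw [if_neg h, if_neg (by simp only; omega)]; simp

theorem rotateDiag_unrotateDiag (hD : D ∈ diagonals n) :
    rotateDiag n (unrotateDiag n D) = D := by
  rw [mem_diagonals] at hD
  obtain ⟨x, y⟩ := D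
  simp only [rotateDiag, unrotateDiag] at hD ⊢
  by_cases h : x = 1
  · rw [if_pos h, if_pos rfl, Prod.mk.injEq]; simp only; omega
  · rw [if_neg h, if_neg (by simp only; omega), Prod.mk.injEq]; simp only; omega

theorem crossing_rotateDiag (hD : D ∈ diagonals n) (hE : E ∈ diagonals n) :
    Crossing (rotateDiag n D) (rotateDiag n E) ↔ Crossing D E := by
  rw [mem_diagonals] at hD hE
  simp only [rotateDiag, Crossing]
  split_ifs <;> simp only <;> omega

theorem crossing_unrotateDiag (hD : D ∈ diagonals n) (hE : E ∈ diagonals n) :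
    Crossing (unrotateDiag n D) (unrotateDiag n E) ↔ Crossing D E := by
  rw [← crossing_rotateDiag (unrotateDiag_mem hD) (unrotateDiag_mem hE),
    rotateDiag_unrotateDiag hD, rotateDiag_unrotateDiag hE]

theorem chord_rotate (hD : D ∈ diagonals n) :
    chord n ((D.1 - 1 + 1) % n + 1) ((D.2 - 1 + 1) % n + 1) = rotateDiag n D := by
  rw [mem_diagonals] at hD
  rw [Nat.sub_add_cancel hD.1, Nat.sub_add_cancel (by omega), Nat.mod_eq_of_lt (by omega : D.1 < n),
    rotateDiag]
  split_ifs with h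
  · rw [h, Nat.mod_self, chord_comm, zero_add, chord_of_le (by omega) (by omega)]
  · rw [Nat.mod_eq_of_lt (by omega : D.2 < n), chord_of_le (by omega) (by omega)]

theorem chord_id (hD : D ∈ diagonals n) :
    chord n ((D.1 - 1 + 0) % n + 1) ((D.2 - 1 + 0) % n + 1) = D := by
  rw [mem_diagonals] at hD
  rw [Nat.mod_eq_of_lt (by omega : D.1 - 1 + 0 < n), Nat.mod_eq_of_lt (by omega : D.2 - 1 + 0 < n),
    show D.1 - 1 + 0 + 1 = D.1 by omega, show D.2 - 1 + 0 + 1 = D.2 by omega,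
    chord_of_le (by omega) (by omega)]

end rotate

theorem height_rotate_one (x : Flavor) (β : List Flavor) {v : ℕ} (h1 : 1 ≤ v)
    (h2 : v ≤ β.length + 1) : height (x :: β) (v + 1) = x + height (β ++ [x]) v := by
  obtain ⟨v, rfl⟩ : ∃ u, v = u + 1 := ⟨v - 1, by omega⟩
  simp only [height, Nat.add_sub_cancel, List.take_succ_cons, List.sum_cons]
  rw [List.take_append_of_le_length (by omega)]

/-- Rotation shifts all heights by the same flavour `x`. A diagonal that ends at the vertex `n` has
its two sides exchanged, and as the total flavour vanishes this costs only a sign. -/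
theorem allowed_rotate_one {x : Flavor} {β : List Flavor} (h : (x :: β).sum = 0) {D : ℕ × ℕ}
    (hD : D ∈ diagonals (β.length + 1)) :
    Allowed (x :: β) (rotateDiag (β.length + 1) D) ↔ Allowed (β ++ [x]) D := by
  rw [mem_diagonals] at hD
  obtain ⟨a, b⟩ := D
  simp only [rotateDiag] at hD ⊢
  have ha := height_rotate_one x β (v := a) (by omega) (by omega)
  have hb := height_rotate_one x β (v := b) (by omega) (by omega)
  by_cases hbn : b = β.length + 1
  · have hend : height (x :: β) (b + 1) = 0 := by
      rw [height, List.take_of_length_le (by simp [hbn]), h]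
    rw [if_pos hbn, allowed_iff (by omega), allowed_iff (by omega), ← allowedFlavor_neg, neg_sub]
    rw [hend] at hb
    rw [ha, eq_neg_of_add_eq_zero_right hb.symm, show height (x :: β) 1 = 0 from rfl]
    abel_nf
  · rw [if_neg hbn, allowed_iff (by omega), allowed_iff (by omega), ha, hb, add_sub_add_left_eq_sub]

theorem mem_feynmanDiagrams_image {β γ : List Flavor} (hl : γ.length = β.length)
    {φ ψ : ℕ × ℕ → ℕ × ℕ} (hφ : ∀ D ∈ diagonals β.length, φ D ∈ diagonals β.length)
    (hinv : ∀ D ∈ diagonals β.length, ψ (φ D) = D)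
    (hA : ∀ D ∈ diagonals β.length, Allowed β D → Allowed γ (φ D))
    (hc : ∀ D ∈ diagonals β.length, ∀ E ∈ diagonals β.length, Crossing (φ D) (φ E) → Crossing D E)
    {T : Finset (ℕ × ℕ)} (hT : T ∈ feynmanDiagrams β) : T.image φ ∈ feynmanDiagrams γ := by
  rw [mem_feynmanDiagrams] at hT ⊢
  obtain ⟨h1, h2, h3, h4⟩ := hT
  refine ⟨?_, ?_, ?_, ?_⟩
  · intro D hD
    obtain ⟨D, hDT, rfl⟩ := Finset.mem_image.1 hD
    rw [hl]; exact hφ D (h1 hDT)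
  · rw [Finset.card_image_of_injOn, h2, hl]
    intro D hD E hE h
    rw [← hinv D (h1 hD), h, hinv E (h1 hE)]
  · intro D hD
    obtain ⟨D, hDT, rfl⟩ := Finset.mem_image.1 hD
    exact hA D (h1 hDT) (h3 D hDT)
  · intro D hD E hE h
    obtain ⟨D, hDT, rfl⟩ := Finset.mem_image.1 hD
    obtain ⟨E, hET, rfl⟩ := Finset.mem_image.1 hE
    exact h4 D hDT E hET (hc D (h1 hDT) E (h1 hET) h)

theorem image_image_eq_self {φ ψ : ℕ × ℕ → ℕ × ℕ} {T : Finset (ℕ × ℕ)} (h : ∀ D ∈ T, ψ (φ D) = D) :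
    (T.image φ).image ψ = T := by
  rw [Finset.image_image]
  exact (Finset.image_congr fun D hD => h D hD).trans Finset.image_id

theorem amplitude_rotate_one {x : Flavor} {β : List Flavor} (h : (x :: β).sum = 0) (X : Kin) :
    amplitude (x :: β) X = amplitude (β ++ [x]) fun D => X (rotateDiag (β.length + 1) D) := by
  have hl : (β ++ [x]).length = (x :: β).length := by simp
  have hn : (x :: β).length = β.length + 1 := by simp
  refine Eq.symm (Finset.sum_bij' (fun T _ => T.image (rotateDiag (β.length + 1)))
    (fun T _ => T.image (unrotateDiag (β.length + 1))) ?_ ?_ ?_ ?_ ?_)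
  · intro T hT
    refine mem_feynmanDiagrams_image (ψ := unrotateDiag (β.length + 1)) hl.symm ?_ ?_ ?_ ?_ hT <;>
      rw [hl, hn]
    · exact fun D hD => rotateDiag_mem hD
    · exact fun D hD => unrotateDiag_rotateDiag hD
    · exact fun D hD hA => (allowed_rotate_one h hD).2 hA
    · exact fun D hD E hE hc => (crossing_rotateDiag hD hE).1 hc
  · intro T hT
    refine mem_feynmanDiagrams_image (ψ := rotateDiag (β.length + 1)) hl ?_ ?_ ?_ ?_ hT <;>
      rw [hn]
    · exact fun D hD => unrotateDiag_mem hD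
    · exact fun D hD => rotateDiag_unrotateDiag hD
    · intro D hD hA
      rwa [← allowed_rotate_one h (unrotateDiag_mem hD), rotateDiag_unrotateDiag hD]
    · exact fun D hD E hE hc => (crossing_unrotateDiag hD hE).1 hc
  · intro T hT
    have h1 := (mem_feynmanDiagrams.1 hT).1
    rw [hl, hn] at h1
    exact image_image_eq_self fun D hD => unrotateDiag_rotateDiag (h1 hD)
  · intro T hT
    have h1 := (mem_feynmanDiagrams.1 hT).1
    rw [hn] at h1
    exact image_image_eq_self fun D hD => rotateDiag_unrotateDiag (h1 hD)
  · intro T hT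
    have h1 := (mem_feynmanDiagrams.1 hT).1
    rw [hl, hn] at h1
    refine (Finset.prod_image (f := fun D => (X D)⁻¹) fun D hD E hE he => ?_).symm
    rw [← unrotateDiag_rotateDiag (h1 hD), he, unrotateDiag_rotateDiag (h1 hE)]

/-! ### The channels of adjacent pairs -/

theorem isLowerAdjacent_word {k : ℕ} {rs : List ℕ} (hn : rs.Nodup) (h2 : 2 ≤ rs.length)
    (hk : rs.length < k) : IsLowerAdjacent k (adjacentPairs rs).word :=
  ⟨rs, 0, hn, h2, hk, List.rotate_zero _, fun X => amplitude_congr fun D hD => by rw [chord_id hD]⟩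

/-- The first particle is the partner of the last one; moving it to the end completes that pair. -/
theorem isLowerAdjacent_rotate {k r : ℕ} {rs : List ℕ} (hn : (r :: rs).Nodup)
    (h2 : 1 ≤ rs.length) (hk : rs.length + 1 < k) :
    IsLowerAdjacent k (-fl r :: ((adjacentPairs rs).word ++ [fl r])) := by
  have hw : (adjacentPairs rs).word ++ [fl r] ++ [-fl r] = (adjacentPairs (rs ++ [r])).word := by
    rw [word_adjacentPairs_append, List.append_assoc]; rfl
  refine ⟨rs ++ [r], 1, ?_, by simpa using h2, by simpa using hk, ?_, fun X => ?_⟩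
  · exact (List.perm_append_singleton r rs).nodup_iff.2 hn
  · rw [← hw, List.rotate_cons_succ, List.rotate_zero]
  · rw [amplitude_rotate_one (by
      rw [List.sum_cons, List.sum_append, sum_word_adjacentPairs]; simp), hw]
    refine amplitude_congr fun D hD => ?_
    rw [← hw] at hD
    have hl : ((adjacentPairs rs).word ++ [fl r] ++ [-fl r]).length =
        (-fl r :: ((adjacentPairs rs).word ++ [fl r])).length := by simp
    rw [hl] at hD
    rw [chord_rotate hD]
    rfl

theorem leftOrdering_append (u v w : List Flavor) {a b : ℕ} (ha : a = u.length + 1)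
    (hb : b = a + v.length) : leftOrdering (u ++ (v ++ w)) (a, b) = v ++ [-v.sum] ∧
      rightOrdering (u ++ (v ++ w)) (a, b) = u ++ v.sum :: w := by
  have e1 : a - 1 = u.length := by omega
  have e2 : b - 1 = (u ++ v).length := by rw [List.length_append]; omega
  have e3 : ((u ++ (v ++ w)).take (b - 1)).drop (a - 1) = v := by
    rw [← List.append_assoc, e2, List.take_left, e1, List.drop_left]
  refine ⟨?_, ?_⟩
  · simp only [leftOrdering, charge, e3]
  · simp only [rightOrdering, charge, e3]
    rw [e1, List.take_left, ← List.append_assoc, e2, List.drop_left]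

/-- Each of these channels cuts the line of one pair, and in both factors the internal particle
replaces the missing partner. Only `(3, 5)` cuts no line; its internal particle would be adjoint. -/
theorem isLowerAdjacent_channels {r₁ : ℕ} {rs : List ℕ} (hn : (r₁ :: rs).Nodup)
    (hrs : 2 ≤ rs.length) {D : ℕ × ℕ}
    (hD : D ∈ adjacentF1 (rs.length + 1) ∪ adjacentF2 (rs.length + 1)) (hne : D ≠ (3, 5)) :
    IsLowerAdjacent (rs.length + 1) (leftOrdering (ordering r₁ (adjacentPairs rs)) D) ∧
      IsLowerAdjacent (rs.length + 1) (rightOrdering (ordering r₁ (adjacentPairs rs)) D) := by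
  obtain ⟨x, y⟩ := D
  rw [Finset.mem_union, mem_adjacentF1, mem_adjacentF2 (by omega)] at hD
  have hα : ordering r₁ (adjacentPairs rs) = (adjacentPairs (r₁ :: rs)).word := rfl
  rcases hD with (⟨rfl, rfl⟩ | ⟨rfl, rfl⟩ | ⟨rfl, h1, h2, h3⟩) | (⟨rfl, rfl⟩ | ⟨rfl, h1, h2, h3⟩)
  · exact absurd rfl hne
  -- `X_{2,5}` cuts the pair `(1, 2)`: the left factor starts with the anti-fundamental particle `2`
  -- and ends with its internal partner.
  · obtain ⟨r₂, tl, rfl⟩ : ∃ r₂ tl, rs = r₂ :: tl := by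
      cases rs with
      | nil => simp at hrs
      | cons r₂ tl => exact ⟨r₂, tl, rfl⟩
    obtain ⟨e1, e2⟩ := leftOrdering_append [fl r₁] [-fl r₁, fl r₂, -fl r₂] (adjacentPairs tl).word
      (a := 2) (b := 5) rfl rfl
    rw [List.length_cons] at hrs ⊢
    have hs : [-fl r₁, fl r₂, -fl r₂].sum = -fl r₁ := by simp
    rw [hs] at e1 e2
    rw [neg_neg] at e1
    constructor
    · refine e1 ▸ isLowerAdjacent_rotate (rs := [r₂]) ?_ le_rfl (by simp; omega)
      simp at hn ⊢; tauto
    · refine e2 ▸ isLowerAdjacent_word (rs := r₁ :: tl) ?_ (by simpa using hrs) (by simp)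
      simp at hn ⊢; tauto
  -- `X_{3,y}` cuts the pair `(y - 1, y)` of flavour `s`; `pre` consists of the `(y - 4) / 2` pairs
  -- from particle `3` to `y - 2`.
  · obtain ⟨pre, s, post, rfl, hpre⟩ : ∃ pre s post, rs = pre ++ s :: post ∧
        pre.length = y / 2 - 2 := by
      refine ⟨rs.take (y / 2 - 2), rs[y / 2 - 2]'(by omega), rs.drop (y / 2 - 2 + 1), ?_, by
        rw [List.length_take]; omega⟩
      rw [List.getElem_cons_drop, List.take_append_drop]
    have hw : ordering r₁ (adjacentPairs (pre ++ s :: post)) = [fl r₁, -fl r₁] ++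
        (((adjacentPairs pre).word ++ [fl s]) ++ (-fl s :: (adjacentPairs post).word)) := by
      rw [hα, word_adjacentPairs_cons, word_adjacentPairs_append, word_adjacentPairs_cons]
      simp
    obtain ⟨e1, e2⟩ := leftOrdering_append [fl r₁, -fl r₁] ((adjacentPairs pre).word ++ [fl s])
      (-fl s :: (adjacentPairs post).word) (a := 3) (b := y) rfl (by
        rw [List.length_append, length_word_adjacentPairs, hpre, List.length_singleton]; omega)
    rw [← hw, List.sum_append, sum_word_adjacentPairs, zero_add, List.sum_singleton] at e1 e2
    rw [List.length_append, List.length_cons] at h3 ⊢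
    constructor
    · have hv : (adjacentPairs pre).word ++ [fl s] ++ [-fl s] =
          (adjacentPairs (pre ++ [s])).word := by
        rw [word_adjacentPairs_append, List.append_assoc]; rfl
      rw [e1, hv]
      refine isLowerAdjacent_word (hn.sublist ?_) ?_ ?_
      · exact ((List.Sublist.append_left (by simp) pre)).cons r₁
      · rw [List.length_append, List.length_singleton]; omega
      · rw [List.length_append, List.length_singleton]; omega
    · rw [e2]
      refine isLowerAdjacent_word (rs := r₁ :: s :: post) (hn.sublist ?_) (by simp) ?_
      · exact (List.sublist_append_right pre (s :: post)).cons_cons r₁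
      · simp only [List.length_cons]; omega
  · obtain ⟨r₂, tl, rfl⟩ : ∃ r₂ tl, rs = r₂ :: tl := by
      cases rs with
      | nil => simp at hrs
      | cons r₂ tl => exact ⟨r₂, tl, rfl⟩
    obtain ⟨e1, e2⟩ := leftOrdering_append [] [fl r₁, -fl r₁, fl r₂] (-fl r₂ :: (adjacentPairs tl).word)
      (a := 1) (b := 4) rfl rfl
    have hs : [fl r₁, -fl r₁, fl r₂].sum = fl r₂ := by simp
    rw [hs] at e1 e2
    constructor
    · refine e1 ▸ isLowerAdjacent_word (rs := [r₁, r₂]) (hn.sublist (by simp)) le_rfl ?_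
      simp only [List.length_cons, List.length_nil] at hrs ⊢; omega
    · exact e2 ▸ isLowerAdjacent_word (rs := r₂ :: tl) (hn.sublist (by simp)) hrs (by simp)
  -- `X_{4,y}` cuts the pair `(3, 4)`; `mid` consists of the `(y - 5) / 2` pairs from particle `5`
  -- to `y - 1`.
  · obtain ⟨r₂, mid, post, rfl, hmid⟩ : ∃ r₂ mid post, rs = r₂ :: (mid ++ post) ∧
        mid.length = y / 2 - 2 := by
      cases rs with
      | nil => simp at hrs
      | cons r₂ tl =>
        refine ⟨r₂, tl.take (y / 2 - 2), tl.drop (y / 2 - 2), by rw [List.take_append_drop], ?_⟩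
        rw [List.length_cons] at h3
        rw [List.length_take]; omega
    have hw : ordering r₁ (adjacentPairs (r₂ :: (mid ++ post))) = [fl r₁, -fl r₁, fl r₂] ++
        ((-fl r₂ :: (adjacentPairs mid).word) ++ (adjacentPairs post).word) := by
      rw [hα, word_adjacentPairs_cons, word_adjacentPairs_cons, word_adjacentPairs_append]
      simp
    obtain ⟨e1, e2⟩ := leftOrdering_append [fl r₁, -fl r₁, fl r₂]
      (-fl r₂ :: (adjacentPairs mid).word) (adjacentPairs post).word (a := 4) (b := y) rfl (by
        rw [List.length_cons, length_word_adjacentPairs, hmid]; omega)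
    rw [← hw, List.sum_cons, sum_word_adjacentPairs, add_zero] at e1 e2
    rw [neg_neg] at e1
    rw [List.length_cons, List.length_append] at h3 ⊢
    constructor
    · rw [e1]
      refine isLowerAdjacent_rotate (hn.sublist ?_) (by omega) (by omega)
      exact ((List.sublist_append_left mid post).cons_cons r₂).cons r₁
    · rw [e2]
      refine isLowerAdjacent_word (rs := r₁ :: r₂ :: post) (hn.sublist ?_) (by simp) ?_
      · exact ((List.sublist_append_right mid post).cons_cons r₂).cons_cons r₁
      · simp only [List.length_cons]; omega

end

/-! ### The two recursions -/

theorem mainTheorem3 :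
    (∀ (r₁ : ℕ) (rs : List ℕ), (r₁ :: rs).Nodup → 3 ≤ rs.length + 1 →
      IsPlanarBasis (ordering r₁ (adjacentPairs rs)) (constraints (adjacentPairs rs))
          (adjacentBasis (rs.length + 1)) ∧
        IsRecursion (ordering r₁ (adjacentPairs rs)) (constraints (adjacentPairs rs))
          (adjacentBasis (rs.length + 1)) (3, 5)
          (adjacentF1 (rs.length + 1) ∪ adjacentF2 (rs.length + 1))
          (adjacentLam (rs.length + 1)) ∧
        ∀ D ∈ adjacentF1 (rs.length + 1) ∪ adjacentF2 (rs.length + 1), D ≠ (3, 5) →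
          IsLowerAdjacent (rs.length + 1) (leftOrdering (ordering r₁ (adjacentPairs rs)) D) ∧
            IsLowerAdjacent (rs.length + 1) (rightOrdering (ordering r₁ (adjacentPairs rs)) D)) ∧
    (∀ (r₁ r₂ : ℕ) (S : Blocks), (r₁ :: r₂ :: S.flavors).Nodup → S ≠ .nil →
      IsPlanarBasis (ordering r₁ (.pair r₂ S .nil)) (constraints (.pair r₂ S .nil))
          (preferredBasis (.pair r₂ S .nil)) ∧
        IsRecursion (ordering r₁ (.pair r₂ S .nil)) (constraints (.pair r₂ S .nil))
          (preferredBasis (.pair r₂ S .nil)) (3, S.size + 4)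
          (twoBlockF1 S ∪ twoBlockF3 S) (twoBlockLam S) ∧
        ∀ D ∈ twoBlockF1 S ∪ twoBlockF3 S,
          charge (ordering r₁ (.pair r₂ S .nil)) D = fl r₂) := by
  refine ⟨fun r₁ rs hn hrs => ?_, fun r₁ r₂ S hn hS => ?_⟩
  · have h := adjacent_flipShift hn (by omega)
    exact ⟨h.basis, h.isRecursion, fun D hD hne => isLowerAdjacent_channels hn (by omega) hD hne⟩
  · have h := twoBlock_flipShift hn hS
    exact ⟨h.basis, h.isRecursion, fun D hD => charge_twoBlockF hn hS hD⟩
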